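/- Let $n\ge 0$ and $r\ge 1$, and write $\mathbb{C}_h=\mathbb{C}[[h]]$. Let $\mathcal{D}$ be the formal Weyl algebra: $\mathbb{C}[[x_1,\dots,x_n,y_1,\dots,y_n,h]]$ as a vector space, with the normally ordered product in which $[y_i,x_j]=\delta_{ij}h$ and all other commutators of generators vanish. Let $\mathfrak{m}=\langle x_i,y_j,h\rangle$ and $\mathcal{J}=\langle y_j,h\rangle$ (two-sided ideals). Let $\mathcal{M}_r=\mathbb{C}[[x_1,\dots,x_n,h]]^{\oplus r}$ be the $\mathcal{D}$-module on which $x_i,h$ act by multiplication and $y_j$ by $h\,\partial/\partial x_j$. Let $\mathrm{Aut}(\mathcal{D},\mathcal{M}_r)$ be the pro-algebraic group of pairs $(\Phi,\Psi)$, where $\Phi$ is a $\mathbb{C}_h$-algebra automorphism of $\mathcal{D}$ preserving $\mathfrak{m}$, $\Psi$ is an invertible $\mathbb{C}_h$-linear map of $\mathcal{M}_r$, and $\Psi(am)=\Phi(a)\Psi(m)$. Let $\mathrm{Der}(\mathcal{D},\mathcal{M}_r)$ be the Lie algebra of pairs $(\phi,\psi)$ of $\mathbb{C}_h$-linear maps,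 where $\phi$ is a derivation of $\mathcal{D}$ (not necessarily preserving $\mathfrak m$) and $\psi(am)=\phi(a)m+a\psi(m)$. The constant scalars give $\mathbb{C}^*\subset\mathrm{Aut}(\mathcal{D},\mathcal{M}_r)$ and $\mathbb{C}\subset\mathrm{Der}(\mathcal{D},\mathcal{M}_r)$. Let $\frac1h\mathcal{J}$ carry the commutator bracket. Let $GL_h(r)$, $PGL_h(r)$ be $GL(r)$, $PGL(r)$ with entries in $\mathbb{C}_h$, let $\mathfrak{pgl}_h(r)=\mathfrak{gl}_r(\mathbb{C}_h)/\mathbb{C}_h$, and let $\exp(h\,\mathfrak{pgl}_h(r))$ be the kernel of $PGL_h(r)\to PGL(r)$, $h\mapsto 0$, on which $GL(r)$ acts by conjugation. A Harish-Chandra pair $\langle G,\mathfrak h\rangle$ is a pro-algebraic group $G$ and a Lie algebra $\mathfrak h$ with a $G$-action and an embedding $\mathrm{Lie}(G)\subset\mathfrak h$; an isomorphism of pairs is a pair of isomorphisms of the groups and of the Lie algebras compatible with the actions and with these embeddings. (1) There is an isomorphism of pro-algebraic groups $$F:\ \mathrm{Aut}(\mathcal{D},\mathcal{M}_r)\ \simeq\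 \big[\mathrm{Aut}(\mathcal{D},\mathcal{M}_1)/\mathbb{C}^*\big]\times\big[GL(r)\ltimes\exp(h\,\mathfrak{pgl}_h(r))\big].$$ It splits the natural subgroups: $(\Phi,\Psi^{\oplus r})$, for $(\Phi,\Psi)\in\mathrm{Aut}(\mathcal{D},\mathcal{M}_1)$, has first component the class of $(\Phi,\Psi)$ and second component a scalar of $GL(r)$; a constant matrix $g\in GL(r)\subset\mathrm{Aut}(\mathcal{D},\mathcal{M}_r)$ goes to $(1,g)$; for $g\in GL_h(r)\subset\mathrm{Aut}(\mathcal{D},\mathcal{M}_r)$ the second component is mapped by the multiplication map $GL(r)\ltimes\exp(h\,\mathfrak{pgl}_h(r))\to PGL_h(r)$ to the class of $g$, and the first component is trivial if $\det g$ is constant in $h$. (2) This splitting agrees modulo $\langle\mathbb{C}^*,\mathbb{C}\rangle$ with the Lie algebra splitting $L:\mathrm{Der}(\mathcal{D},\mathcal{M}_r)\simeq\frac1h\mathcal{J}\oplus\mathfrak{pgl}_h(r)$, the isomorphism of Lie algebras under which $\alpha\in\frac1h\mathcal{J}$ corresponds to $([\alpha,\cdot],\alpha\cdot)$ and the class of a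 traceless matrix $A$ corresponds to $(0,A\cdot)$. That is, the map induced by $F$ followed by $GL(r)\ltimes\exp(h\,\mathfrak{pgl}_h(r))\to PGL_h(r)$, and the map induced by $L$, are well defined on the quotients by $\mathbb{C}^*$ and $\mathbb{C}$ and form an isomorphism of Harish-Chandra pairs $$\langle\mathrm{Aut}(\mathcal{D},\mathcal{M}_r),\mathrm{Der}(\mathcal{D},\mathcal{M}_r)\rangle/\langle\mathbb{C}^*,\mathbb{C}\rangle\ \simeq\ \Big\langle\mathrm{Aut}(\mathcal{D},\mathcal{M}_1)/\mathbb{C}^*,\tfrac1h\mathcal{J}/\mathbb{C}\Big\rangle\times\langle PGL_h(r),\mathfrak{pgl}_h(r)\rangle.$$ -/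

import Mathlib

open Finset.HasAntidiagonal (antidiagonal mem_antidiagonal)

attribute [local instance 100] LieRing.ofAssociativeRing

noncomputable section

namespace FormalQuant

section Calculus

variable {σ : Type} [Fintype σ] {R : Type} [CommRing R]

/-- The divided-power (Hasse) derivative `∂^K / K!` on formal power series:
it sends `X^(e + K)` to `∏ i, (e i + K i).choose (K i)` times `X^e`. -/
def hasse (K : σ →₀ ℕ) : MvPowerSeries σ R →ₗ[R] MvPowerSeries σ R where
  toFun f := fun e => ((∏ i, (e i + K i).choose (K i) : ℕ) : R) * MvPowerSeries.coeff (e + K) f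
  map_add' f g := by
    funext e
    change (_ * MvPowerSeries.coeff _ (f + g) : R) = _ * MvPowerSeries.coeff _ f + _ * MvPowerSeries.coeff _ g
    rw [map_add, mul_add]
  map_smul' c f := by
    funext e
    change (_ * MvPowerSeries.coeff _ (c • f) : R) = c * (_ * MvPowerSeries.coeff _ f)
    rw [MvPowerSeries.coeff_smul]
    ring

theorem coeff_hasse (K e : σ →₀ ℕ) (f : MvPowerSeries σ R) :
    MvPowerSeries.coeff e (hasse K f) =
      ((∏ i, (e i + K i).choose (K i) : ℕ) : R) * MvPowerSeries.coeff (e + K) f := rfl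

theorem hasse_zero (f : MvPowerSeries σ R) : hasse 0 f = f := by
  ext e
  simp [coeff_hasse]

theorem hasse_hasse (K L : σ →₀ ℕ) (f : MvPowerSeries σ R) :
    hasse K (hasse L f) = (∏ i, (K i + L i).choose (K i) : ℕ) • hasse (K + L) f := by
  ext e
  rw [coeff_hasse, coeff_hasse, map_nsmul, coeff_hasse, nsmul_eq_mul, ← mul_assoc, ← mul_assoc,
    ← Nat.cast_mul, ← Nat.cast_mul, add_assoc]
  congr 2
  rw [← Finset.prod_mul_distrib, ← Finset.prod_mul_distrib]
  refine Finset.prod_congr rfl fun i _ => ?_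
  simp only [Finsupp.add_apply]
  have := Nat.choose_mul (n := e i + (K i + L i)) (k := K i + L i) (s := L i) (by omega)
  have h1 : e i + (K i + L i) - L i = e i + K i := by omega
  have h2 : K i + L i - L i = K i := by omega
  rw [h1, h2] at this
  rw [mul_comm, ← add_assoc, add_assoc, ← this, mul_comm, Nat.choose_symm_add]

theorem hasse_comm (K L : σ →₀ ℕ) (f : MvPowerSeries σ R) :
    hasse K (hasse L f) = hasse L (hasse K f) := by
  rw [hasse_hasse, hasse_hasse, add_comm L K]
  congr 1
  refine Finset.prod_congr rfl fun i _ => ?_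
  rw [Nat.choose_symm_add, add_comm]

theorem prod_choose_add [DecidableEq σ] (a b K : σ →₀ ℕ) :
    ∏ i, (a i + b i).choose (K i) =
      ∑ p ∈ antidiagonal K, (∏ i, (a i).choose (p.1 i)) * ∏ i, (b i).choose (p.2 i) := by
  simp_rw [Nat.add_choose_eq, ← Finset.prod_mul_distrib]
  rw [Finset.prod_univ_sum]
  refine Finset.sum_bij' (i := fun p _ => (Finsupp.equivFunOnFinite.symm fun i => (p i).1,
      Finsupp.equivFunOnFinite.symm fun i => (p i).2)) (j := fun q _ i => (q.1 i, q.2 i))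
      ?_ ?_ ?_ ?_ ?_
  · intro p hp
    simp only [Fintype.mem_piFinset, mem_antidiagonal] at hp ⊢
    ext i
    simpa using hp i
  · intro q hq
    simp only [Fintype.mem_piFinset, mem_antidiagonal] at hq ⊢
    intro i
    rw [← hq]; rfl
  · intro p hp
    rfl
  · intro q hq
    ext <;> simp
  · intro p hp
    rfl

theorem hasse_mul [DecidableEq σ] (K : σ →₀ ℕ) (f g : MvPowerSeries σ R) :
    hasse K (f * g) = ∑ p ∈ antidiagonal K, hasse p.1 f * hasse p.2 g := by
  ext e
  rw [coeff_hasse, MvPowerSeries.coeff_mul, map_sum]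
  simp_rw [MvPowerSeries.coeff_mul, coeff_hasse]
  rw [Finset.mul_sum]
  have key : ∀ q ∈ antidiagonal (e + K),
      ((∏ i, (e i + K i).choose (K i) : ℕ) : R) *
        (MvPowerSeries.coeff q.1 f * MvPowerSeries.coeff q.2 g) =
      ∑ p ∈ antidiagonal K, (((∏ i, (q.1 i).choose (p.1 i) : ℕ) : R) * MvPowerSeries.coeff q.1 f) *
        (((∏ i, (q.2 i).choose (p.2 i) : ℕ) : R) * MvPowerSeries.coeff q.2 g) := by
    intro q hq
    rw [mem_antidiagonal] at hq
    have : ∀ i, e i + K i = q.1 i + q.2 i := fun i => by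
      rw [← Finsupp.add_apply, ← Finsupp.add_apply, hq]
    simp_rw [this]
    rw [prod_choose_add, Nat.cast_sum, Finset.sum_mul]
    refine Finset.sum_congr rfl fun p _ => ?_
    push_cast
    ring
  rw [Finset.sum_congr rfl key, Finset.sum_comm]
  refine Finset.sum_congr rfl fun p hp => ?_
  rw [mem_antidiagonal] at hp
  symm
  refine Finset.sum_of_injOn (fun q => (q.1 + p.1, q.2 + p.2)) ?_ ?_ ?_ ?_
  · intro a _ b _ h
    simp only [Prod.mk.injEq, add_left_inj] at h
    exact Prod.ext h.1 h.2
  · intro q hq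
    simp only [Finset.mem_coe, mem_antidiagonal] at hq ⊢
    rw [← hq, ← hp]; abel
  · intro q hq hq'
    rw [mem_antidiagonal] at hq
    by_cases h : p.1 ≤ q.1 ∧ p.2 ≤ q.2
    · exfalso
      apply hq'
      refine ⟨(q.1 - p.1, q.2 - p.2), ?_, ?_⟩
      · simp only [Finset.mem_coe, mem_antidiagonal]
        have h3 : (q.1 - p.1 + p.1) + (q.2 - p.2 + p.2) = e + K := by
          rw [tsub_add_cancel_of_le h.1, tsub_add_cancel_of_le h.2, hq]
        have h4 : (q.1 - p.1 + (q.2 - p.2)) + K = e + K := by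
          rw [← h3, ← hp]; exact add_add_add_comm _ _ _ _
        exact add_right_cancel h4
      · exact Prod.ext (tsub_add_cancel_of_le h.1) (tsub_add_cancel_of_le h.2)
    · rw [not_and_or, Finsupp.le_def, Finsupp.le_def] at h
      push Not at h
      rcases h with ⟨i, hi⟩ | ⟨i, hi⟩
      · rw [Finset.prod_eq_zero (Finset.mem_univ i) (Nat.choose_eq_zero_of_lt hi)]
        simp
      · rw [Finset.prod_eq_zero (i := i) (s := Finset.univ) (f := fun i => (q.2 i).choose (p.2 i))
          (Finset.mem_univ i) (Nat.choose_eq_zero_of_lt hi)]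
        simp
  · intro q hq
    rfl

end Calculus

section Series

variable {n : ℕ} {A : Type} [CommRing A]

/-- The multi-indices `κ : Fin n →₀ ℕ` with `|κ| = k`. -/
def multi (n k : ℕ) : Finset (Fin n →₀ ℕ) := Finset.univ.finsuppAntidiag k

/-- The factorial `κ!` of a multi-index. -/
def mfact (κ : Fin n →₀ ℕ) : ℕ := ∏ i, (κ i).factorial

/-- The `h`-adically convergent sum `∑ κ, h ^ |κ| * u κ` over all multi-indices `κ`,
where `h` is the variable of `A⟦h⟧`. -/
def hsum (u : (Fin n →₀ ℕ) → PowerSeries A) : PowerSeries A :=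
  PowerSeries.mk fun N =>
    ∑ p ∈ antidiagonal N, ∑ κ ∈ multi n p.1, PowerSeries.coeff p.2 (u κ)

/-- Apply an additive map to all coefficients of a power series in `h`. -/
def coeffwise {A' : Type} [CommRing A'] (T : A →+ A') : PowerSeries A →+ PowerSeries A' where
  toFun f := PowerSeries.mk fun N => T (PowerSeries.coeff N f)
  map_zero' := by ext; simp
  map_add' f g := by ext; simp

@[simp] theorem coeff_coeffwise {A' : Type} [CommRing A'] (T : A →+ A') (f : PowerSeries A)
    (N : ℕ) : PowerSeries.coeff N (coeffwise T f) = T (PowerSeries.coeff N f) := by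
  simp [coeffwise]

theorem coeff_hsum (u : (Fin n →₀ ℕ) → PowerSeries A) (N : ℕ) :
    PowerSeries.coeff N (hsum u) =
      ∑ p ∈ antidiagonal N, ∑ κ ∈ multi n p.1, PowerSeries.coeff p.2 (u κ) := by
  simp [hsum]

theorem mem_multi {k : ℕ} {κ : Fin n →₀ ℕ} : κ ∈ multi n k ↔ ∑ i, κ i = k := by
  simp [multi]

theorem hsum_add (u v : (Fin n →₀ ℕ) → PowerSeries A) :
    hsum (fun κ => u κ + v κ) = hsum u + hsum v := by
  ext N
  simp [coeff_hsum, Finset.sum_add_distrib]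

theorem hsum_coeffwise {A' : Type} [CommRing A'] (T : A →+ A')
    (u : (Fin n →₀ ℕ) → PowerSeries A) :
    coeffwise T (hsum u) = hsum fun κ => coeffwise T (u κ) := by
  ext N
  simp [coeff_hsum]

theorem hsum_mul (u : (Fin n →₀ ℕ) → PowerSeries A) (v : PowerSeries A) :
    hsum u * v = hsum fun κ => u κ * v := by
  ext N
  simp only [coeff_hsum, PowerSeries.coeff_mul, Finset.sum_mul]
  simp only [Finset.sum_sigma']
  refine Finset.sum_bij'
    (i := fun x _ => ⟨(x.2.1.1, x.2.1.2 + x.1.2), x.2.2, (x.2.1.2, x.1.2)⟩)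
    (j := fun x _ => ⟨(x.1.1 + x.2.2.1, x.2.2.2), (x.1.1, x.2.2.1), x.2.1⟩) ?_ ?_ ?_ ?_ ?_
  · rintro ⟨⟨i, j⟩, ⟨k, l⟩, κ⟩ h
    simp only [Finset.mem_sigma, mem_antidiagonal, mem_multi] at h ⊢
    and_intros <;> first | trivial | omega
  · rintro ⟨⟨i, j⟩, κ, ⟨k, l⟩⟩ h
    simp only [Finset.mem_sigma, mem_antidiagonal, mem_multi] at h ⊢
    and_intros <;> first | trivial | omega
  · rintro ⟨⟨i, j⟩, ⟨k, l⟩, κ⟩ h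
    simp only [Finset.mem_sigma, mem_antidiagonal, mem_multi] at h
    obtain ⟨h1, rfl, h3⟩ := h
    rfl
  · rintro ⟨⟨i, j⟩, κ, ⟨k, l⟩⟩ h
    simp only [Finset.mem_sigma, mem_antidiagonal, mem_multi] at h
    obtain ⟨h1, h3, rfl⟩ := h
    rfl
  · rintro ⟨⟨i, j⟩, ⟨k, l⟩, κ⟩ h
    rfl

theorem hsum_of_single (u : (Fin n →₀ ℕ) → PowerSeries A) (hu : ∀ κ, κ ≠ 0 → u κ = 0) :
    hsum u = u 0 := by
  ext N
  rw [coeff_hsum, Finset.sum_eq_single (0, N)]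
  · rw [Finset.sum_eq_single 0]
    · intro κ _ h
      simp [hu κ h]
    · intro h
      exact absurd (mem_multi.2 (by simp)) h
  · rintro ⟨i, j⟩ hp hne
    refine Finset.sum_eq_zero fun κ hκ => ?_
    rw [hu κ, map_zero]
    rintro rfl
    rw [mem_multi] at hκ
    rw [mem_antidiagonal] at hp
    apply hne
    simp at hκ hp
    ext <;> simp <;> omega
  · intro h
    exact absurd (by simp) h

theorem hsum_assoc (v : (Fin n →₀ ℕ) → (Fin n →₀ ℕ) → (Fin n →₀ ℕ) → PowerSeries A) :
    hsum (fun l => ∑ p ∈ antidiagonal l, hsum fun k => v k p.1 p.2) =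
      hsum (fun m => ∑ p ∈ antidiagonal m, hsum fun k => v p.1 p.2 k) := by
  ext N
  simp only [coeff_hsum, map_sum]
  simp only [Finset.sum_sigma']
  refine Finset.sum_bij'
    (i := fun x _ => ⟨(∑ i, x.2.2.2.2 i + ∑ i, x.2.2.1.1 i, ∑ i, x.2.2.1.2 i + x.2.2.2.1.2),
      x.2.2.2.2 + x.2.2.1.1, (x.2.2.2.2, x.2.2.1.1), (∑ i, x.2.2.1.2 i, x.2.2.2.1.2), x.2.2.1.2⟩)
    (j := fun x _ => ⟨(∑ i, x.2.2.1.2 i + ∑ i, x.2.2.2.2 i, ∑ i, x.2.2.1.1 i + x.2.2.2.1.2),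
      x.2.2.1.2 + x.2.2.2.2, (x.2.2.1.2, x.2.2.2.2), (∑ i, x.2.2.1.1 i, x.2.2.2.1.2), x.2.2.1.1⟩)
    ?_ ?_ ?_ ?_ ?_
  · rintro ⟨⟨i, j⟩, l, ⟨l1, l2⟩, ⟨i', j'⟩, k⟩ h
    simp only [Finset.mem_sigma, mem_antidiagonal, mem_multi] at h ⊢
    obtain ⟨h1, h2, rfl, h4, h5⟩ := h
    simp only [Finsupp.add_apply, Finset.sum_add_distrib] at *
    and_intros <;> first | trivial | omega
  · rintro ⟨⟨i, j⟩, l, ⟨l1, l2⟩, ⟨i', j'⟩, k⟩ h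
    simp only [Finset.mem_sigma, mem_antidiagonal, mem_multi] at h ⊢
    obtain ⟨h1, h2, rfl, h4, h5⟩ := h
    simp only [Finsupp.add_apply, Finset.sum_add_distrib] at *
    and_intros <;> first | trivial | omega
  · rintro ⟨⟨i, j⟩, l, ⟨l1, l2⟩, ⟨i', j'⟩, k⟩ h
    simp only [Finset.mem_sigma, mem_antidiagonal, mem_multi] at h
    obtain ⟨h1, h2, rfl, rfl, rfl⟩ := h
    simp only [Finsupp.add_apply, Finset.sum_add_distrib] at *
    subst h2
    rfl
  · rintro ⟨⟨i, j⟩, l, ⟨l1, l2⟩, ⟨i', j'⟩, k⟩ h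
    simp only [Finset.mem_sigma, mem_antidiagonal, mem_multi] at h
    obtain ⟨h1, h2, rfl, rfl, rfl⟩ := h
    simp only [Finsupp.add_apply, Finset.sum_add_distrib] at *
    subst h2
    rfl
  · rintro ⟨⟨i, j⟩, l, ⟨l1, l2⟩, ⟨i', j'⟩, k⟩ h
    rfl

end Series

section Star

variable {n : ℕ} {R : Type} [CommRing R]

/-- `R⟦x₁, …, xₙ, y₁, …, yₙ⟧`; the index `Sum.inl i` is `xᵢ` and `Sum.inr i` is `yᵢ`. -/
abbrev SymbolRing (n : ℕ) (R : Type) [CommRing R] : Type := MvPowerSeries (Fin n ⊕ Fin n) R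

/-- `R⟦x₁, …, xₙ⟧`. -/
abbrev FunRing (n : ℕ) (R : Type) [CommRing R] : Type := MvPowerSeries (Fin n) R

/-- `∂ₓ^κ / κ!` on `R⟦x, y⟧⟦h⟧`. -/
def dX (κ : Fin n →₀ ℕ) : PowerSeries (SymbolRing n R) →+ PowerSeries (SymbolRing n R) :=
  coeffwise (hasse (κ.sumElim 0)).toAddMonoidHom

/-- `∂_y^κ / κ!` on `R⟦x, y⟧⟦h⟧`. -/
def dY (κ : Fin n →₀ ℕ) : PowerSeries (SymbolRing n R) →+ PowerSeries (SymbolRing n R) :=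
  coeffwise (hasse (Finsupp.sumElim 0 κ)).toAddMonoidHom

/-- `∂ₓ^κ / κ!` on `R⟦x⟧⟦h⟧`. -/
def dV (κ : Fin n →₀ ℕ) : PowerSeries (FunRing n R) →+ PowerSeries (FunRing n R) :=
  coeffwise (hasse κ).toAddMonoidHom

/-- The normally ordered product on `R⟦x, y⟧⟦h⟧`:
`f ⋆ g = ∑ κ, (h ^ |κ| / κ!) * ∂_y^κ f * ∂ₓ^κ g`. -/
def star (f g : PowerSeries (SymbolRing n R)) : PowerSeries (SymbolRing n R) :=
  hsum fun κ => mfact κ • (dY κ f * dX κ g)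

/-- The coefficient `f_κ ∈ R⟦x⟧⟦h⟧` of `y^κ` in `f ∈ R⟦x, y⟧⟦h⟧`. -/
def coeffY (κ : Fin n →₀ ℕ) : PowerSeries (SymbolRing n R) →+ PowerSeries (FunRing n R) :=
  coeffwise
    { toFun := fun f => fun a => MvPowerSeries.coeff (a.sumElim κ) f
      map_zero' := by
        funext a
        change MvPowerSeries.coeff _ 0 = 0
        simp
      map_add' := fun f g => by
        funext a
        change MvPowerSeries.coeff _ (f + g) = MvPowerSeries.coeff _ f + MvPowerSeries.coeff _ g
        simp }

/-- The action of `f = ∑ κ, f_κ(x, h) * y^κ` on `m ∈ R⟦x⟧⟦h⟧`, where `y_j` acts by `h * ∂/∂x_j`: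
`f • m = ∑ κ, f_κ * h ^ |κ| * ∂ₓ^κ m`. -/
def opAct (f : PowerSeries (SymbolRing n R)) (m : PowerSeries (FunRing n R)) :
    PowerSeries (FunRing n R) :=
  hsum fun κ => mfact κ • (coeffY κ f * dV κ m)

theorem coeffwise_mul_of {ι : Type} {A A' : Type} [CommRing A] [CommRing A'] (s : Finset ι)
    (T : A →+ A') (T₁ T₂ : ι → (A →+ A'))
    (h : ∀ a b, T (a * b) = ∑ i ∈ s, T₁ i a * T₂ i b) (f g : PowerSeries A) :
    coeffwise T (f * g) = ∑ i ∈ s, coeffwise (T₁ i) f * coeffwise (T₂ i) g := by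
  ext N
  simp only [coeff_coeffwise, PowerSeries.coeff_mul, map_sum, h]
  exact Finset.sum_comm

theorem dY_mul (l : Fin n →₀ ℕ) (f g : PowerSeries (SymbolRing n R)) :
    dY l (f * g) = ∑ p ∈ antidiagonal l, dY p.1 f * dY p.2 g := by
  refine coeffwise_mul_of (antidiagonal l) _ (fun p => _) (fun p => _) ?_ f g
  intro a b
  change hasse _ (a * b) = ∑ p ∈ antidiagonal l, hasse _ a * hasse _ b
  rw [hasse_mul, ← Finsupp.image_sumElim_product_antidiagonal, Finset.sum_image]
  · simp
  · rintro ⟨⟨a, b⟩, c, d⟩ h ⟨⟨a', b'⟩, c', d'⟩ h' heq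
    simpa [Finsupp.ext_iff, and_assoc, and_left_comm, and_comm] using heq

theorem dX_mul (l : Fin n →₀ ℕ) (f g : PowerSeries (SymbolRing n R)) :
    dX l (f * g) = ∑ p ∈ antidiagonal l, dX p.1 f * dX p.2 g := by
  refine coeffwise_mul_of (antidiagonal l) _ (fun p => _) (fun p => _) ?_ f g
  intro a b
  change hasse _ (a * b) = ∑ p ∈ antidiagonal l, hasse _ a * hasse _ b
  rw [hasse_mul, ← Finsupp.image_sumElim_product_antidiagonal, Finset.sum_image]
  · simp
  · rintro ⟨⟨a, b⟩, c, d⟩ h ⟨⟨a', b'⟩, c', d'⟩ h' heq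
    simpa [Finsupp.ext_iff, and_assoc, and_left_comm, and_comm] using heq

theorem dY_dX (k l : Fin n →₀ ℕ) (f : PowerSeries (SymbolRing n R)) :
    dY k (dX l f) = dX l (dY k f) := by
  ext N : 1
  simp only [dY, dX, coeff_coeffwise]
  exact hasse_comm _ _ _

/-- The multinomial factor `∏ i, (k i + l i).choose (k i)`. -/
def mchoose (k l : Fin n →₀ ℕ) : ℕ := ∏ i, (k i + l i).choose (k i)

theorem mchoose_mul (k l : Fin n →₀ ℕ) : mfact k * mfact l * mchoose k l = mfact (k + l) := by
  simp only [mfact, mchoose, ← Finset.prod_mul_distrib]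
  refine Finset.prod_congr rfl fun i _ => ?_
  have := Nat.add_choose_mul_factorial_mul_factorial (k i) (l i)
  rw [Finsupp.add_apply, ← this, Nat.choose_symm_add]
  ring

theorem dY_dY (k l : Fin n →₀ ℕ) (f : PowerSeries (SymbolRing n R)) :
    dY k (dY l f) = mchoose k l • dY (k + l) f := by
  ext N : 1
  simp only [dY, coeff_coeffwise, map_nsmul]
  refine (hasse_hasse _ _ _).trans ?_
  rw [← Finsupp.sumElim_add, zero_add]
  congr 1
  simp [mchoose, Fintype.prod_sum_type]

theorem dX_dX (k l : Fin n →₀ ℕ) (f : PowerSeries (SymbolRing n R)) :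
    dX k (dX l f) = mchoose k l • dX (k + l) f := by
  ext N : 1
  simp only [dX, coeff_coeffwise, map_nsmul]
  refine (hasse_hasse _ _ _).trans ?_
  rw [← Finsupp.sumElim_add, zero_add]
  congr 1
  simp [mchoose, Fintype.prod_sum_type]

theorem dX_zero (f : PowerSeries (SymbolRing n R)) : dX 0 f = f := by
  ext N : 1
  simp only [dX, coeff_coeffwise, Finsupp.sumElim_zero_zero]
  exact hasse_zero _

theorem dY_zero (f : PowerSeries (SymbolRing n R)) : dY 0 f = f := by
  ext N : 1
  simp only [dY, coeff_coeffwise, Finsupp.sumElim_zero_zero]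
  exact hasse_zero _

theorem dY_hsum (k : Fin n →₀ ℕ) (u : (Fin n →₀ ℕ) → PowerSeries (SymbolRing n R)) :
    dY k (hsum u) = hsum fun κ => dY k (u κ) := hsum_coeffwise _ _

theorem dX_hsum (k : Fin n →₀ ℕ) (u : (Fin n →₀ ℕ) → PowerSeries (SymbolRing n R)) :
    dX k (hsum u) = hsum fun κ => dX k (u κ) := hsum_coeffwise _ _

theorem nsmul_hsum {A : Type} [CommRing A] (c : ℕ) (u : (Fin n →₀ ℕ) → PowerSeries A) :
    c • hsum u = hsum fun κ => c • u κ := by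
  ext N
  simp only [coeff_hsum, Finset.smul_sum, map_nsmul]

theorem sum_hsum {A ι : Type} [CommRing A] (s : Finset ι)
    (u : ι → (Fin n →₀ ℕ) → PowerSeries A) :
    ∑ i ∈ s, hsum (u i) = hsum fun κ => ∑ i ∈ s, u i κ := by
  classical
  induction s using Finset.induction_on with
  | empty => ext N; simp [coeff_hsum]
  | insert a s ha ih => simp only [Finset.sum_insert ha, ih, hsum_add]

theorem star_assoc (f g e : PowerSeries (SymbolRing n R)) :
    star (star f g) e = star f (star g e) := by
  have hl : star (star f g) e = hsum fun l => ∑ p ∈ antidiagonal l, hsum fun k =>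
      (mfact (p.1 + p.2) * mfact k * mchoose p.1 k) •
        (dY (k + p.1) f * dX k (dY p.2 g) * dX (p.1 + p.2) e) := by
    refine congrArg hsum (funext fun l => ?_)
    rw [sum_hsum, star, dY_hsum, hsum_mul, nsmul_hsum]
    refine congrArg hsum (funext fun k => ?_)
    rw [map_nsmul, dY_mul, Finset.smul_sum, Finset.sum_mul, Finset.smul_sum]
    refine Finset.sum_congr rfl fun p hp => ?_
    rw [mem_antidiagonal] at hp
    rw [dY_dY, dY_dX, hp, add_comm k p.1]
    simp only [nsmul_eq_mul]
    push_cast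
    ring
  have hr : star f (star g e) = hsum fun m => ∑ p ∈ antidiagonal m, hsum fun k =>
      (mfact (p.1 + p.2) * mfact k * mchoose p.2 k) •
        (dY (p.1 + p.2) f * dX p.1 (dY k g) * dX (p.2 + k) e) := by
    refine congrArg hsum (funext fun l => ?_)
    rw [sum_hsum, star, dX_hsum, mul_comm, hsum_mul, nsmul_hsum]
    refine congrArg hsum (funext fun k => ?_)
    rw [map_nsmul, dX_mul, Finset.smul_sum, Finset.sum_mul, Finset.smul_sum]
    refine Finset.sum_congr rfl fun p hp => ?_
    rw [mem_antidiagonal] at hp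
    rw [dX_dX, hp]
    simp only [nsmul_eq_mul]
    push_cast
    ring
  refine hl.trans (((hsum_assoc fun k a b => (mfact (a + b) * mfact k * mchoose a k) •
    (dY (k + a) f * dX k (dY b g) * dX (a + b) e)).trans ?_).trans hr.symm)
  refine congrArg hsum (funext fun l => Finset.sum_congr rfl fun p _ =>
    congrArg hsum (funext fun k => ?_))
  congr 1
  rw [← mchoose_mul p.2 k, add_comm p.1 p.2, ← mchoose_mul p.2 p.1]
  ring

end Star

section WeylAlgebra

variable {n : ℕ} {R : Type} [CommRing R]

theorem coeffwise_smul {A A' : Type} [CommRing A] [CommRing A'] [Algebra R A] [Algebra R A']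
    (T : A →+ A') (hT : ∀ (r : R) a, T (r • a) = r • T a) (c : PowerSeries R) (f : PowerSeries A) :
    coeffwise T (c • f) = c • coeffwise T f := by
  ext N
  have h1 : c • f = PowerSeries.map (algebraMap R A) c * f := rfl
  have h2 : c • coeffwise T f = PowerSeries.map (algebraMap R A') c * coeffwise T f := rfl
  rw [h1, h2]
  simp only [coeff_coeffwise, PowerSeries.coeff_mul, map_sum, PowerSeries.coeff_map,
    ← Algebra.smul_def, hT]

theorem dX_smul (κ : Fin n →₀ ℕ) (c : PowerSeries R) (f : PowerSeries (SymbolRing n R)) :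
    dX κ (c • f) = c • dX κ f :=
  coeffwise_smul _ (fun r a => map_smul (hasse _) r a) c f

theorem dY_smul (κ : Fin n →₀ ℕ) (c : PowerSeries R) (f : PowerSeries (SymbolRing n R)) :
    dY κ (c • f) = c • dY κ f :=
  coeffwise_smul _ (fun r a => map_smul (hasse _) r a) c f

theorem dV_smul (κ : Fin n →₀ ℕ) (c : PowerSeries R) (m : PowerSeries (FunRing n R)) :
    dV κ (c • m) = c • dV κ m :=
  coeffwise_smul _ (fun r a => map_smul (hasse _) r a) c m

theorem hsum_smul {A : Type} [CommRing A] [Algebra R A] (c : PowerSeries R)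
    (u : (Fin n →₀ ℕ) → PowerSeries A) : c • hsum u = hsum fun κ => c • u κ := by
  have h (f : PowerSeries A) : c • f = f * PowerSeries.map (algebraMap R A) c := mul_comm _ _
  simp only [h]
  exact hsum_mul _ _

theorem hasse_const {σ : Type} [Fintype σ] {K : σ →₀ ℕ} (i : σ) (hi : K i ≠ 0)
    (f : MvPowerSeries σ R) (hf : ∀ e, e i ≠ 0 → MvPowerSeries.coeff e f = 0) :
    hasse K f = 0 := by
  ext e
  rw [coeff_hasse, hf _ (by simp [hi]), mul_zero, map_zero]

theorem dY_eq_zero {κ : Fin n →₀ ℕ} (hκ : κ ≠ 0) (f : PowerSeries (SymbolRing n R))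
    (hf : ∀ N e j, e (Sum.inr j) ≠ 0 → MvPowerSeries.coeff e (PowerSeries.coeff N f) = 0) :
    dY κ f = 0 := by
  obtain ⟨j, hj⟩ := Finsupp.ne_iff.1 hκ
  ext N : 1
  rw [dY, coeff_coeffwise, map_zero]
  exact hasse_const (Sum.inr j) (by simpa using hj) _ (fun e he => hf N e j he)

theorem dX_eq_zero {κ : Fin n →₀ ℕ} (hκ : κ ≠ 0) (f : PowerSeries (SymbolRing n R))
    (hf : ∀ N e j, e (Sum.inl j) ≠ 0 → MvPowerSeries.coeff e (PowerSeries.coeff N f) = 0) :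
    dX κ f = 0 := by
  obtain ⟨j, hj⟩ := Finsupp.ne_iff.1 hκ
  ext N : 1
  rw [dX, coeff_coeffwise, map_zero]
  exact hasse_const (Sum.inl j) (by simpa using hj) _ (fun e he => hf N e j he)

/-- If the left factor does not involve `y`, the star product is the commutative product. -/
theorem star_of_left (f g : PowerSeries (SymbolRing n R))
    (hf : ∀ N e j, e (Sum.inr j) ≠ 0 → MvPowerSeries.coeff e (PowerSeries.coeff N f) = 0) :
    star f g = f * g := by
  rw [star, hsum_of_single]
  · simp [mfact, dX_zero, dY_zero]
  · intro κ hκ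
    rw [dY_eq_zero hκ f hf, zero_mul, smul_zero]

/-- If the right factor does not involve `x`, the star product is the commutative product. -/
theorem star_of_right (f g : PowerSeries (SymbolRing n R))
    (hg : ∀ N e j, e (Sum.inl j) ≠ 0 → MvPowerSeries.coeff e (PowerSeries.coeff N g) = 0) :
    star f g = f * g := by
  rw [star, hsum_of_single]
  · simp [mfact, dX_zero, dY_zero]
  · intro κ hκ
    rw [dX_eq_zero hκ g hg, mul_zero, smul_zero]

/-- Scalars from `R⟦h⟧` involve neither `x` nor `y`. -/
theorem coeff_smul_one (c : PowerSeries R) (N : ℕ) (e : Fin n ⊕ Fin n →₀ ℕ) (j : Fin n ⊕ Fin n)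
    (he : e j ≠ 0) :
    MvPowerSeries.coeff e (PowerSeries.coeff N (c • (1 : PowerSeries (SymbolRing n R)))) = 0 := by
  classical
  have h1 : c • (1 : PowerSeries (SymbolRing n R)) =
    PowerSeries.map (algebraMap R (SymbolRing n R)) c * 1 := rfl
  rw [h1, mul_one, PowerSeries.coeff_map]
  have h2 : algebraMap R (SymbolRing n R) (PowerSeries.coeff N c) =
    MvPowerSeries.C (PowerSeries.coeff N c) := rfl
  rw [h2, MvPowerSeries.coeff_C, if_neg]
  rintro rfl
  simp at he

theorem coeff_one_eq_zero (N : ℕ) (e : Fin n ⊕ Fin n →₀ ℕ) (j : Fin n ⊕ Fin n)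
    (he : e j ≠ 0) :
    MvPowerSeries.coeff e (PowerSeries.coeff N (1 : PowerSeries (SymbolRing n R))) = 0 := by
  have := coeff_smul_one (n := n) (1 : PowerSeries R) N e j he
  rwa [one_smul] at this

/-- The formal Weyl algebra `𝒟` over `R`: the `R`-module `R⟦x₁, …, xₙ, y₁, …, yₙ, h⟧` with the
normally ordered product, so that `[y_i, x_j] = δ_ij h` and all other commutators of the
generators vanish. -/
def Weyl (n : ℕ) (R : Type) [CommRing R] : Type := PowerSeries (SymbolRing n R)

namespace Weyl

instance : AddCommGroup (Weyl n R) := inferInstanceAs (AddCommGroup (PowerSeries (SymbolRing n R)))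

instance : Module (PowerSeries R) (Weyl n R) :=
  inferInstanceAs (Module (PowerSeries R) (PowerSeries (SymbolRing n R)))

/-- The underlying power series in `x`, `y`, `h`. -/
def symbol : Weyl n R ≃ₗ[PowerSeries R] PowerSeries (SymbolRing n R) := LinearEquiv.refl _ _

/-- The element of the Weyl algebra with given normally ordered symbol. -/
def ofSymbol : PowerSeries (SymbolRing n R) ≃ₗ[PowerSeries R] Weyl n R := LinearEquiv.refl _ _

instance : Ring (Weyl n R) where
  __ := (inferInstance : AddCommGroup (Weyl n R))
  mul f g := ofSymbol (star (symbol f) (symbol g))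
  one := ofSymbol 1
  left_distrib f g e := by
    change star (symbol f) (symbol g + symbol e) = star (symbol f) (symbol g) + star (symbol f) (symbol e)
    simp only [star, map_add, mul_add, smul_add, hsum_add]
  right_distrib f g e := by
    change star (symbol f + symbol g) (symbol e) = star (symbol f) (symbol e) + star (symbol g) (symbol e)
    simp only [star, map_add, add_mul, smul_add, hsum_add]
  zero_mul f := by
    change star 0 (symbol f) = 0
    rw [star_of_left _ _ (by simp), zero_mul]
  mul_zero f := by
    change star (symbol f) 0 = 0
    rw [star_of_right _ _ (by simp), mul_zero]
  mul_assoc f g e := star_assoc _ _ _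
  one_mul f := by
    change star 1 (symbol f) = symbol f
    rw [star_of_left _ _ (fun N e j h => coeff_one_eq_zero N e _ h), one_mul]
  mul_one f := by
    change star (symbol f) 1 = symbol f
    rw [star_of_right _ _ (fun N e j h => coeff_one_eq_zero N e _ h), mul_one]

theorem symbol_mul (f g : Weyl n R) : symbol (f * g) = star (symbol f) (symbol g) := rfl

theorem symbol_one : symbol (1 : Weyl n R) = 1 := rfl

instance : Algebra (PowerSeries R) (Weyl n R) :=
  Algebra.ofModule
    (fun c f g => by
      change star (c • symbol f) (symbol g) = c • star (symbol f) (symbol g)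
      simp only [star, hsum_smul, dY_smul, smul_mul_assoc, smul_comm c (mfact _)])
    (fun c f g => by
      change star (symbol f) (c • symbol g) = c • star (symbol f) (symbol g)
      simp only [star, hsum_smul, dX_smul, mul_smul_comm, smul_comm c (mfact _)])

/-- The generator `x_i`. -/
def x (i : Fin n) : Weyl n R := ofSymbol (PowerSeries.C (MvPowerSeries.X (Sum.inl i)))

/-- The generator `y_i`. -/
def y (i : Fin n) : Weyl n R := ofSymbol (PowerSeries.C (MvPowerSeries.X (Sum.inr i)))

/-- The central element `h`. -/
def h : Weyl n R := ofSymbol PowerSeries.X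

/-- Coefficientwise change of the base ring. -/
def map {S : Type} [CommRing S] (ρ : R →+* S) (f : Weyl n R) : Weyl n S :=
  ofSymbol (PowerSeries.map (MvPowerSeries.map ρ) (symbol f))

theorem h_eq : (h : Weyl n R) = algebraMap (PowerSeries R) (Weyl n R) PowerSeries.X := by
  rw [Algebra.algebraMap_eq_smul_one]
  have : (PowerSeries.X : PowerSeries R) • (1 : PowerSeries (SymbolRing n R)) =
    PowerSeries.map (algebraMap R (SymbolRing n R)) PowerSeries.X * 1 := rfl
  change _ = (PowerSeries.X : PowerSeries R) • (1 : PowerSeries (SymbolRing n R))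
  rw [this, mul_one, PowerSeries.map_X]
  rfl

theorem h_mul (f : Weyl n R) : h * f = (PowerSeries.X : PowerSeries R) • f := by
  rw [h_eq, Algebra.smul_def]

theorem h_comm (f : Weyl n R) : h * f = f * h := by
  rw [h_eq, Algebra.commutes]

end Weyl

end WeylAlgebra

section FormalModule

variable {n : ℕ} {R : Type} [CommRing R]

/-- `R⟦x₁, …, xₙ⟧⟦h⟧`, the underlying `R`-module of the formal module of rank one. -/
abbrev Vac (n : ℕ) (R : Type) [CommRing R] : Type := PowerSeries (FunRing n R)

theorem coeff_coeffY (κ a : Fin n →₀ ℕ) (f : PowerSeries (SymbolRing n R)) (N : ℕ) :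
    MvPowerSeries.coeff a (PowerSeries.coeff N (coeffY κ f)) =
      MvPowerSeries.coeff (a.sumElim κ) (PowerSeries.coeff N f) := by
  rw [coeffY, coeff_coeffwise]
  rfl

theorem coeffY_zero_mul (f g : PowerSeries (SymbolRing n R)) :
    coeffY 0 (f * g) = coeffY 0 f * coeffY 0 g := by
  refine (coeffwise_mul_of {()} _ (fun _ => _) (fun _ => _) ?_ f g).trans (by simp; rfl)
  intro a b
  simp only [Finset.sum_singleton]
  ext e
  rw [MvPowerSeries.coeff_mul]
  change MvPowerSeries.coeff (e.sumElim 0) (a * b) = ∑ p ∈ antidiagonal e,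
    MvPowerSeries.coeff (p.1.sumElim 0) a * MvPowerSeries.coeff (p.2.sumElim 0) b
  rw [MvPowerSeries.coeff_mul, ← Finsupp.image_sumElim_product_antidiagonal, Finset.sum_image]
  · rw [Finset.sum_product]
    simp
  · rintro ⟨⟨a, b⟩, c, d⟩ h ⟨⟨a', b'⟩, c', d'⟩ h' heq
    simpa [Finsupp.ext_iff, and_assoc, and_left_comm, and_comm] using heq

theorem coeffY_zero_dY (κ : Fin n →₀ ℕ) (f : PowerSeries (SymbolRing n R)) :
    coeffY 0 (dY κ f) = coeffY κ f := by
  ext N a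
  rw [coeff_coeffY, coeff_coeffY, dY, coeff_coeffwise]
  refine (coeff_hasse _ _ _).trans ?_
  rw [← Finsupp.sumElim_add]
  simp [Fintype.prod_sum_type]

theorem coeffY_zero_dX (κ : Fin n →₀ ℕ) (f : PowerSeries (SymbolRing n R)) :
    coeffY 0 (dX κ f) = dV κ (coeffY 0 f) := by
  ext N a
  rw [coeff_coeffY, dX, coeff_coeffwise, dV, coeff_coeffwise]
  refine (coeff_hasse _ _ _).trans ((?_ : _ = _).trans (coeff_hasse _ _ _).symm)
  rw [coeff_coeffY, ← Finsupp.sumElim_add]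
  simp [Fintype.prod_sum_type]

theorem coeffY_zero_star (f g : PowerSeries (SymbolRing n R)) :
    coeffY 0 (star f g) = opAct f (coeffY 0 g) := by
  refine (hsum_coeffwise _ _).trans (congrArg hsum (funext fun κ => ?_))
  change coeffY 0 _ = _
  rw [map_nsmul, coeffY_zero_mul, coeffY_zero_dY, coeffY_zero_dX]

/-- A function of `x` and `h`, regarded as a symbol not involving `y`. -/
def ofFun (m : Vac n R) : PowerSeries (SymbolRing n R) :=
  PowerSeries.mk fun N => fun e =>
    if e.comapDomain Sum.inr Sum.inr_injective.injOn = 0 then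
      MvPowerSeries.coeff (e.comapDomain Sum.inl Sum.inl_injective.injOn) (PowerSeries.coeff N m)
    else 0

theorem coeffY_ofFun (m : Vac n R) : coeffY 0 (ofFun m) = m := by
  ext N a
  have h : PowerSeries.coeff N (ofFun m) = _ := PowerSeries.coeff_mk N _
  rw [coeff_coeffY, h]
  change (if _ then _ else _) = _
  rw [if_pos (by simp), Finsupp.comapDomain_inl_sumElim]

theorem coeffY_zero_surjective :
    Function.Surjective (coeffY (n := n) (R := R) 0) := fun m => ⟨ofFun m, coeffY_ofFun m⟩

instance : Module (Weyl n R) (Vac n R) where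
  smul f m := opAct (Weyl.symbol f) m
  one_smul m := by
    obtain ⟨w, rfl⟩ := coeffY_zero_surjective m
    change opAct (Weyl.symbol 1) _ = _
    rw [← coeffY_zero_star]
    exact congrArg (coeffY 0) (one_mul (Weyl.ofSymbol w))
  mul_smul f g m := by
    obtain ⟨w, rfl⟩ := coeffY_zero_surjective m
    change opAct (Weyl.symbol (f * g)) _ = opAct _ (opAct _ _)
    rw [← coeffY_zero_star, ← coeffY_zero_star, ← coeffY_zero_star]
    exact congrArg (coeffY 0) (mul_assoc f g (Weyl.ofSymbol w))
  smul_zero f := by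
    change opAct _ 0 = 0
    rw [← map_zero (coeffY (n := n) (R := R) 0), ← coeffY_zero_star]
    exact congrArg (coeffY 0) (mul_zero f)
  smul_add f m m' := by
    change opAct _ (m + m') = opAct _ _ + opAct _ _
    simp only [opAct, map_add, mul_add, smul_add, hsum_add]
  add_smul f g m := by
    change opAct (Weyl.symbol f + Weyl.symbol g) m = opAct _ _ + opAct _ _
    simp only [opAct, map_add, add_mul, smul_add, hsum_add]
  zero_smul m := by
    obtain ⟨w, rfl⟩ := coeffY_zero_surjective m
    change opAct (Weyl.symbol 0) _ = _
    rw [← coeffY_zero_star]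
    exact (congrArg (coeffY 0) (zero_mul (Weyl.ofSymbol w))).trans (map_zero _)

theorem smul_def' (f : Weyl n R) (m : Vac n R) : f • m = opAct (Weyl.symbol f) m := rfl

theorem coeffY_smul (κ : Fin n →₀ ℕ) (c : PowerSeries R) (f : PowerSeries (SymbolRing n R)) :
    coeffY κ (c • f) = c • coeffY κ f :=
  coeffwise_smul _ (fun r a => by
    ext e
    exact MvPowerSeries.coeff_smul _ _ _) c f

instance : IsScalarTower (PowerSeries R) (Weyl n R) (Vac n R) where
  smul_assoc c f m := by
    change opAct (c • Weyl.symbol f) m = c • opAct (Weyl.symbol f) m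
    simp only [opAct, hsum_smul, coeffY_smul, smul_mul_assoc, smul_comm c (mfact _)]

instance : SMulCommClass (Weyl n R) (PowerSeries R) (Vac n R) where
  smul_comm f c m := by
    change opAct (Weyl.symbol f) (c • m) = c • opAct (Weyl.symbol f) m
    simp only [opAct, hsum_smul, dV_smul, mul_smul_comm, smul_comm c (mfact _)]

theorem symbol_smul_one (f : Weyl n R) : f • (1 : Vac n R) = coeffY 0 (Weyl.symbol f) := by
  have : (1 : Vac n R) = coeffY 0 1 := by
    ext N a
    rw [coeff_coeffY, PowerSeries.coeff_one, PowerSeries.coeff_one]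
    split_ifs
    · rw [MvPowerSeries.coeff_one, MvPowerSeries.coeff_one]
      congr 1
      simp [Finsupp.ext_iff]
    · simp
  rw [this, smul_def', ← coeffY_zero_star]
  exact congrArg (coeffY 0) (mul_one f)

/-- The formal module `ℳ_r`: as an `R`-module it is `R⟦x₁, …, xₙ, h⟧^r`, and the Weyl algebra acts
on each component. -/
abbrev FormalModule (n r : ℕ) (R : Type) [CommRing R] : Type := Fin r → Vac n R

/-- Coefficientwise change of the base ring. -/
def FormalModule.map {r : ℕ} {S : Type} [CommRing S] (ρ : R →+* S) (m : FormalModule n r R) :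
    FormalModule n r S :=
  fun i => PowerSeries.map (MvPowerSeries.map ρ) (m i)

end FormalModule

section Relations

variable {n : ℕ} {R : Type} [CommRing R]

theorem hsum_of_one {A : Type} [CommRing A] (κ₀ : Fin n →₀ ℕ) (u : (Fin n →₀ ℕ) → PowerSeries A)
    (hu : ∀ κ, κ ≠ κ₀ → u κ = 0) : hsum u = PowerSeries.X ^ (∑ i, κ₀ i) * u κ₀ := by
  ext N
  rw [coeff_hsum, PowerSeries.coeff_X_pow_mul']
  split_ifs with hN
  · rw [Finset.sum_eq_single (∑ i, κ₀ i, N - ∑ i, κ₀ i)]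
    · rw [Finset.sum_eq_single κ₀]
      · intro κ _ h
        simp [hu κ h]
      · intro h
        exact absurd (mem_multi.2 rfl) h
    · rintro ⟨i, j⟩ hp hne
      refine Finset.sum_eq_zero fun κ hκ => ?_
      rw [hu κ, map_zero]
      rintro rfl
      rw [mem_multi] at hκ
      rw [mem_antidiagonal] at hp
      apply hne
      simp only at hκ hp
      ext <;> simp <;> omega
    · intro h
      exact absurd (mem_antidiagonal.2 (by simp only; omega)) h
  · refine Finset.sum_eq_zero fun p hp => Finset.sum_eq_zero fun κ hκ => ?_
    rw [hu κ, map_zero]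
    rintro rfl
    rw [mem_multi] at hκ
    rw [mem_antidiagonal] at hp
    omega

theorem hsum_of_le_one {A : Type} [CommRing A] (u : (Fin n →₀ ℕ) → PowerSeries A) (j : Fin n)
    (hu : ∀ κ, κ ≠ 0 → κ ≠ Finsupp.single j 1 → u κ = 0) :
    hsum u = u 0 + PowerSeries.X * u (Finsupp.single j 1) := by
  have h1 : u = fun κ => (if κ = 0 then u κ else 0) +
      (if κ = Finsupp.single j 1 then u κ else 0) := by
    funext κ
    by_cases h0 : κ = 0
    · have h2 : (0 : Fin n →₀ ℕ) ≠ Finsupp.single j 1 := fun h => by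
        simpa using DFunLike.congr_fun h j
      rw [h0, if_pos rfl, if_neg h2, add_zero]
    · by_cases h1 : κ = Finsupp.single j 1
      · simp [h1]
      · simp [h0, h1, hu κ h0 h1]
  conv_lhs => rw [h1]
  rw [hsum_add, hsum_of_one 0 _ (fun κ h => if_neg h),
    hsum_of_one (Finsupp.single j 1) _ (fun κ h => if_neg h)]
  simp [Finsupp.single_apply]

theorem dX_of_linear {κ : Fin n →₀ ℕ} (j : Fin n) (h0 : κ ≠ 0) (h1 : κ ≠ Finsupp.single j 1) :
    dX κ (PowerSeries.C (MvPowerSeries.X (Sum.inl j) : SymbolRing n R)) = 0 := by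
  classical
  ext N e
  rw [dX, coeff_coeffwise]
  refine (coeff_hasse _ _ _).trans ?_
  rw [PowerSeries.coeff_C]
  split_ifs
  · rw [MvPowerSeries.coeff_X, if_neg, mul_zero, map_zero, map_zero]
    intro h
    have hi : ∀ i, e (Sum.inl i) + κ i = (Finsupp.single j 1 : Fin n →₀ ℕ) i := fun i => by
      have := DFunLike.congr_fun h (Sum.inl i)
      simpa [Finsupp.single_apply] using this
    have hz : ∀ i, i ≠ j → κ i = 0 := fun i hij => by
      have := hi i
      rw [Finsupp.single_eq_of_ne hij] at this
      omega
    have hj := hi j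
    rw [Finsupp.single_eq_same] at hj
    have : κ j = 0 ∨ κ j = 1 := by omega
    rcases this with hk | hk
    · exact h0 (Finsupp.ext fun i => if hij : i = j then hij ▸ hk else hz i hij)
    · refine h1 (Finsupp.ext fun i => ?_)
      by_cases hij : i = j
      · subst hij
        simpa using hk
      · rw [hz i hij, Finsupp.single_eq_of_ne hij]
  · simp

theorem dX_single_X (j : Fin n) :
    dX (Finsupp.single j 1) (PowerSeries.C (MvPowerSeries.X (Sum.inl j) : SymbolRing n R)) = 1 := by
  classical
  ext N e
  rw [dX, coeff_coeffwise]
  refine (coeff_hasse _ _ _).trans ?_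
  rw [PowerSeries.coeff_C, PowerSeries.coeff_one]
  split_ifs
  · rw [MvPowerSeries.coeff_X, MvPowerSeries.coeff_one]
    have : e + (Finsupp.single j 1 : Fin n →₀ ℕ).sumElim 0 = Finsupp.single (Sum.inl j) 1 ↔
        e = 0 := by
      have hs : (Finsupp.single j 1 : Fin n →₀ ℕ).sumElim (0 : Fin n →₀ ℕ) =
          Finsupp.single (Sum.inl j) 1 := by
        ext i
        rcases i with i | i <;> simp [Finsupp.single_apply]
      rw [hs]
      simp
    simp only [this]
    split_ifs with he
    · subst he
      rw [mul_one]
      refine (congrArg Nat.cast (Finset.prod_eq_one fun i _ => ?_)).trans Nat.cast_one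
      simp
    · simp
  · simp

theorem dY_single_X (i j : Fin n) :
    dY (Finsupp.single j 1) (PowerSeries.C (MvPowerSeries.X (Sum.inr i) : SymbolRing n R)) =
      if i = j then 1 else 0 := by
  classical
  ext N e
  rw [dY, coeff_coeffwise]
  refine (coeff_hasse _ _ _).trans ?_
  rw [PowerSeries.coeff_C]
  have hs : Finsupp.sumElim (0 : Fin n →₀ ℕ) (Finsupp.single j 1 : Fin n →₀ ℕ) =
      Finsupp.single (Sum.inr j) 1 := by
    ext i
    rcases i with i | i <;> simp [Finsupp.single_apply]
  rw [hs]
  by_cases hN : N = 0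
  · by_cases hij : i = j
    · subst hij
      simp only [hN, if_true, PowerSeries.coeff_one]
      rw [MvPowerSeries.coeff_X, MvPowerSeries.coeff_one]
      by_cases he : e = 0
      · subst he
        simp only [zero_add, if_true, mul_one]
        refine (congrArg Nat.cast (Finset.prod_eq_one fun i _ => ?_)).trans Nat.cast_one
        simp
      · simp [he]
    · rw [if_pos hN, if_neg hij, map_zero, map_zero, MvPowerSeries.coeff_X, if_neg, mul_zero]
      intro h
      have := DFunLike.congr_fun h (Sum.inr j)
      simp [hij] at this
  · rw [if_neg hN]
    split_ifs <;> simp [PowerSeries.coeff_one, hN]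

/-- The defining relation `[y_i, x_j] = δ_ij h`. -/
theorem Weyl.y_mul_x_sub (i j : Fin n) :
    (Weyl.y i * Weyl.x j - Weyl.x j * Weyl.y i : Weyl n R) = if i = j then Weyl.h else 0 := by
  have h1 : Weyl.symbol (Weyl.x j * Weyl.y i : Weyl n R) =
      Weyl.symbol (Weyl.x j) * Weyl.symbol (Weyl.y i) := by
    classical
    refine star_of_left _ _ fun N e k he => ?_
    change MvPowerSeries.coeff e (PowerSeries.coeff N (PowerSeries.C (MvPowerSeries.X _))) = 0
    rw [PowerSeries.coeff_C]
    split_ifs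
    · rw [MvPowerSeries.coeff_X, if_neg]
      rintro rfl
      simp at he
    · simp
  have h2 : Weyl.symbol (Weyl.y i * Weyl.x j : Weyl n R) =
      Weyl.symbol (Weyl.y i) * Weyl.symbol (Weyl.x j) +
        PowerSeries.X * (if i = j then 1 else 0) := by
    refine (hsum_of_le_one _ j fun κ h0 h1 => ?_).trans ?_
    · change mfact κ • (_ * dX κ (PowerSeries.C (MvPowerSeries.X (Sum.inl j)))) = 0
      rw [dX_of_linear j h0 h1, mul_zero, smul_zero]
    · have e1 : mfact (Finsupp.single j 1 : Fin n →₀ ℕ) = 1 :=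
        Finset.prod_eq_one fun k _ => by
          rw [Finsupp.single_apply]
          split_ifs <;> rfl
      have e2 : mfact (0 : Fin n →₀ ℕ) = 1 := Finset.prod_eq_one fun k _ => rfl
      have e3 := dX_single_X (R := R) j
      have e4 := dY_single_X (R := R) i j
      change mfact 0 • (dY 0 _ * dX 0 _) + PowerSeries.X * mfact _ •
        (dY (Finsupp.single j 1) (PowerSeries.C (MvPowerSeries.X (Sum.inr i))) *
          dX (Finsupp.single j 1) (PowerSeries.C (MvPowerSeries.X (Sum.inl j)))) = _
      rw [e3, e4, e1, e2, one_smul, one_smul, mul_one, dX_zero, dY_zero]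
  apply Weyl.symbol.injective
  rw [map_sub, h1, h2, mul_comm (Weyl.symbol (Weyl.x j))]
  split_ifs
  · rw [add_sub_cancel_left, mul_one]
    rfl
  · simp

end Relations

section Ideals

variable {n : ℕ} {R : Type} [CommRing R]

/-- The maximal ideal `𝔪 = ⟨x_i, y_i, h⟩` of the Weyl algebra. -/
def maxIdeal (n : ℕ) (R : Type) [CommRing R] : TwoSidedIdeal (Weyl n R) :=
  TwoSidedIdeal.span (Set.range Weyl.x ∪ Set.range Weyl.y ∪ {Weyl.h})

/-- The ideal `𝒥 = ⟨y_i, h⟩` of the Weyl algebra. -/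
def idealJ (n : ℕ) (R : Type) [CommRing R] : TwoSidedIdeal (Weyl n R) :=
  TwoSidedIdeal.span (Set.range Weyl.y ∪ {Weyl.h})

/-- Division by `h`: it removes the constant term in `h` and shifts the remaining coefficients. -/
def Weyl.divH (f : Weyl n R) : Weyl n R :=
  Weyl.ofSymbol (PowerSeries.mk fun N => PowerSeries.coeff (N + 1) (Weyl.symbol f))

theorem Weyl.symbol_X_smul (f : Weyl n R) :
    Weyl.symbol ((PowerSeries.X : PowerSeries R) • f) = PowerSeries.X * Weyl.symbol f := by
  have : (PowerSeries.X : PowerSeries R) • Weyl.symbol f =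
    PowerSeries.map (algebraMap R (SymbolRing n R)) PowerSeries.X * Weyl.symbol f := rfl
  rw [map_smul, this, PowerSeries.map_X]

theorem X_smul_vac (m : Vac n R) : (PowerSeries.X : PowerSeries R) • m = PowerSeries.X * m := by
  have : (PowerSeries.X : PowerSeries R) • m =
    PowerSeries.map (algebraMap R (FunRing n R)) PowerSeries.X * m := rfl
  rw [this, PowerSeries.map_X]

theorem Weyl.h_mul_cancel {f g : Weyl n R} (hfg : Weyl.h * f = Weyl.h * g) : f = g := by
  rw [Weyl.h_mul, Weyl.h_mul] at hfg
  have := congrArg Weyl.symbol hfg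
  rw [Weyl.symbol_X_smul, Weyl.symbol_X_smul] at this
  exact Weyl.symbol.injective (PowerSeries.X_mul_cancel this)

theorem Weyl.h_mul_divH (f : Weyl n R) (hf : PowerSeries.coeff 0 (Weyl.symbol f) = 0) :
    Weyl.h * Weyl.divH f = f := by
  apply Weyl.symbol.injective
  rw [Weyl.h_mul, Weyl.symbol_X_smul]
  ext N : 1
  cases N with
  | zero =>
    rw [hf]
    exact PowerSeries.coeff_zero_X_mul _
  | succ N =>
    rw [PowerSeries.coeff_succ_X_mul]
    exact PowerSeries.coeff_mk N fun N => PowerSeries.coeff (N + 1) (Weyl.symbol f)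

theorem Weyl.coeff_zero_mul (f g : Weyl n R) :
    PowerSeries.coeff 0 (Weyl.symbol (f * g)) =
      PowerSeries.coeff 0 (Weyl.symbol f) * PowerSeries.coeff 0 (Weyl.symbol g) := by
  rw [Weyl.symbol_mul, star, coeff_hsum]
  have : multi n 0 = {0} := by
    ext κ
    simp [mem_multi, Finsupp.ext_iff]
  rw [Finset.HasAntidiagonal.antidiagonal_zero, Finset.sum_singleton, this, Finset.sum_singleton, dX_zero,
    dY_zero]
  simp [mfact, PowerSeries.coeff_mul]

/-- The commutator of the Weyl algebra is divisible by `h`. -/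
theorem Weyl.h_mul_divH_comm (f g : Weyl n R) :
    Weyl.h * Weyl.divH (f * g - g * f) = f * g - g * f := by
  apply Weyl.h_mul_divH
  rw [map_sub, map_sub, Weyl.coeff_zero_mul, Weyl.coeff_zero_mul, mul_comm, sub_self]

theorem coeff_zero_X_smul (f : Weyl n R) (m : Vac n R) (hm : PowerSeries.coeff 0 m = 0) :
    PowerSeries.coeff 0 (f • m) = 0 := by
  obtain ⟨m', rfl⟩ := PowerSeries.X_dvd_iff.2 ((PowerSeries.coeff_zero_eq_constantCoeff_apply m) ▸ hm)
  rw [← X_smul_vac, smul_comm, X_smul_vac]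
  simp

/-- The annihilator of `ℳ_1 / h ℳ_1`. -/
def annModH (n : ℕ) (R : Type) [CommRing R] : TwoSidedIdeal (Weyl n R) :=
  TwoSidedIdeal.mk' {a | ∀ m : Vac n R, PowerSeries.coeff 0 (a • m) = 0}
    (by simp)
    (fun {a b} ha hb m => by rw [add_smul, map_add, ha m, hb m, add_zero])
    (fun {a} ha m => by rw [neg_smul, map_neg, ha m, neg_zero])
    (fun {a b} hb m => by rw [mul_smul]; exact coeff_zero_X_smul _ _ (hb m))
    (fun {a b} ha m => by rw [mul_smul]; exact ha _)

theorem exists_sum_X {σ : Type} [DecidableEq σ] (s : Finset σ) (f : MvPowerSeries σ R)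
    (hf : ∀ e, (∀ i ∈ s, e i = 0) → MvPowerSeries.coeff e f = 0) :
    ∃ q : σ → MvPowerSeries σ R, f = ∑ i ∈ s, q i * MvPowerSeries.X i := by
  induction s using Finset.induction_on generalizing f with
  | empty =>
    refine ⟨0, ?_⟩
    ext e
    simpa using hf e
  | insert a s ha ih =>
    let f' : MvPowerSeries σ R := fun e => if e a = 0 then MvPowerSeries.coeff e f else 0
    have hf' : ∀ e, MvPowerSeries.coeff e f' = if e a = 0 then MvPowerSeries.coeff e f else 0 :=
      fun e => rfl
    obtain ⟨q, hq⟩ := ih f' fun e he => by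
      rw [hf']
      split_ifs with h
      · exact hf e fun i hi => by
          rcases Finset.mem_insert.1 hi with rfl | hi
          · exact h
          · exact he i hi
      · rfl
    obtain ⟨g, hg⟩ : MvPowerSeries.X a ∣ f - f' := by
      rw [MvPowerSeries.X_dvd_iff]
      intro e he
      rw [map_sub, hf', if_pos he, sub_self]
    refine ⟨Function.update q a g, ?_⟩
    rw [Finset.sum_insert ha, Function.update_self, mul_comm, ← hg]
    have : ∑ i ∈ s, Function.update q a g i * MvPowerSeries.X i = f' := by
      rw [hq]
      refine Finset.sum_congr rfl fun i hi => ?_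
      rw [Function.update_of_ne (ne_of_mem_of_not_mem hi ha)]
    rw [this]
    abel

theorem mem_idealJ_of (a : Weyl n R) (ha : PowerSeries.coeff 0 (a • (1 : Vac n R)) = 0) :
    a ∈ idealJ n R := by
  classical
  rw [symbol_smul_one] at ha
  have hy : ∀ j, (Weyl.y j : Weyl n R) ∈ idealJ n R := fun j =>
    TwoSidedIdeal.subset_span (Or.inl ⟨j, rfl⟩)
  have hh : (Weyl.h : Weyl n R) ∈ idealJ n R := TwoSidedIdeal.subset_span (Or.inr rfl)
  obtain ⟨q, hq⟩ := exists_sum_X (Finset.univ.map ⟨(Sum.inr : Fin n → Fin n ⊕ Fin n),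
      Sum.inr_injective⟩) (PowerSeries.coeff 0 (Weyl.symbol a)) fun e he => by
    have h1 := congrArg (MvPowerSeries.coeff (e.comapDomain Sum.inl Sum.inl_injective.injOn)) ha
    rw [coeff_coeffY, map_zero] at h1
    have he' : (e.comapDomain Sum.inl Sum.inl_injective.injOn).sumElim 0 = e := by
      ext i
      rcases i with i | i
      · simp
      · simpa using (he (Sum.inr i) (by simp)).symm
    rwa [he'] at h1
  set b : Weyl n R := ∑ j, Weyl.ofSymbol (PowerSeries.C (q (Sum.inr j))) * Weyl.y j with hb
  have hbJ : b ∈ idealJ n R := sum_mem fun j _ => TwoSidedIdeal.mul_mem_left _ _ _ (hy j)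
  have hsymb : PowerSeries.coeff 0 (Weyl.symbol b) = PowerSeries.coeff 0 (Weyl.symbol a) := by
    rw [hq, hb, map_sum, map_sum, Finset.sum_map]
    refine Finset.sum_congr rfl fun j _ => ?_
    rw [Weyl.coeff_zero_mul]
    change PowerSeries.coeff 0 (PowerSeries.C _) * PowerSeries.coeff 0 (PowerSeries.C _) = _
    simp
  have : a = b + Weyl.h * Weyl.divH (a - b) := by
    rw [Weyl.h_mul_divH _ (by rw [map_sub, map_sub, hsymb, sub_self])]
    abel
  rw [this]
  exact TwoSidedIdeal.add_mem _ hbJ (TwoSidedIdeal.mul_mem_right _ _ _ hh)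

theorem idealJ_le_annModH : idealJ n R ≤ annModH n R := by
  refine TwoSidedIdeal.span_le.2 ?_
  rintro a (⟨j, rfl⟩ | rfl)
  · refine (TwoSidedIdeal.mem_mk' _ _ _ _ _ _ _).2 fun m => ?_
    obtain ⟨w, rfl⟩ := coeffY_zero_surjective m
    change PowerSeries.coeff 0 (opAct _ _) = 0
    rw [← coeffY_zero_star]
    have h0 := Weyl.coeff_zero_mul (Weyl.y j) (Weyl.ofSymbol w)
    rw [Weyl.symbol_mul] at h0
    ext e
    have h1 : (PowerSeries.coeff 0 (star (Weyl.symbol (Weyl.y j)) w) : SymbolRing n R) =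
      MvPowerSeries.X (Sum.inr j) * PowerSeries.coeff 0 w := by
      refine h0.trans ?_
      congr 1
      change PowerSeries.coeff 0 (PowerSeries.C _) = _
      simp
    rw [coeff_coeffY, h1, map_zero]
    exact MvPowerSeries.X_dvd_iff.1 (dvd_mul_right _ _) _ (by simp)
  · refine (TwoSidedIdeal.mem_mk' _ _ _ _ _ _ _).2 fun m => ?_
    rw [Weyl.h_eq, algebraMap_smul, X_smul_vac]
    simp

/-- `a ∈ 𝒥` if and only if `a ℳ_1 ⊆ h ℳ_1`. -/
theorem mem_idealJ_iff (a : Weyl n R) :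
    a ∈ idealJ n R ↔ ∀ m : Vac n R, PowerSeries.coeff 0 (a • m) = 0 :=
  ⟨fun ha => (TwoSidedIdeal.mem_mk' _ _ _ _ _ _ _).1 (idealJ_le_annModH ha),
    fun ha => mem_idealJ_of a (ha 1)⟩

/-- `[𝒥, 𝒥] ⊆ h 𝒥`. -/
theorem divH_comm_mem_idealJ (a b : Weyl n R) (ha : a ∈ idealJ n R) (hb : b ∈ idealJ n R) :
    Weyl.divH (a * b - b * a) ∈ idealJ n R := by
  rw [mem_idealJ_iff] at *
  intro m
  obtain ⟨u, hu⟩ := PowerSeries.X_dvd_iff.2 (PowerSeries.coeff_zero_eq_constantCoeff_apply (R := FunRing n R) _ ▸ ha m)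
  obtain ⟨v, hv⟩ := PowerSeries.X_dvd_iff.2 (PowerSeries.coeff_zero_eq_constantCoeff_apply (R := FunRing n R) _ ▸ hb m)
  have h1 : PowerSeries.X * (Weyl.divH (a * b - b * a) • m) =
      PowerSeries.X * (a • v - b • u) := by
    rw [← X_smul_vac, ← smul_assoc, ← Weyl.h_mul, Weyl.h_mul_divH_comm, sub_smul, mul_smul,
      mul_smul, hu, hv, ← X_smul_vac, ← X_smul_vac, ← X_smul_vac, smul_comm a, smul_comm b,
      smul_sub]
  rw [PowerSeries.X_mul_cancel h1, map_sub, ha v, hb u, sub_zero]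

end Ideals

section Groups

variable {n r : ℕ} {R : Type} [CommRing R]

/-- The group `Aut(𝒟, ℳ_r)` over `R`, as a subgroup: pairs `(Φ, Ψ)` of an `R⟦h⟧`-algebra automorphism `Φ` of
`𝒟` preserving `𝔪` and an `R⟦h⟧`-linear automorphism `Ψ` of `ℳ_r` with `Ψ (a m) = Φ a (Ψ m)`. -/
def pairAutSubgroup (n r : ℕ) (R : Type) [CommRing R] :
    Subgroup ((Weyl n R ≃ₐ[PowerSeries R] Weyl n R) ×
      (FormalModule n r R ≃ₗ[PowerSeries R] FormalModule n r R)) where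
  carrier := {p | (∀ a, p.1 a ∈ maxIdeal n R ↔ a ∈ maxIdeal n R) ∧
    ∀ (a : Weyl n R) (m : FormalModule n r R), p.2 (a • m) = p.1 a • p.2 m}
  one_mem' := ⟨fun _ => Iff.rfl, fun _ _ => rfl⟩
  mul_mem' {p q} hp hq := ⟨fun a => (hp.1 (q.1 a)).trans (hq.1 a), fun a m => by
    change p.2 (q.2 (a • m)) = p.1 (q.1 a) • p.2 (q.2 m)
    rw [hq.2, hp.2]⟩
  inv_mem' {p} hp := ⟨fun a => by
      change p.1.symm a ∈ _ ↔ _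
      rw [← hp.1, AlgEquiv.apply_symm_apply], fun a m => by
      change p.2.symm (a • m) = p.1.symm a • p.2.symm m
      rw [LinearEquiv.symm_apply_eq, hp.2, AlgEquiv.apply_symm_apply,
        LinearEquiv.apply_symm_apply]⟩

/-- The group `Aut(𝒟, ℳ_r)` over `R`. -/
abbrev PairAut (n r : ℕ) (R : Type) [CommRing R] : Type := pairAutSubgroup n r R

/-- The component `Φ : 𝒟 → 𝒟` of an element of `Aut(𝒟, ℳ_r)`. -/
def PairAut.alg (p : PairAut n r R) : Weyl n R ≃ₐ[PowerSeries R] Weyl n R := p.1.1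

/-- The component `Ψ : ℳ_r → ℳ_r` of an element of `Aut(𝒟, ℳ_r)`. -/
def PairAut.mod (p : PairAut n r R) :
    FormalModule n r R ≃ₗ[PowerSeries R] FormalModule n r R := p.1.2

/-- The subgroup of `Aut(𝒟, ℳ_r)` of constant scalars, that is, the `R`-points of `ℂ^*`: the
pairs `(id, c)` with `c ∈ Rˣ`. -/
def scalarAut (n r : ℕ) (R : Type) [CommRing R] : Subgroup (PairAut n r R) where
  carrier := {p | p.alg = 1 ∧ ∃ c : Rˣ, ∀ m, p.mod m = PowerSeries.C (c : R) • m}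
  one_mem' := ⟨rfl, 1, fun m => by rw [Units.val_one, map_one, one_smul]; rfl⟩
  mul_mem' := by
    rintro p q ⟨hp, c, hc⟩ ⟨hq, d, hd⟩
    refine ⟨?_, c * d, fun m => ?_⟩
    · change p.alg * q.alg = 1
      rw [hp, hq, one_mul]
    · change p.mod (q.mod m) = _
      rw [hd, hc, Units.val_mul, map_mul, mul_smul]
  inv_mem' := by
    rintro p ⟨hp, c, hc⟩
    refine ⟨?_, c⁻¹, fun m => ?_⟩
    · change p.alg⁻¹ = 1
      rw [hp, inv_one]
    · change p.mod.symm m = _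
      rw [LinearEquiv.symm_apply_eq, hc, ← mul_smul, ← map_mul, Units.mul_inv, map_one, one_smul]

instance : (scalarAut n r R).Normal where
  conj_mem := by
    rintro p ⟨hp, c, hc⟩ q
    refine ⟨?_, c, fun m => ?_⟩
    · change q.alg * p.alg * q.alg⁻¹ = 1
      rw [hp, mul_one, mul_inv_cancel]
    · change q.mod (p.mod (q.mod.symm m)) = _
      rw [hc, map_smul, LinearEquiv.apply_symm_apply]

/-- `g'` is the base change of `g` along `ρ : R → S`: both components are compatible with the
coefficientwise maps `𝒟(R) → 𝒟(S)` and `ℳ_r(R) → ℳ_r(S)`. -/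
def PairAut.BaseChange {S : Type} [CommRing S] (ρ : R →+* S) (g : PairAut n r R)
    (g' : PairAut n r S) : Prop :=
  (∀ a, g'.alg (Weyl.map ρ a) = Weyl.map ρ (g.alg a)) ∧
    ∀ m, g'.mod (FormalModule.map ρ m) = FormalModule.map ρ (g.mod m)

open scoped MatrixGroups

/-- The kernel `exp(h 𝔭𝔤𝔩_h(r))` of the evaluation map `PGL_h(r) → PGL(r)`, `h ↦ 0`,
over `R`. -/
def expKer (r : ℕ) (R : Type) [CommRing R] : Subgroup (PGL(r, PowerSeries R)) :=
  (Matrix.ProjGenLinGroup.map (PowerSeries.constantCoeff (R := R))).ker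

instance : (expKer r R).Normal := MonoidHom.normal_ker _

/-- `GL(r) → GL_h(r)`, the matrices that are constant in `h`. -/
def constGL (r : ℕ) (R : Type) [CommRing R] : GL (Fin r) R →* GL (Fin r) (PowerSeries R) :=
  Matrix.GeneralLinearGroup.map PowerSeries.C

/-- The conjugation action of `GL(r)` on `exp(h 𝔭𝔤𝔩_h(r))`. -/
def conjExp (r : ℕ) (R : Type) [CommRing R] : GL (Fin r) R →* MulAut (expKer r R) :=
  MulAut.conjNormal.comp (Matrix.ProjGenLinGroup.mk.comp (constGL r R))

/-- The semidirect product `GL(r) ⋉ exp(h 𝔭𝔤𝔩_h(r))` over `R`. -/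
abbrev SemiGL (r : ℕ) (R : Type) [CommRing R] : Type :=
  expKer r R ⋊[conjExp r R] GL (Fin r) R

/-- The multiplication map `GL(r) ⋉ exp(h 𝔭𝔤𝔩_h(r)) → PGL_h(r)`; its kernel is `ℂ^* ⊆ GL(r)`. -/
def SemiGL.toPGL (r : ℕ) (R : Type) [CommRing R] : SemiGL r R →* PGL(r, PowerSeries R) :=
  SemidirectProduct.lift (expKer r R).subtype
    (Matrix.ProjGenLinGroup.mk.comp (constGL r R)) (fun g => by
      ext x
      rfl)

end Groups

section LieAlgebras

variable {n r : ℕ}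

theorem smul_smul_series {R A : Type} [CommRing R] [CommRing A] [Algebra R A] (c : R)
    (f : PowerSeries R) (g : PowerSeries A) : (c • f) • g = c • f • g := by
  have h1 (f : PowerSeries R) (g : PowerSeries A) :
    f • g = PowerSeries.map (algebraMap R A) f * g := rfl
  have h2 : PowerSeries.map (algebraMap R A) (c • f) = c • PowerSeries.map (algebraMap R A) f := by
    ext N
    rw [PowerSeries.coeff_map, PowerSeries.coeff_smul, PowerSeries.coeff_smul,
      PowerSeries.coeff_map, smul_eq_mul, map_mul, Algebra.smul_def]
  rw [h1, h1, h2, smul_mul_assoc]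

instance (R : Type) [CommRing R] : Module R (Weyl n R) :=
  inferInstanceAs (Module R (PowerSeries (SymbolRing n R)))

instance (R : Type) [CommRing R] : IsScalarTower R (PowerSeries R) (Weyl n R) :=
  ⟨fun c f g => smul_smul_series c f (Weyl.symbol g)⟩

instance (R : Type) [CommRing R] : IsScalarTower R (PowerSeries R) (Vac n R) :=
  ⟨fun c f g => smul_smul_series c f g⟩

theorem C_smul_eq {M : Type} [AddCommGroup M] [Module ℂ M] [Module (PowerSeries ℂ) M]
    [IsScalarTower ℂ (PowerSeries ℂ) M] (c : ℂ) (m : M) :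
    (PowerSeries.C c : PowerSeries ℂ) • m = c • m := by
  rw [← mul_one (PowerSeries.C c), ← PowerSeries.smul_eq_C_mul, smul_assoc, one_smul]

/-- The Lie algebra `Der(𝒟, ℳ_r)`: pairs `(φ, ψ)` of `ℂ⟦h⟧`-linear maps such that `φ` is a
derivation of `𝒟` and `ψ (a m) = φ a m + a (ψ m)`, with the commutator bracket. -/
def pairDerSubalgebra (n r : ℕ) : LieSubalgebra ℂ (Module.End (PowerSeries ℂ) (Weyl n ℂ) ×
    Module.End (PowerSeries ℂ) (FormalModule n r ℂ)) where
  carrier := {X | (∀ a b : Weyl n ℂ, X.1 (a * b) = X.1 a * b + a * X.1 b) ∧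
    ∀ (a : Weyl n ℂ) (m : FormalModule n r ℂ), X.2 (a • m) = X.1 a • m + a • X.2 m}
  add_mem' {X Y} hX hY := ⟨fun a b => by
      simp only [Prod.fst_add, LinearMap.add_apply, hX.1, hY.1, add_mul, mul_add]
      abel, fun a m => by
      simp only [Prod.fst_add, Prod.snd_add, LinearMap.add_apply, hX.2, hY.2, add_smul, smul_add]
      abel⟩
  zero_mem' := ⟨fun a b => by simp, fun a m => by simp⟩
  smul_mem' c X hX := ⟨fun a b => by
      simp only [Prod.smul_fst, LinearMap.smul_apply, hX.1, ← C_smul_eq, smul_add, smul_mul_assoc,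
        mul_smul_comm], fun a m => by
      simp only [Prod.smul_fst, Prod.smul_snd, LinearMap.smul_apply, hX.2, ← C_smul_eq, smul_add,
        smul_assoc, smul_comm a]⟩
  lie_mem' {X Y} hX hY := ⟨fun a b => by
      change X.1 (Y.1 (a * b)) - Y.1 (X.1 (a * b)) =
        (X.1 (Y.1 a) - Y.1 (X.1 a)) * b + a * (X.1 (Y.1 b) - Y.1 (X.1 b))
      simp only [hX.1, hY.1, map_add, sub_mul, mul_sub]
      abel, fun a m => by
      change X.2 (Y.2 (a • m)) - Y.2 (X.2 (a • m)) =
        (X.1 (Y.1 a) - Y.1 (X.1 a)) • m + a • (X.2 (Y.2 m) - Y.2 (X.2 m))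
      simp only [hX.2, hY.2, map_add, sub_smul, smul_sub]
      abel⟩

/-- The Lie algebra `Der(𝒟, ℳ_r)`. -/
abbrev PairDer (n r : ℕ) : Type := pairDerSubalgebra n r

/-- The component `φ : 𝒟 → 𝒟` of an element of `Der(𝒟, ℳ_r)`. -/
def PairDer.alg (X : PairDer n r) : Weyl n ℂ →ₗ[PowerSeries ℂ] Weyl n ℂ := X.1.1

/-- The component `ψ : ℳ_r → ℳ_r` of an element of `Der(𝒟, ℳ_r)`. -/
def PairDer.mod (X : PairDer n r) :
    FormalModule n r ℂ →ₗ[PowerSeries ℂ] FormalModule n r ℂ := X.1.2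

theorem PairDer.ext {X Y : PairDer n r} (h1 : ∀ a, X.alg a = Y.alg a)
    (h2 : ∀ m, X.mod m = Y.mod m) : X = Y :=
  Subtype.ext (Prod.ext (LinearMap.ext h1) (LinearMap.ext h2))

theorem PairDer.lie_alg (X Y : PairDer n r) (a : Weyl n ℂ) :
    ⁅X, Y⁆.alg a = X.alg (Y.alg a) - Y.alg (X.alg a) := rfl

theorem PairDer.lie_mod (X Y : PairDer n r) (m : FormalModule n r ℂ) :
    ⁅X, Y⁆.mod m = X.mod (Y.mod m) - Y.mod (X.mod m) := rfl

/-- The ideal `ℂ ⊆ Der(𝒟, ℳ_r)` of constant scalars `(0, c)`. -/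
def scalarDer (n r : ℕ) : LieIdeal ℂ (PairDer n r) where
  carrier := {X | (∀ a, X.alg a = 0) ∧ ∃ c : ℂ, ∀ m, X.mod m = c • m}
  add_mem' := by
    rintro X Y ⟨hX, c, hc⟩ ⟨hY, d, hd⟩
    refine ⟨fun a => ?_, c + d, fun m => ?_⟩
    · change X.alg a + Y.alg a = 0
      rw [hX, hY, add_zero]
    · change X.mod m + Y.mod m = _
      rw [hc, hd, add_smul]
  zero_mem' := ⟨fun a => rfl, 0, fun m => by rw [zero_smul]; rfl⟩
  smul_mem' := by
    rintro t X ⟨hX, c, hc⟩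
    refine ⟨fun a => ?_, t * c, fun m => ?_⟩
    · change t • X.alg a = 0
      rw [hX, smul_zero]
    · change t • X.mod m = _
      rw [hc, mul_smul]
  lie_mem := by
    rintro X Y ⟨hY, c, hc⟩
    refine ⟨fun a => ?_, 0, fun m => ?_⟩
    · rw [PairDer.lie_alg, hY, hY, map_zero, sub_zero]
    · rw [PairDer.lie_mod, hc, hc, ← C_smul_eq, map_smul, C_smul_eq, sub_self, zero_smul]

/-- The `ℂ`-vector space `(1/h) 𝒟`: the vector `a` of `𝒟` stands for `(1/h) a`. It is
a Lie algebra for the commutator bracket `[(1/h) a, (1/h) b] = (1/h) ((1/h) (a b - b a))`. -/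
def HInv (n : ℕ) : Type := Weyl n ℂ

namespace HInv

instance : AddCommGroup (HInv n) := inferInstanceAs (AddCommGroup (Weyl n ℂ))

instance : Module ℂ (HInv n) := inferInstanceAs (Module ℂ (Weyl n ℂ))

/-- The element `h α` of `𝒟`, for `α ∈ (1/h) 𝒟`. -/
def num : HInv n ≃ₗ[ℂ] Weyl n ℂ := LinearEquiv.refl _ _

/-- The element `(1/h) a`, for `a ∈ 𝒟`. -/
def mk : Weyl n ℂ ≃ₗ[ℂ] HInv n := LinearEquiv.refl _ _

instance : Bracket (HInv n) (HInv n) :=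
  ⟨fun α β => mk (Weyl.divH (num α * num β - num β * num α))⟩

theorem h_mul_num_lie (α β : HInv n) :
    Weyl.h * num ⁅α, β⁆ = num α * num β - num β * num α :=
  Weyl.h_mul_divH_comm _ _

theorem eq_of {α β : HInv n} (h : Weyl.h * num α = Weyl.h * num β) : α = β :=
  num.injective (Weyl.h_mul_cancel h)

instance : LieRing (HInv n) where
  add_lie α β γ := eq_of (by
    simp only [map_add, mul_add, h_mul_num_lie, add_mul]
    abel)
  lie_add α β γ := eq_of (by
    simp only [map_add, mul_add, h_mul_num_lie, add_mul]
    abel)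
  lie_self α := eq_of (by simp only [h_mul_num_lie, map_zero, mul_zero, sub_self])
  leibniz_lie α β γ := eq_of (Weyl.h_mul_cancel (by
    have key (a : Weyl n ℂ) (β γ : HInv n) : a * (Weyl.h * num ⁅β, γ⁆) =
      Weyl.h * (a * num ⁅β, γ⁆) := by rw [← mul_assoc, ← Weyl.h_comm, mul_assoc]
    simp only [map_add, mul_add, h_mul_num_lie, mul_sub, ← key]
    simp only [← mul_assoc]
    simp only [h_mul_num_lie, mul_assoc, sub_mul]
    abel))

instance : LieAlgebra ℂ (HInv n) where
  lie_smul c α β := eq_of (by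
    simp only [h_mul_num_lie, map_smul, ← C_smul_eq, mul_smul_comm, smul_mul_assoc, smul_sub])

end HInv

/-- The Lie algebra `(1/h) 𝒥` with the commutator bracket. -/
def hInvJ (n : ℕ) : LieSubalgebra ℂ (HInv n) where
  carrier := {α | HInv.num α ∈ idealJ n ℂ}
  add_mem' {α β} hα hβ := (idealJ n ℂ).add_mem hα hβ
  zero_mem' := (idealJ n ℂ).zero_mem
  smul_mem' c α hα := by
    change HInv.num (c • α) ∈ _
    rw [map_smul, ← C_smul_eq, Algebra.smul_def]
    exact (idealJ n ℂ).mul_mem_left _ _ hα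
  lie_mem' {α β} hα hβ := divH_comm_mem_idealJ _ _ hα hβ

/-- The ideal `ℂ ⊆ (1/h) 𝒥` of constants `c = (1/h) (c h)`. -/
def constJ (n : ℕ) : LieIdeal ℂ (hInvJ n) where
  carrier := {α | ∃ c : ℂ, HInv.num α.1 = c • Weyl.h}
  add_mem' := by
    rintro α β ⟨c, hc⟩ ⟨d, hd⟩
    exact ⟨c + d, by
      change HInv.num (α.1 + β.1) = _
      rw [map_add, hc, hd, add_smul]⟩
  zero_mem' := ⟨0, by rw [zero_smul]; rfl⟩
  smul_mem' := by
    rintro t α ⟨c, hc⟩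
    exact ⟨t * c, by
      change HInv.num (t • α.1) = _
      rw [map_smul, hc, mul_smul]⟩
  lie_mem := by
    rintro α β ⟨c, hc⟩
    refine ⟨0, Weyl.h_mul_cancel ?_⟩
    change Weyl.h * HInv.num ⁅α.1, β.1⁆ = _
    rw [HInv.h_mul_num_lie, hc, ← C_smul_eq, mul_smul_comm, smul_mul_assoc, Weyl.h_comm, sub_self,
      zero_smul, mul_zero]

/-- The Lie algebra `𝔤𝔩_h(r)` of `r × r` matrices over `ℂ⟦h⟧`. -/
abbrev GlH (r : ℕ) : Type := Matrix (Fin r) (Fin r) (PowerSeries ℂ)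

/-- The ideal `ℂ⟦h⟧ ⊆ 𝔤𝔩_h(r)` of scalar matrices. -/
def scalarGlH (r : ℕ) : LieIdeal ℂ (GlH r) where
  carrier := {A | ∃ c : PowerSeries ℂ, A = Matrix.scalar (Fin r) c}
  add_mem' := by
    rintro A B ⟨c, rfl⟩ ⟨d, rfl⟩
    exact ⟨c + d, (map_add _ _ _).symm⟩
  zero_mem' := ⟨0, (map_zero _).symm⟩
  smul_mem' := by
    rintro t A ⟨c, rfl⟩
    exact ⟨t • c, by ext i j; simp [Matrix.diagonal_apply, apply_ite (t • ·)]⟩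
  lie_mem := by
    rintro A B ⟨c, rfl⟩
    refine ⟨0, ?_⟩
    rw [map_zero, LieRing.of_associative_ring_bracket, sub_eq_zero]
    exact ((Matrix.scalar_commute c (fun d => mul_comm c d) A).eq).symm

/-- The Lie algebra `𝔭𝔤𝔩_h(r) = 𝔤𝔩_h(r) / ℂ⟦h⟧`. -/
abbrev PglH (r : ℕ) : Type := GlH r ⧸ scalarGlH r

end LieAlgebras

section Actions

variable {n r : ℕ}

/-- The representation on the quotient by an invariant ideal. -/
def quotRep {G L : Type} [Group G] [LieRing L] [LieAlgebra ℂ L] (I : LieIdeal ℂ L)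
    (ρ : Representation ℂ G L) (hρ : ∀ g, ∀ x ∈ I, ρ g x ∈ I) : Representation ℂ G (L ⧸ I) where
  toFun g := Submodule.mapQ I.toSubmodule I.toSubmodule (ρ g) (hρ g)
  map_one' := by
    refine LinearMap.ext fun x => ?_
    obtain ⟨x, rfl⟩ := LieSubmodule.Quotient.surjective_mk' I x
    change LieSubmodule.Quotient.mk' I (ρ 1 x) = _
    rw [map_one]
    rfl
  map_mul' g g' := by
    refine LinearMap.ext fun x => ?_
    obtain ⟨x, rfl⟩ := LieSubmodule.Quotient.surjective_mk' I x
    change LieSubmodule.Quotient.mk' I (ρ (g * g') x) = _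
    rw [map_mul]
    rfl

theorem quotRep_mk {G L : Type} [Group G] [LieRing L] [LieAlgebra ℂ L] (I : LieIdeal ℂ L)
    (ρ : Representation ℂ G L) (hρ : ∀ g, ∀ x ∈ I, ρ g x ∈ I) (g : G) (x : L) :
    quotRep I ρ hρ g (LieSubmodule.Quotient.mk' I x) = LieSubmodule.Quotient.mk' I (ρ g x) := rfl

theorem quotRep_lie {G L : Type} [Group G] [LieRing L] [LieAlgebra ℂ L] (I : LieIdeal ℂ L)
    (ρ : Representation ℂ G L) (hρ : ∀ g, ∀ x ∈ I, ρ g x ∈ I)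
    (hl : ∀ g x y, ρ g ⁅x, y⁆ = ⁅ρ g x, ρ g y⁆) (g : G) (x y : L ⧸ I) :
    quotRep I ρ hρ g ⁅x, y⁆ = ⁅quotRep I ρ hρ g x, quotRep I ρ hρ g y⁆ := by
  obtain ⟨x, rfl⟩ := LieSubmodule.Quotient.surjective_mk' I x
  obtain ⟨y, rfl⟩ := LieSubmodule.Quotient.surjective_mk' I y
  exact congrArg (LieSubmodule.Quotient.mk' I) (hl g x y)

/-- The adjoint action of `Aut(𝒟, ℳ_r)` on `Der(𝒟, ℳ_r)` by conjugation. -/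
def conjDer (n r : ℕ) : Representation ℂ (PairAut n r ℂ) (PairDer n r) where
  toFun p :=
    { toFun := fun X =>
        ⟨(p.alg.toLinearMap ∘ₗ X.alg ∘ₗ p.alg.symm.toLinearMap,
          p.mod.toLinearMap ∘ₗ X.mod ∘ₗ p.mod.symm.toLinearMap),
          fun a b => by
            change p.alg (X.alg (p.alg.symm (a * b))) = p.alg (X.alg (p.alg.symm a)) * b +
              a * p.alg (X.alg (p.alg.symm b))
            rw [map_mul, show X.alg _ = _ from X.2.1 _ _, map_add, map_mul, map_mul,
              AlgEquiv.apply_symm_apply, AlgEquiv.apply_symm_apply]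
            rfl,
          fun a m => by
            change p.mod (X.mod (p.mod.symm (a • m))) = p.alg (X.alg (p.alg.symm a)) • m +
              a • p.mod (X.mod (p.mod.symm m))
            have h1 : p.mod.symm (a • m) = p.alg.symm a • p.mod.symm m := p⁻¹.2.2 a m
            rw [h1, show X.mod _ = _ from X.2.2 _ _, map_add, show p.mod _ = _ from p.2.2 _ _,
              show p.mod (_ • X.1.2 _) = _ from p.2.2 _ _]
            change p.alg (X.alg _) • p.mod (p.mod.symm m) + p.alg (p.alg.symm a) • _ = _
            rw [AlgEquiv.apply_symm_apply, LinearEquiv.apply_symm_apply]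
            rfl⟩
      map_add' := fun X Y => PairDer.ext (fun a => map_add p.alg _ _) (fun m => map_add p.mod _ _)
      map_smul' := fun c X => PairDer.ext
        (fun a => by
          change p.alg (c • X.alg _) = c • p.alg (X.alg _)
          rw [← C_smul_eq, map_smul, C_smul_eq])
        (fun m => by
          change p.mod (c • X.mod _) = c • p.mod (X.mod _)
          rw [← C_smul_eq, map_smul, C_smul_eq]) }
  map_one' := rfl
  map_mul' p q := rfl

theorem conjDer_alg (p : PairAut n r ℂ) (X : PairDer n r) (a : Weyl n ℂ) :
    (conjDer n r p X).alg a = p.alg (X.alg (p.alg.symm a)) := rfl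

theorem conjDer_mod (p : PairAut n r ℂ) (X : PairDer n r) (m : FormalModule n r ℂ) :
    (conjDer n r p X).mod m = p.mod (X.mod (p.mod.symm m)) := rfl

theorem conjDer_lie (p : PairAut n r ℂ) (X Y : PairDer n r) :
    conjDer n r p ⁅X, Y⁆ = ⁅conjDer n r p X, conjDer n r p Y⁆ :=
  PairDer.ext
    (fun a => by
      simp only [conjDer_alg, PairDer.lie_alg, map_sub, AlgEquiv.symm_apply_apply])
    (fun m => by
      simp only [conjDer_mod, PairDer.lie_mod, map_sub, LinearEquiv.symm_apply_apply])

theorem conjDer_scalarDer (p : PairAut n r ℂ) (X : PairDer n r) (hX : X ∈ scalarDer n r) :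
    conjDer n r p X ∈ scalarDer n r := by
  obtain ⟨h0, c, hc⟩ := hX
  refine ⟨fun a => ?_, c, fun m => ?_⟩
  · rw [conjDer_alg, h0, map_zero]
  · rw [conjDer_mod, hc, ← C_smul_eq, map_smul, C_smul_eq, LinearEquiv.apply_symm_apply]

theorem conjDer_of_mem (p : PairAut n r ℂ) (hp : p ∈ scalarAut n r ℂ) : conjDer n r p = 1 := by
  obtain ⟨h1, c, hc⟩ := hp
  refine LinearMap.ext fun X => PairDer.ext (fun a => ?_) (fun m => ?_)
  · rw [conjDer_alg, h1]
    rfl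
  · rw [conjDer_mod, hc, ← map_smul, ← hc, LinearEquiv.apply_symm_apply]
    rfl

/-- An automorphism of `(𝒟, ℳ_1)` preserves `𝒥`. -/
theorem alg_mem_idealJ {R : Type} [CommRing R] (p : PairAut n 1 R) (a : Weyl n R)
    (ha : a ∈ idealJ n R) : p.alg a ∈ idealJ n R := by
  rw [mem_idealJ_iff] at *
  intro m
  obtain ⟨M, hM⟩ : ∃ M, p.mod M = fun _ => m := p.mod.surjective _
  obtain ⟨v, hv⟩ := PowerSeries.X_dvd_iff.2
    (PowerSeries.coeff_zero_eq_constantCoeff_apply (R := FunRing n R) _ ▸ ha (M 0))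
  have h1 : a • M = (PowerSeries.X : PowerSeries R) • (fun _ => v : FormalModule n 1 R) := by
    funext i
    rw [Subsingleton.elim i 0]
    change a • M 0 = (PowerSeries.X : PowerSeries R) • v
    rw [hv, X_smul_vac]
  have h2 : p.alg a • (fun _ => m : FormalModule n 1 R) =
      (PowerSeries.X : PowerSeries R) • p.mod (fun _ => v) := by
    rw [← hM]
    exact (p.2.2 a M).symm.trans ((congrArg p.mod h1).trans (map_smul p.mod _ _))
  have h3 : p.alg a • m = (PowerSeries.X : PowerSeries R) • (p.mod fun _ => v) 0 :=
    congrFun h2 0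
  rw [h3, X_smul_vac]
  exact PowerSeries.coeff_zero_X_mul _

/-- The action of `Aut(𝒟, ℳ_1)` on `(1/h) 𝒥`: the pair `(Φ, Ψ)` sends `(1/h) a`
to `(1/h) (Φ a)`. -/
def actJ (n : ℕ) : Representation ℂ (PairAut n 1 ℂ) (hInvJ n) where
  toFun p :=
    { toFun := fun α => ⟨HInv.mk (p.alg (HInv.num α.1)), alg_mem_idealJ p _ α.2⟩
      map_add' := fun α β => Subtype.ext (map_add p.alg _ _)
      map_smul' := fun c α => Subtype.ext (by
        change p.alg (c • HInv.num α.1) = c • p.alg (HInv.num α.1)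
        rw [← C_smul_eq, map_smul, C_smul_eq]) }
  map_one' := rfl
  map_mul' p q := rfl

theorem num_actJ (p : PairAut n 1 ℂ) (α : hInvJ n) :
    HInv.num (actJ n p α).1 = p.alg (HInv.num α.1) := rfl

theorem alg_h {R : Type} [CommRing R] (p : PairAut n r R) : p.alg Weyl.h = Weyl.h := by
  rw [Weyl.h_eq, AlgEquiv.commutes]

theorem actJ_lie (p : PairAut n 1 ℂ) (α β : hInvJ n) :
    actJ n p ⁅α, β⁆ = ⁅actJ n p α, actJ n p β⁆ := by
  refine Subtype.ext (HInv.eq_of ?_)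
  change Weyl.h * p.alg (HInv.num ⁅α.1, β.1⁆) = Weyl.h * HInv.num ⁅(actJ n p α).1, (actJ n p β).1⁆
  rw [HInv.h_mul_num_lie, num_actJ, num_actJ, ← map_mul p.alg, ← map_mul p.alg, ← map_sub p.alg,
    ← HInv.h_mul_num_lie, map_mul p.alg, alg_h]

theorem actJ_constJ (p : PairAut n 1 ℂ) (α : hInvJ n) (hα : α ∈ constJ n) :
    actJ n p α ∈ constJ n := by
  obtain ⟨c, hc⟩ := hα
  refine ⟨c, ?_⟩
  rw [num_actJ, hc, ← C_smul_eq, map_smul, alg_h, C_smul_eq]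

theorem actJ_of_mem (p : PairAut n 1 ℂ) (hp : p ∈ scalarAut n 1 ℂ) : actJ n p = 1 := by
  refine LinearMap.ext fun α => Subtype.ext ?_
  change HInv.mk (p.alg (HInv.num α.1)) = _
  rw [hp.1]
  rfl

/-- The adjoint action of `GL_h(r)` on `𝔤𝔩_h(r)` by conjugation. -/
def conjGlH (r : ℕ) : Representation ℂ (GL (Fin r) (PowerSeries ℂ)) (GlH r) where
  toFun g :=
    { toFun := fun A => (g : GlH r) * A * ((g⁻¹ : GL (Fin r) (PowerSeries ℂ)) : GlH r)
      map_add' := fun A B => by rw [mul_add, add_mul]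
      map_smul' := fun c A => by rw [mul_smul_comm, smul_mul_assoc]; rfl }
  map_one' := by
    refine LinearMap.ext fun A => ?_
    change ((1 : GL (Fin r) (PowerSeries ℂ)) : GlH r) * A * _ = A
    rw [inv_one, Units.val_one, one_mul, mul_one]
  map_mul' g g' := by
    refine LinearMap.ext fun A => ?_
    change ((g * g' : GL (Fin r) (PowerSeries ℂ)) : GlH r) * A * _ = (g : GlH r) * (_ * A * _) * _
    rw [mul_inv_rev, Units.val_mul, Units.val_mul]
    simp only [mul_assoc]

theorem conjGlH_apply (g : GL (Fin r) (PowerSeries ℂ)) (A : GlH r) :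
    conjGlH r g A = (g : GlH r) * A * ((g⁻¹ : GL (Fin r) (PowerSeries ℂ)) : GlH r) := rfl

theorem conjGlH_lie (g : GL (Fin r) (PowerSeries ℂ)) (A B : GlH r) :
    conjGlH r g ⁅A, B⁆ = ⁅conjGlH r g A, conjGlH r g B⁆ := by
  have key (A B : GlH r) : conjGlH r g A * conjGlH r g B = conjGlH r g (A * B) := by
    simp only [conjGlH_apply, mul_assoc]
    rw [← mul_assoc _ (g : GlH r), Units.inv_mul, one_mul]
  rw [LieRing.of_associative_ring_bracket, LieRing.of_associative_ring_bracket, key, key, map_sub]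

theorem conjGlH_scalar (g : GL (Fin r) (PowerSeries ℂ)) (A : GlH r) (hA : A ∈ scalarGlH r) :
    conjGlH r g A ∈ scalarGlH r := by
  obtain ⟨c, rfl⟩ := hA
  refine ⟨c, ?_⟩
  rw [conjGlH_apply, ← (Matrix.scalar_commute c (fun d => mul_comm c d) (g : GlH r)).eq, mul_assoc,
    Units.mul_inv, mul_one]

open scoped MatrixGroups

/-- The adjoint action of `PGL_h(r)` on `𝔭𝔤𝔩_h(r)`. -/
def conjPglH (r : ℕ) : Representation ℂ (PGL(r, PowerSeries ℂ)) (PglH r) :=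
  Matrix.ProjGenLinGroup.lift (quotRep (scalarGlH r) (conjGlH r) conjGlH_scalar) (by
    refine MonoidHom.ext fun u => LinearMap.ext fun x => ?_
    obtain ⟨A, rfl⟩ := LieSubmodule.Quotient.surjective_mk' _ x
    change LieSubmodule.Quotient.mk' (scalarGlH r)
      (conjGlH r (Matrix.GeneralLinearGroup.scalar (Fin r) u) A) = _
    have h1 : ((Matrix.GeneralLinearGroup.scalar (Fin r) u : GL (Fin r) (PowerSeries ℂ)) : GlH r) =
      Matrix.scalar (Fin r) (u : PowerSeries ℂ) := rfl
    rw [conjGlH_apply, h1, (Matrix.scalar_commute (u : PowerSeries ℂ) (fun d => mul_comm _ d) A).eq,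
      mul_assoc, ← h1, Units.mul_inv, mul_one]
    rfl)

theorem conjPglH_lie (g : PGL(r, PowerSeries ℂ)) (x y : PglH r) :
    conjPglH r g ⁅x, y⁆ = ⁅conjPglH r g x, conjPglH r g y⁆ := by
  induction g using Matrix.ProjGenLinGroup.induction_on with
  | mk g => exact quotRep_lie (scalarGlH r) (conjGlH r) conjGlH_scalar conjGlH_lie g x y

end Actions

/-- A pro-algebraic group over `ℂ`, presented by its functor of points: a group of `R`-points for
every commutative `ℂ`-algebra `R`, and for every homomorphism `ρ : R → S` of such algebras the
relation `bc ρ g g'` that the `S`-point `g'` is the base change of the `R`-point `g`. -/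
structure ProGroup where
  /-- The group of `R`-points. -/
  pts : (R : Type) → [CommRing R] → [Algebra ℂ R] → Type
  [group : ∀ (R : Type) [CommRing R] [Algebra ℂ R], Group (pts R)]
  /-- Base change along a homomorphism of `ℂ`-algebras. -/
  bc : ∀ {R S : Type} [CommRing R] [CommRing S] [Algebra ℂ R] [Algebra ℂ S],
    (R →ₐ[ℂ] S) → pts R → pts S → Prop

namespace ProGroup

attribute [instance] ProGroup.group

/-- The product of two groups. -/
abbrev prod (G H : ProGroup) : ProGroup where
  pts R _ _ := G.pts R × H.pts R
  bc ρ g g' := G.bc ρ g.1 g'.1 ∧ H.bc ρ g.2 g'.2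

/-- An isomorphism of pro-algebraic groups: a family of isomorphisms of groups of `R`-points that
commutes with base change. -/
structure Iso (G H : ProGroup) where
  /-- The isomorphism on `R`-points. -/
  equiv : ∀ (R : Type) [CommRing R] [Algebra ℂ R], G.pts R ≃* H.pts R
  bc_iff : ∀ {R S : Type} [CommRing R] [CommRing S] [Algebra ℂ R] [Algebra ℂ S] (ρ : R →ₐ[ℂ] S)
    (g : G.pts R) (g' : G.pts S), G.bc ρ g g' ↔ H.bc ρ (equiv R g) (equiv S g')

end ProGroup

/-- The data of a Harish-Chandra pair `⟨G, 𝔥⟩`: a pro-algebraic group `G`, a Lie algebra `𝔥`, an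
action of `G` on `𝔥` by Lie algebra automorphisms, and the embedding `Lie(G) ⊆ 𝔥`. The Lie algebra
of `G` consists of the tangent vectors `g = 1 + ε X ∈ G(ℂ[ε])` at the identity, and
`tangent g X` says that `g` is such a tangent vector and that `X` is its image in `𝔥`. -/
structure HCPair where
  /-- The group `G`. -/
  grp : ProGroup
  /-- The Lie algebra `𝔥`. -/
  lie : Type
  [lieRing : LieRing lie]
  [lieAlgebra : LieAlgebra ℂ lie]
  /-- The action of `G` on `𝔥`. -/
  act : Representation ℂ (grp.pts ℂ) lie
  act_lie : ∀ g x y, act g ⁅x, y⁆ = ⁅act g x, act g y⁆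
  /-- The embedding of the Lie algebra of `G` into `𝔥`. -/
  tangent : grp.pts (DualNumber ℂ) → lie → Prop

namespace HCPair

attribute [instance] HCPair.lieRing HCPair.lieAlgebra

/-- The product of two Harish-Chandra pairs. -/
abbrev prod (P Q : HCPair) : HCPair where
  grp := P.grp.prod Q.grp
  lie := P.lie × Q.lie
  act :=
    { toFun := fun g => (P.act g.1).prodMap (Q.act g.2)
      map_one' := by
        refine LinearMap.ext fun x => ?_
        change (P.act 1 x.1, Q.act 1 x.2) = x
        rw [map_one, map_one]
        rfl
      map_mul' := fun g g' => by
        refine LinearMap.ext fun x => ?_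
        change (P.act (g.1 * g'.1) x.1, Q.act (g.2 * g'.2) x.2) = _
        rw [map_mul, map_mul]
        rfl }
  act_lie g x y := Prod.ext (P.act_lie g.1 x.1 y.1) (Q.act_lie g.2 x.2 y.2)
  tangent g x := P.tangent g.1 x.1 ∧ Q.tangent g.2 x.2

/-- An isomorphism of Harish-Chandra pairs: isomorphisms of the groups and of the Lie algebras that
are compatible with the actions and with the embeddings of the Lie algebras of the groups. -/
structure Iso (P Q : HCPair) where
  /-- The isomorphism of pro-algebraic groups. -/
  grp : P.grp.Iso Q.grp
  /-- The isomorphism of Lie algebras. -/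
  lie : P.lie ≃ₗ⁅ℂ⁆ Q.lie
  act_comm : ∀ (g : P.grp.pts ℂ) (x : P.lie), lie (P.act g x) = Q.act (grp.equiv ℂ g) (lie x)
  tangent_iff : ∀ (g : P.grp.pts (DualNumber ℂ)) (x : P.lie),
    P.tangent g x ↔ Q.tangent (grp.equiv (DualNumber ℂ) g) (lie x)

end HCPair

section Pairs

open scoped MatrixGroups

/-- The inclusion `ℂ → ℂ[ε]`. -/
abbrev dualIncl : ℂ →+* DualNumber ℂ := algebraMap ℂ (DualNumber ℂ)

/-- The constant power series `ε`. -/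
abbrev epsC : PowerSeries (DualNumber ℂ) := PowerSeries.C DualNumber.eps

/-- The pro-algebraic group `Aut(𝒟, ℳ_r)`. -/
abbrev autGroup (n r : ℕ) : ProGroup where
  pts R _ _ := PairAut n r R
  bc ρ g g' := PairAut.BaseChange (ρ : _ →+* _) g g'

/-- The pro-algebraic group `Aut(𝒟, ℳ_r) / ℂ^*`. -/
abbrev autModScalars (n r : ℕ) : ProGroup where
  pts R _ _ := PairAut n r R ⧸ scalarAut n r R
  bc {R S} _ _ _ _ ρ g g' := ∃ (p : PairAut n r R) (p' : PairAut n r S),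
    QuotientGroup.mk p = g ∧ QuotientGroup.mk p' = g' ∧ PairAut.BaseChange (ρ : R →+* S) p p'

/-- The pro-algebraic group `PGL_h(r)`. -/
abbrev pglGroup (r : ℕ) : ProGroup where
  pts R _ _ := PGL(r, PowerSeries R)
  bc ρ g g' := g' = Matrix.ProjGenLinGroup.map (PowerSeries.map (ρ : _ →+* _)) g

/-- The pro-algebraic group `GL(r) ⋉ exp(h 𝔭𝔤𝔩_h(r))`. -/
abbrev semiGroup (r : ℕ) : ProGroup where
  pts R _ _ := SemiGL r R
  bc {R S} _ _ _ _ ρ g g' := g'.right = Matrix.GeneralLinearGroup.map (ρ : R →+* S) g.right ∧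
    (g'.left : PGL(r, PowerSeries S)) =
      Matrix.ProjGenLinGroup.map (PowerSeries.map (ρ : R →+* S)) (g.left : PGL(r, PowerSeries R))

/-- The `ℂ[ε]`-point `p` of `Aut(𝒟, ℳ_r)` equals `1 + ε X`, for `X ∈ Der(𝒟, ℳ_r)`. -/
def IsTangentDer {n r : ℕ} (p : PairAut n r (DualNumber ℂ)) (X : PairDer n r) : Prop :=
  (∀ a, p.alg (Weyl.map dualIncl a) =
    Weyl.map dualIncl a + epsC • Weyl.map dualIncl (X.alg a)) ∧
  ∀ m, p.mod (FormalModule.map dualIncl m) =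
    FormalModule.map dualIncl m + epsC • FormalModule.map dualIncl (X.mod m)

/-- The `ℂ[ε]`-point `p` of `Aut(𝒟, ℳ_1)` equals `1 + ε α`, for `α = (1/h) a ∈ (1/h) 𝒥` acting
by `(1/h) [a, ·]` on `𝒟` and by `(1/h) a` on `ℳ_1`. -/
def IsTangentJ {n : ℕ} (p : PairAut n 1 (DualNumber ℂ)) (α : hInvJ n) : Prop :=
  (∀ b, Weyl.h * (p.alg (Weyl.map dualIncl b) - Weyl.map dualIncl b) =
    epsC • Weyl.map dualIncl (HInv.num α.1 * b - b * HInv.num α.1)) ∧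
  ∀ m, (PowerSeries.X : PowerSeries (DualNumber ℂ)) •
      (p.mod (FormalModule.map dualIncl m) - FormalModule.map dualIncl m) =
    epsC • FormalModule.map dualIncl (HInv.num α.1 • m)

/-- The `ℂ[ε]`-point `g` of `GL_h(r)` equals `1 + ε A`, for `A ∈ 𝔤𝔩_h(r)`. -/
def IsTangentGl {r : ℕ} (g : GL (Fin r) (PowerSeries (DualNumber ℂ))) (A : GlH r) : Prop :=
  (g : Matrix (Fin r) (Fin r) (PowerSeries (DualNumber ℂ))) =
    1 + epsC • A.map (PowerSeries.map dualIncl)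

/-- The quotient of `⟨Aut(𝒟, ℳ_r), Der(𝒟, ℳ_r)⟩` by `⟨ℂ^*, ℂ⟩`. -/
abbrev autPairModScalars (n r : ℕ) : HCPair where
  grp := autModScalars n r
  lie := PairDer n r ⧸ scalarDer n r
  act := QuotientGroup.lift (scalarAut n r ℂ)
    (quotRep (scalarDer n r) (conjDer n r) conjDer_scalarDer) (fun p hp => by
      refine LinearMap.ext fun x => ?_
      obtain ⟨X, rfl⟩ := LieSubmodule.Quotient.surjective_mk' _ x
      rw [quotRep_mk, conjDer_of_mem p hp]
      rfl)
  act_lie g x y := by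
    induction g using QuotientGroup.induction_on with
    | H p => exact quotRep_lie (scalarDer n r) (conjDer n r) conjDer_scalarDer conjDer_lie p x y
  tangent g x := ∃ p X, QuotientGroup.mk p = g ∧ LieSubmodule.Quotient.mk' (scalarDer n r) X = x ∧
    IsTangentDer p X

/-- The Harish-Chandra pair `⟨Aut(𝒟, ℳ_1) / ℂ^*, (1/h) 𝒥 / ℂ⟩`. -/
abbrev jPair (n : ℕ) : HCPair where
  grp := autModScalars n 1
  lie := hInvJ n ⧸ constJ n
  act := QuotientGroup.lift (scalarAut n 1 ℂ)
    (quotRep (constJ n) (actJ n) actJ_constJ) (fun p hp => by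
      refine LinearMap.ext fun x => ?_
      obtain ⟨X, rfl⟩ := LieSubmodule.Quotient.surjective_mk' _ x
      rw [quotRep_mk, actJ_of_mem p hp]
      rfl)
  act_lie g x y := by
    induction g using QuotientGroup.induction_on with
    | H p => exact quotRep_lie (constJ n) (actJ n) actJ_constJ actJ_lie p x y
  tangent g x := ∃ p α, QuotientGroup.mk p = g ∧ LieSubmodule.Quotient.mk' (constJ n) α = x ∧
    IsTangentJ p α

/-- The Harish-Chandra pair `⟨PGL_h(r), 𝔭𝔤𝔩_h(r)⟩`. -/
abbrev pglPair (r : ℕ) : HCPair where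
  grp := pglGroup r
  lie := PglH r
  act := conjPglH r
  act_lie := conjPglH_lie
  tangent g x := ∃ k A, Matrix.ProjGenLinGroup.mk k = g ∧
    LieSubmodule.Quotient.mk' (scalarGlH r) A = x ∧ IsTangentGl k A

end Pairs

section Subgroups

variable {n r : ℕ} {R : Type} [CommRing R]

/-- `p` is the image `(Φ, Ψ ⊕ ⋯ ⊕ Ψ)` of `q = (Φ, Ψ)` under the map
`Aut(𝒟, ℳ_1) → Aut(𝒟, ℳ_r)` given by `ℳ_r = ℳ_1 ⊕ ⋯ ⊕ ℳ_1`. -/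
def PairAut.IsDiag (p : PairAut n r R) (q : PairAut n 1 R) : Prop :=
  p.alg = q.alg ∧ ∀ m i, p.mod m i = q.mod (fun _ => m i) 0

/-- `p` is the image of `g ∈ GL_h(r)` in `Aut(𝒟, ℳ_r)`: the identity on `𝒟` and
multiplication by the matrix `g` on `ℳ_r`. -/
def PairAut.IsMatrix (p : PairAut n r R) (g : GL (Fin r) (PowerSeries R)) : Prop :=
  p.alg = 1 ∧ ∀ m i, p.mod m i = ∑ j, g i j • m j

/-- `X` is the image of `α = (1/h) a ∈ (1/h) 𝒥` in `Der(𝒟, ℳ_r)`, that is, the pair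
`((1/h) [a, ·], (1/h) a)`. -/
def PairDer.IsInner (X : PairDer n r) (α : hInvJ n) : Prop :=
  (∀ b, Weyl.h * X.alg b = HInv.num α.1 * b - b * HInv.num α.1) ∧
    ∀ m, (PowerSeries.X : PowerSeries ℂ) • X.mod m = HInv.num α.1 • m

/-- `X` is the image of `A ∈ 𝔤𝔩_h(r)` in `Der(𝒟, ℳ_r)`: zero on `𝒟` and multiplication by the
matrix `A` on `ℳ_r`. -/
def PairDer.IsMatrix (X : PairDer n r) (A : GlH r) : Prop :=
  (∀ a, X.alg a = 0) ∧ ∀ m i, X.mod m i = ∑ j, A i j • m j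

end Subgroups

end FormalQuant

end

open FormalQuant

noncomputable section

namespace FormalQuant

/-! ### Roots of power series in h -/

section Roots

variable {R : Type} [CommRing R] [Algebra ℂ R]

/-! Everything rests on the module being generated by vacuum vectors: ℳ_1 is 𝒟 modulo the left ideal
generated by the y_j, and over a ℂ-algebra R the vectors killed by all y_j are exactly the
R⟦h⟧-multiples of 1. Hence the 𝒟-linear endomorphisms of ℳ_r are the matrices over R⟦h⟧
(`exists_matAct`), and the automorphisms (Φ, Ψ) with Φ = 1 are GL_h(r) (`exists_matAut`).

Group side. The Φ of any pair (Φ, Ψ) on ℳ_r already lifts to ℳ_1 (`exists_diag`): a suitable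
coordinate of Ψ gives a vector w with constant term 1 killed by all Φ(y_j), and a·1 ↦ Φ(a)w is the
required semilinear map. Dividing by the diagonal lift leaves a matrix, so every element is
diag(q)·g, and the two factors commute. The only ambiguity is a scalar from R⟦h⟧ˣ, which lies in
both subgroups. It is cut down to Rˣ by requiring det g to be constant in h: r-th roots of series
with constant term 1 exist and are unique. So `exists_factorization` and `factorization_unique` give
a homomorphism `splitAut` onto Aut(𝒟, ℳ_1)/ℂ^* × PGL_h(r) with kernel exactly the constant scalars.
To recover these scalars one adds the action `evGL` on ℳ_r/𝔪ℳ_r = R^r. Its class in PGL(r) is the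
value at h = 0 of the PGL_h(r)-component, and GL(r) ⋉ exp(h 𝔭𝔤𝔩_h(r)) is the fibre product of
PGL_h(r) and GL(r) over PGL(r); this yields `fullSplit_bijective`.

Lie algebra side. Commutators with the generators are h times partial derivatives, so the
commutation relations say that the values of a derivation on generators form a closed one-form. The
formal Poincaré lemma makes every derivation (1/h)[a, ·] (`exists_innerDer`). What remains of ψ is
again a matrix, after a is shifted by a scalar to lie in 𝒥. The overlap ℂ⟦h⟧ of (1/h)𝒥 and 𝔤𝔩_h(r)
is removed by taking traceless matrices.

Comparison. Since det(1 + εA) = 1 + ε tr A, traceless matrices exponentiate to first order inside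
the matrices of constant determinant (`hasConstDet_dualGL`). A tangent vector 1 + ε(α + A) thus
factors as diag(1 + εα)·(1 + εA), a factorization of the kind used on the group side
(`IsTangentDer.exists_factorization`). Compatibility with the adjoint action follows from the
commutation of the two factors, and compatibility with base change from the fact that the base
change of diag(q)·g factors in the same way (`exists_baseChange_diagAut`). -/

theorem isUnit_natCast_of_pos {r : ℕ} (hr : 1 ≤ r) : IsUnit (r : R) := by
  have h : IsUnit (r : ℂ) := (Nat.cast_ne_zero.2 (by omega)).isUnit
  simpa using h.map (algebraMap ℂ R)

/-- A power series with constant coefficient `1` has an `r`-th root of the same kind. -/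
theorem exists_pow_eq {r : ℕ} (hr : 1 ≤ r) (u : PowerSeries R)
    (hu : PowerSeries.constantCoeff u = 1) :
    ∃ c : PowerSeries R, PowerSeries.constantCoeff c = 1 ∧ c ^ r = u := by
  have hs : PowerSeries.HasSubst (u - 1) :=
    PowerSeries.HasSubst.of_constantCoeff_zero' (by simp [hu])
  -- The root is (1 + X)^(1/r) over ℂ with u - 1 substituted for X, which is legitimate because u -
  -- 1 has no constant term.
  set b : PowerSeries ℂ := PowerSeries.binomialSeries ℂ ((r : ℂ)⁻¹) with hb
  have hpow : ∀ k : ℕ, b ^ k = PowerSeries.binomialSeries ℂ ((k : ℂ) * (r : ℂ)⁻¹) := by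
    intro k
    induction k with
    | zero => simp
    | succ k ih => rw [pow_succ, ih, hb, ← PowerSeries.binomialSeries_add]; congr 1; push_cast; ring
  have hbr : b ^ r = 1 + PowerSeries.X := by
    rw [hpow, mul_inv_cancel₀ (Nat.cast_ne_zero.2 (by omega))]
    simpa using PowerSeries.binomialSeries_nat (R := ℂ) (A := ℂ) 1
  refine ⟨PowerSeries.substAlgHom hs b, ?_, ?_⟩
  · have h1 : b = 1 + (b - 1) := by ring
    rw [h1, map_add, map_add, map_one, map_one, PowerSeries.coe_substAlgHom]
    have := PowerSeries.constantCoeff_subst_eq_zero (S := R) (a := u - 1)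
      (by change PowerSeries.constantCoeff (u - 1) = 0; simp [hu]) (b - 1) (by simp [hb])
    exact (congrArg (1 + ·) this).trans (add_zero 1)
  · rw [← map_pow, hbr, map_add, map_one, PowerSeries.substAlgHom_X]
    ring

/-- In c^r - d^r = (c - d)·∑ c^i d^(r-1-i) the second factor has constant term r, a unit because R
is a ℂ-algebra. -/
theorem pow_left_injective_of_constantCoeff {r : ℕ} (hr : 1 ≤ r) {c d : PowerSeries R}
    (hc : PowerSeries.constantCoeff c = 1) (hd : PowerSeries.constantCoeff d = 1)
    (h : c ^ r = d ^ r) : c = d := by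
  have h1 := (Commute.all c d).mul_geom_sum₂ r
  rw [h, sub_self] at h1
  have hu : IsUnit (∑ i ∈ Finset.range r, c ^ i * d ^ (r - 1 - i)) := by
    rw [PowerSeries.isUnit_iff_constantCoeff]
    simpa [map_sum, hc, hd] using isUnit_natCast_of_pos (R := R) hr
  exact sub_eq_zero.1 ((hu.mul_left_eq_zero).1 h1)

/-- A unit of `R⟦h⟧` whose `r`-th power is constant is constant. -/
theorem eq_C_of_pow_eq_C {r : ℕ} (hr : 1 ≤ r) (c : (PowerSeries R)ˣ) (d : R)
    (h : (c : PowerSeries R) ^ r = PowerSeries.C d) :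
    c = Units.map (PowerSeries.C (R := R)).toMonoidHom
      (Units.map (PowerSeries.constantCoeff (R := R)).toMonoidHom c) := by
  set c₀ : Rˣ := Units.map (PowerSeries.constantCoeff (R := R)).toMonoidHom c with hc₀
  have h0 : PowerSeries.constantCoeff (c : PowerSeries R) = c₀ := rfl
  have hd : (c₀ : R) ^ r = d := by
    have := congrArg PowerSeries.constantCoeff h
    rwa [map_pow, h0, PowerSeries.constantCoeff_C] at this
  -- Dividing c by its constant term c₀ gives an r-th root of 1 with constant term 1, and the only
  -- such root is 1.
  have key : (c : PowerSeries R) * PowerSeries.C ((c₀⁻¹ : Rˣ) : R) = 1 := by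
    refine pow_left_injective_of_constantCoeff hr ?_ (map_one _) ?_
    · rw [map_mul, h0, PowerSeries.constantCoeff_C, Units.mul_inv]
    · rw [mul_pow, h, one_pow, ← hd, ← map_pow, ← map_mul, ← mul_pow, Units.mul_inv, one_pow,
        map_one]
  apply Units.ext
  change (c : PowerSeries R) = PowerSeries.C (c₀ : R)
  have h2 : PowerSeries.C ((c₀⁻¹ : Rˣ) : R) * PowerSeries.C (c₀ : R) = 1 := by
    rw [← map_mul, Units.inv_mul, map_one]
  calc (c : PowerSeries R) = c * (PowerSeries.C ((c₀⁻¹ : Rˣ) : R) * PowerSeries.C (c₀ : R)) := by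
        rw [h2, mul_one]
    _ = PowerSeries.C (c₀ : R) := by rw [← mul_assoc, key, one_mul]

end Roots

/-! ### The augmentations of 𝒟 and ℳ_1, and the ideal 𝔪 -/

section Augmentation

variable {n r : ℕ} {R : Type} [CommRing R]

/-- The value at `x = h = 0` of an element of `R⟦x, h⟧`. -/
def vacAug (n : ℕ) (R : Type) [CommRing R] : Vac n R →+* R :=
  (MvPowerSeries.constantCoeff (σ := Fin n) (R := R)).comp PowerSeries.constantCoeff

/-- The constant term of an element of the Weyl algebra. -/
def weylAug (n : ℕ) (R : Type) [CommRing R] : Weyl n R →+* R where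
  toFun a := MvPowerSeries.constantCoeff (PowerSeries.coeff 0 (Weyl.symbol a))
  map_one' := by rw [Weyl.symbol_one]; simp
  map_mul' a b := by rw [Weyl.coeff_zero_mul, map_mul]
  map_zero' := by simp
  map_add' a b := by simp

theorem weylAug_apply (a : Weyl n R) :
    weylAug n R a = MvPowerSeries.constantCoeff (PowerSeries.coeff 0 (Weyl.symbol a)) := rfl

/-- Setting y = 0 in normally ordered symbols identifies ℳ_1 with a quotient of 𝒟 and matches the
two constant terms, so this is multiplicativity of `weylAug`. It makes ℳ_r/𝔪ℳ_r accessible through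
constant terms. -/
theorem vacAug_smul (a : Weyl n R) (m : Vac n R) :
    vacAug n R (a • m) = weylAug n R a * vacAug n R m := by
  obtain ⟨w, rfl⟩ := coeffY_zero_surjective m
  have h (w : PowerSeries (SymbolRing n R)) :
      vacAug n R (coeffY 0 w) = weylAug n R (Weyl.ofSymbol w) := by
    change MvPowerSeries.constantCoeff (PowerSeries.constantCoeff (coeffY 0 w)) =
      MvPowerSeries.constantCoeff (PowerSeries.coeff 0 w)
    rw [← PowerSeries.coeff_zero_eq_constantCoeff_apply,
      ← MvPowerSeries.coeff_zero_eq_constantCoeff_apply, coeff_coeffY, Finsupp.sumElim_zero_zero,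
      MvPowerSeries.coeff_zero_eq_constantCoeff_apply]
  rw [smul_def', ← coeffY_zero_star, h, h, ← map_mul]
  rfl

theorem weylAug_x (i : Fin n) : weylAug n R (Weyl.x i) = 0 := by
  change MvPowerSeries.constantCoeff (PowerSeries.coeff 0 (PowerSeries.C _)) = _
  simp

theorem weylAug_y (i : Fin n) : weylAug n R (Weyl.y i) = 0 := by
  change MvPowerSeries.constantCoeff (PowerSeries.coeff 0 (PowerSeries.C _)) = _
  simp

theorem weylAug_h : weylAug n R Weyl.h = 0 := by
  change MvPowerSeries.constantCoeff (PowerSeries.coeff 0 PowerSeries.X) = _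
  simp

theorem weylAug_algebraMap (c : PowerSeries R) :
    weylAug n R (algebraMap _ _ c) = PowerSeries.constantCoeff c := by
  rw [Algebra.algebraMap_eq_smul_one, weylAug_apply]
  have h1 : Weyl.symbol (c • (1 : Weyl n R)) =
    PowerSeries.map (algebraMap R (SymbolRing n R)) c * 1 := rfl
  rw [h1, mul_one, PowerSeries.coeff_map]
  change MvPowerSeries.constantCoeff (MvPowerSeries.C _) = _
  simp

theorem vacAug_series_smul (c : PowerSeries R) (m : Vac n R) :
    vacAug n R (c • m) = PowerSeries.constantCoeff c * vacAug n R m := by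
  rw [← algebraMap_smul (Weyl n R) c m, vacAug_smul, weylAug_algebraMap]

/-- Every element of the Weyl algebra is a combination of its constant term and the generators. -/
theorem Weyl.exists_decomp (a : Weyl n R) :
    ∃ (p q : Fin n → Weyl n R) (b : Weyl n R),
      a = algebraMap (PowerSeries R) _ (PowerSeries.C (weylAug n R a)) + ∑ j, p j * Weyl.x j +
        ∑ j, q j * Weyl.y j + Weyl.h * b := by
  classical
  set c := algebraMap (PowerSeries R) (Weyl n R) (PowerSeries.C (weylAug n R a)) with hc
  have hc' : weylAug n R c = weylAug n R a := by
    rw [hc, weylAug_algebraMap, PowerSeries.constantCoeff_C]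
  obtain ⟨q, hq⟩ := exists_sum_X Finset.univ (PowerSeries.coeff 0 (Weyl.symbol (a - c)))
    fun e he => by
      have : e = 0 := Finsupp.ext fun i => he i (Finset.mem_univ i)
      subst this
      have : weylAug n R (a - c) = 0 := by rw [map_sub, hc', sub_self]
      exact this
  let Q : Fin n ⊕ Fin n → Weyl n R := fun i => Weyl.ofSymbol (PowerSeries.C (q i))
  set b : Weyl n R := ∑ j, Q (Sum.inl j) * Weyl.x j + ∑ j, Q (Sum.inr j) * Weyl.y j with hb
  -- Modulo h the product is commutative, so the combination b of generators matches a - c there;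
  -- the remainder is then divisible by h.
  refine ⟨fun j => Q (Sum.inl j), fun j => Q (Sum.inr j), Weyl.divH (a - c - b), ?_⟩
  have hsymb : PowerSeries.coeff 0 (Weyl.symbol b) = PowerSeries.coeff 0 (Weyl.symbol (a - c)) := by
    rw [hq, Fintype.sum_sum_type, hb]
    simp only [map_add, map_sum]
    congr 1 <;> refine Finset.sum_congr rfl fun j _ => ?_
    · rw [Weyl.coeff_zero_mul]
      change PowerSeries.coeff 0 (PowerSeries.C _) * PowerSeries.coeff 0 (PowerSeries.C _) = _
      simp
    · rw [Weyl.coeff_zero_mul]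
      change PowerSeries.coeff 0 (PowerSeries.C _) * PowerSeries.coeff 0 (PowerSeries.C _) = _
      simp
  rw [Weyl.h_mul_divH _ (by rw [map_sub, map_sub, hsymb, sub_self]), add_assoc c, ← hb]
  abel

/-- One inclusion holds because the generators have no constant term, the other is the decomposition
`Weyl.exists_decomp`. The condition on Φ thereby becomes preservation of constant terms. -/
theorem mem_maxIdeal_iff (a : Weyl n R) : a ∈ maxIdeal n R ↔ weylAug n R a = 0 := by
  constructor
  · intro ha
    have hle : maxIdeal n R ≤ TwoSidedIdeal.ker (weylAug n R) := by
      refine TwoSidedIdeal.span_le.2 ?_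
      rintro a ((⟨j, rfl⟩ | ⟨j, rfl⟩) | rfl)
      · exact (TwoSidedIdeal.mem_ker _).2 (weylAug_x j)
      · exact (TwoSidedIdeal.mem_ker _).2 (weylAug_y j)
      · exact (TwoSidedIdeal.mem_ker _).2 weylAug_h
    exact (TwoSidedIdeal.mem_ker _).1 (hle ha)
  · intro ha
    obtain ⟨p, q, b, hab⟩ := Weyl.exists_decomp a
    rw [hab, ha, map_zero, map_zero, zero_add]
    have hx : ∀ j, (Weyl.x j : Weyl n R) ∈ maxIdeal n R := fun j =>
      TwoSidedIdeal.subset_span (Or.inl (Or.inl ⟨j, rfl⟩))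
    have hy : ∀ j, (Weyl.y j : Weyl n R) ∈ maxIdeal n R := fun j =>
      TwoSidedIdeal.subset_span (Or.inl (Or.inr ⟨j, rfl⟩))
    have hh : (Weyl.h : Weyl n R) ∈ maxIdeal n R := TwoSidedIdeal.subset_span (Or.inr rfl)
    exact TwoSidedIdeal.add_mem _ (TwoSidedIdeal.add_mem _
      (sum_mem fun j _ => TwoSidedIdeal.mul_mem_left _ _ _ (hx j))
      (sum_mem fun j _ => TwoSidedIdeal.mul_mem_left _ _ _ (hy j)))
      (TwoSidedIdeal.mul_mem_right _ _ _ hh)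

/-- An element differs from its constant term by an element of 𝔪, and Φ fixes constants and
preserves 𝔪. -/
theorem PairAut.weylAug_alg (p : PairAut n r R) (a : Weyl n R) :
    weylAug n R (p.alg a) = weylAug n R a := by
  set c := algebraMap (PowerSeries R) (Weyl n R) (PowerSeries.C (weylAug n R a)) with hc
  have hc' : weylAug n R c = weylAug n R a := by
    rw [hc, weylAug_algebraMap, PowerSeries.constantCoeff_C]
  have h1 : p.alg (a - c) ∈ maxIdeal n R := (p.2.1 _).2 ((mem_maxIdeal_iff _).2 (by
    rw [map_sub, hc', sub_self]))
  have h2 : p.alg c = c := p.alg.commutes _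
  rw [mem_maxIdeal_iff, map_sub, h2, map_sub, hc'] at h1
  exact sub_eq_zero.1 h1

end Augmentation

/-! ### ℳ_1 as a cyclic module on the vacuum vector -/

section Presentation

variable {n r : ℕ} {R : Type} [CommRing R]

/-- A function of `x` and `h` as an element of the Weyl algebra. -/
def Weyl.ofVac (m : Vac n R) : Weyl n R := Weyl.ofSymbol (ofFun m)

theorem Weyl.ofVac_smul_one (m : Vac n R) : Weyl.ofVac m • (1 : Vac n R) = m := by
  rw [symbol_smul_one]
  exact coeffY_ofFun m

theorem symbol_mul_y (a : Weyl n R) (j : Fin n) :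
    Weyl.symbol (a * Weyl.y j) = Weyl.symbol a * PowerSeries.C (MvPowerSeries.X (Sum.inr j)) := by
  classical
  refine star_of_right _ _ fun N e k he => ?_
  change MvPowerSeries.coeff e (PowerSeries.coeff N (PowerSeries.C (MvPowerSeries.X _))) = 0
  rw [PowerSeries.coeff_C]
  split_ifs
  · rw [MvPowerSeries.coeff_X, if_neg]
    rintro rfl
    simp at he
  · simp

theorem y_smul_one (j : Fin n) : (Weyl.y j : Weyl n R) • (1 : Vac n R) = 0 := by
  classical
  rw [symbol_smul_one]
  ext N e
  rw [coeff_coeffY]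
  change MvPowerSeries.coeff _ (PowerSeries.coeff N (PowerSeries.C (MvPowerSeries.X _))) = _
  rw [PowerSeries.coeff_C, map_zero, map_zero]
  split_ifs
  · rw [MvPowerSeries.coeff_X, if_neg]
    intro h
    simpa using DFunLike.congr_fun h (Sum.inr j)
  · simp

/-- The annihilator of the vacuum vector is the left ideal generated by the `y_j`. -/
theorem exists_sum_y (a : Weyl n R) (ha : a • (1 : Vac n R) = 0) :
    ∃ q : Fin n → Weyl n R, a = ∑ j, q j * Weyl.y j := by
  classical
  rw [symbol_smul_one] at ha
  -- Right multiplication by y_j is the commutative product on symbols and does not involve h, so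
  -- the division by the y_j can be done separately in each power of h and reassembled.
  have h (N : ℕ) := exists_sum_X (Finset.univ.map ⟨(Sum.inr : Fin n → Fin n ⊕ Fin n),
      Sum.inr_injective⟩) (PowerSeries.coeff N (Weyl.symbol a)) fun e he => by
    have h1 := congrArg (MvPowerSeries.coeff (e.comapDomain Sum.inl Sum.inl_injective.injOn))
      (congrArg (PowerSeries.coeff N) ha)
    rw [coeff_coeffY, map_zero, map_zero] at h1
    have he' : (e.comapDomain Sum.inl Sum.inl_injective.injOn).sumElim 0 = e := by
      ext i
      rcases i with i | i
      · simp
      · simpa using (he (Sum.inr i) (by simp)).symm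
    rwa [he'] at h1
  choose q hq using h
  refine ⟨fun j => Weyl.ofSymbol (PowerSeries.mk fun N => q N (Sum.inr j)), ?_⟩
  apply Weyl.symbol.injective
  ext N : 1
  rw [hq, map_sum, map_sum, Finset.sum_map]
  refine Finset.sum_congr rfl fun j _ => ?_
  rw [symbol_mul_y, PowerSeries.coeff_mul_C]
  congr 1
  exact (PowerSeries.coeff_mk N fun N => q N (Sum.inr j)).symm

/-- The vacuum module is the universal module with a vector killed by the `y_j`. -/
theorem smul_eq_of_smul_one_eq {M : Type} [AddCommGroup M] [Module (Weyl n R) M]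
    (Φ : Weyl n R →+* Weyl n R) (v : M) (hv : ∀ j, Φ (Weyl.y j) • v = 0) {a b : Weyl n R}
    (hab : a • (1 : Vac n R) = b • (1 : Vac n R)) : Φ a • v = Φ b • v := by
  obtain ⟨q, hq⟩ := exists_sum_y (a - b) (by rw [sub_smul, hab, sub_self])
  have : Φ (a - b) • v = 0 := by
    rw [hq, map_sum, Finset.sum_smul]
    exact Finset.sum_eq_zero fun j _ => by rw [map_mul, mul_smul, hv, smul_zero]
  rwa [map_sub, sub_smul, sub_eq_zero] at this

/-- The `Φ`-semilinear map `ℳ_1 → ℳ_1` sending the vacuum vector to `w`. -/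
def twistMap (Φ : Weyl n R ≃ₐ[PowerSeries R] Weyl n R) (w : Vac n R)
    (hw : ∀ j, Φ (Weyl.y j) • w = 0) : Vac n R →ₗ[PowerSeries R] Vac n R where
  toFun m := Φ (Weyl.ofVac m) • w
  map_add' m m' := by
    rw [← add_smul, ← map_add]
    refine smul_eq_of_smul_one_eq (Φ : Weyl n R →+* Weyl n R) w hw ?_
    simp only [add_smul, Weyl.ofVac_smul_one]
  map_smul' c m := by
    rw [RingHom.id_apply, ← smul_assoc, ← map_smul]
    refine smul_eq_of_smul_one_eq (Φ : Weyl n R →+* Weyl n R) w hw ?_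
    simp only [smul_assoc, Weyl.ofVac_smul_one]

theorem twistMap_smul (Φ : Weyl n R ≃ₐ[PowerSeries R] Weyl n R) (w : Vac n R)
    (hw : ∀ j, Φ (Weyl.y j) • w = 0) (a : Weyl n R) (m : Vac n R) :
    twistMap Φ w hw (a • m) = Φ a • twistMap Φ w hw m := by
  change Φ _ • w = Φ a • Φ _ • w
  rw [← mul_smul, ← map_mul]
  refine smul_eq_of_smul_one_eq (Φ : Weyl n R →+* Weyl n R) w hw ?_
  simp only [mul_smul, Weyl.ofVac_smul_one]

theorem coeffY_y (κ : Fin n →₀ ℕ) (j : Fin n) :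
    coeffY κ (PowerSeries.C (MvPowerSeries.X (Sum.inr j) : SymbolRing n R)) =
      if κ = Finsupp.single j 1 then 1 else 0 := by
  classical
  ext N e
  rw [coeff_coeffY, PowerSeries.coeff_C]
  have hs : e.sumElim κ = Finsupp.single (Sum.inr j) 1 ↔ e = 0 ∧ κ = Finsupp.single j 1 := by
    constructor
    · intro h
      constructor
      · ext i
        simpa using DFunLike.congr_fun h (Sum.inl i)
      · ext i
        simpa [Finsupp.single_apply] using DFunLike.congr_fun h (Sum.inr i)
    · rintro ⟨rfl, rfl⟩
      ext i
      rcases i with i | i <;> simp [Finsupp.single_apply]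
  by_cases hN : N = 0
  · subst hN
    rw [if_pos rfl, MvPowerSeries.coeff_X, if_congr hs rfl rfl]
    by_cases hκ : κ = Finsupp.single j 1
    · rw [if_pos hκ, PowerSeries.coeff_one, if_pos rfl, MvPowerSeries.coeff_one]
      simp [hκ]
    · simp [hκ]
  · rw [if_neg hN, map_zero]
    split_ifs
    · rw [PowerSeries.coeff_one, if_neg hN, map_zero]
    · simp

theorem y_smul (j : Fin n) (m : Vac n R) :
    (Weyl.y j : Weyl n R) • m = PowerSeries.X * dV (Finsupp.single j 1) m := by
  change opAct (PowerSeries.C (MvPowerSeries.X (Sum.inr j))) m = _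
  rw [opAct, hsum_of_one (Finsupp.single j 1)]
  · rw [coeffY_y, if_pos rfl, one_mul]
    have e1 : mfact (Finsupp.single j 1 : Fin n →₀ ℕ) = 1 :=
      Finset.prod_eq_one fun k _ => by
        rw [Finsupp.single_apply]
        split_ifs <;> rfl
    rw [e1, one_smul]
    simp [Finsupp.single_apply]
  · intro κ hκ
    rw [coeffY_y, if_neg hκ, zero_mul, smul_zero]

theorem coeff_hasse_single {σ : Type} [Fintype σ] [DecidableEq σ] (s : σ) (e : σ →₀ ℕ)
    (f : MvPowerSeries σ R) :
    MvPowerSeries.coeff e (hasse (Finsupp.single s 1) f) =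
      ((e s + 1 : ℕ) : R) * MvPowerSeries.coeff (e + Finsupp.single s 1) f := by
  rw [coeff_hasse]
  congr 2
  rw [Finset.prod_eq_single s]
  · simp
  · intro b _ hb
    simp [Finsupp.single_eq_of_ne hb]
  · simp

/-- A power series all of whose partial derivatives vanish is constant. -/
theorem coeff_eq_zero_of_hasse [Algebra ℂ R] {σ : Type} [Fintype σ] [DecidableEq σ]
    (f : MvPowerSeries σ R) (hf : ∀ s, hasse (Finsupp.single s 1) f = 0) (e : σ →₀ ℕ)
    (he : e ≠ 0) : MvPowerSeries.coeff e f = 0 := by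
  obtain ⟨s, hs⟩ := Finsupp.ne_iff.1 he
  rw [Finsupp.zero_apply] at hs
  have hse : e - Finsupp.single s 1 + Finsupp.single s 1 = e :=
    tsub_add_cancel_of_le (Finsupp.single_le_iff.2 (by omega))
  have h := congrArg (MvPowerSeries.coeff (e - Finsupp.single s 1)) (hf s)
  rw [coeff_hasse_single, hse, map_zero] at h
  -- The exponent of s in e is positive, hence invertible in R; this is where characteristic zero
  -- enters.
  exact ((isUnit_natCast_of_pos (R := R) (by omega)).mul_right_eq_zero).1 h

theorem series_smul_one_coeff (c : PowerSeries R) (N : ℕ) :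
    PowerSeries.coeff N (c • (1 : Vac n R)) = MvPowerSeries.C (PowerSeries.coeff N c) := by
  have h1 : c • (1 : Vac n R) = PowerSeries.map (algebraMap R (FunRing n R)) c * 1 := rfl
  rw [h1, mul_one, PowerSeries.coeff_map]
  rfl

/-- The vectors of `ℳ_1` killed by the `y_j` are the multiples of the vacuum vector. -/
theorem eq_smul_one_of_y_smul [Algebra ℂ R] (w : Vac n R) (hw : ∀ j, (Weyl.y j : Weyl n R) • w = 0) :
    ∃ c : PowerSeries R, w = c • (1 : Vac n R) := by
  classical
  refine ⟨PowerSeries.mk fun N => MvPowerSeries.constantCoeff (PowerSeries.coeff N w), ?_⟩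
  have hd : ∀ j, dV (Finsupp.single j 1) w = 0 := fun j => by
    refine PowerSeries.X_mul_cancel ((y_smul j w).symm.trans ((hw j).trans (mul_zero _).symm))
  ext N e
  rw [series_smul_one_coeff, PowerSeries.coeff_mk, MvPowerSeries.coeff_C]
  split_ifs with he
  · rw [he]; rfl
  · refine coeff_eq_zero_of_hasse _ (fun s => ?_) e he
    have := congrArg (PowerSeries.coeff N) (hd s)
    rw [dV, coeff_coeffwise, map_zero] at this
    exact this

theorem series_smul_one_injective :
    Function.Injective fun c : PowerSeries R => c • (1 : Vac n R) := by
  intro c d h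
  ext N
  have := congrArg (PowerSeries.coeff N) h
  simp only [series_smul_one_coeff] at this
  have := congrArg (MvPowerSeries.constantCoeff) this
  simpa using this

end Presentation

/-! ### Matrices, diagonal automorphisms, and the action on ℳ_r/𝔪ℳ_r -/

section AutConstructions

variable {n r : ℕ} {R : Type} [CommRing R]

theorem PairAut.ext {p q : PairAut n r R} (h1 : p.alg = q.alg) (h2 : ∀ m, p.mod m = q.mod m) :
    p = q :=
  Subtype.ext (Prod.ext h1 (LinearEquiv.ext h2))

theorem PairAut.mod_smul (p : PairAut n r R) (a : Weyl n R) (m : FormalModule n r R) :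
    p.mod (a • m) = p.alg a • p.mod m := p.2.2 a m

theorem PairAut.alg_one : (1 : PairAut n r R).alg = 1 := rfl

theorem PairAut.alg_mul (p q : PairAut n r R) : (p * q).alg = p.alg * q.alg := rfl

theorem PairAut.alg_inv (p : PairAut n r R) : p⁻¹.alg = p.alg⁻¹ := rfl

theorem PairAut.mod_one (m : FormalModule n r R) : (1 : PairAut n r R).mod m = m := rfl

theorem PairAut.mod_mul (p q : PairAut n r R) (m : FormalModule n r R) :
    (p * q).mod m = p.mod (q.mod m) := rfl

/-- The element of `Aut(𝒟, ℳ_r)` with given components. -/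
def PairAut.of (Φ : Weyl n R ≃ₐ[PowerSeries R] Weyl n R)
    (Ψ : FormalModule n r R ≃ₗ[PowerSeries R] FormalModule n r R)
    (hΦ : ∀ a, weylAug n R (Φ a) = weylAug n R a)
    (hΨ : ∀ (a : Weyl n R) m, Ψ (a • m) = Φ a • Ψ m) : PairAut n r R :=
  ⟨(Φ, Ψ), fun a => by rw [mem_maxIdeal_iff, mem_maxIdeal_iff, hΦ], hΨ⟩

theorem PairAut.alg_of (Φ : Weyl n R ≃ₐ[PowerSeries R] Weyl n R)
    (Ψ : FormalModule n r R ≃ₗ[PowerSeries R] FormalModule n r R) (hΦ) (hΨ) :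
    (PairAut.of Φ Ψ hΦ hΨ).alg = Φ := rfl

theorem PairAut.mod_of (Φ : Weyl n R ≃ₐ[PowerSeries R] Weyl n R)
    (Ψ : FormalModule n r R ≃ₗ[PowerSeries R] FormalModule n r R) (hΦ) (hΨ) :
    (PairAut.of Φ Ψ hΦ hΨ).mod = Ψ := rfl

/-- The action of matrices over `R⟦h⟧` on `ℳ_r`. -/
def matAct (n r : ℕ) (R : Type) [CommRing R] : Matrix (Fin r) (Fin r) (PowerSeries R) →+*
    Module.End (PowerSeries R) (FormalModule n r R) where
  toFun A :=
    { toFun := fun m i => ∑ j, A i j • m j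
      map_add' := fun m m' => by
        funext i
        simp only [Pi.add_apply, smul_add, Finset.sum_add_distrib]
      map_smul' := fun c m => by
        funext i
        simp only [Pi.smul_apply, RingHom.id_apply, Finset.smul_sum]
        exact Finset.sum_congr rfl fun j _ => smul_comm _ _ _ }
  map_one' := by
    refine LinearMap.ext fun m => funext fun i => ?_
    change ∑ j, (1 : Matrix (Fin r) (Fin r) (PowerSeries R)) i j • m j = m i
    simp [Matrix.one_apply]
  map_mul' A B := by
    refine LinearMap.ext fun m => funext fun i => ?_
    change ∑ j, (A * B) i j • m j = ∑ j, A i j • ∑ k, B j k • m k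
    simp only [Matrix.mul_apply, Finset.sum_smul, Finset.smul_sum, mul_smul]
    exact Finset.sum_comm
  map_zero' := by
    refine LinearMap.ext fun m => funext fun i => ?_
    change ∑ j, (0 : Matrix (Fin r) (Fin r) (PowerSeries R)) i j • m j = 0
    simp
  map_add' A B := by
    refine LinearMap.ext fun m => funext fun i => ?_
    change ∑ j, (A + B) i j • m j = ∑ j, A i j • m j + ∑ j, B i j • m j
    simp only [Matrix.add_apply, add_smul, Finset.sum_add_distrib]

theorem matAct_apply (A : Matrix (Fin r) (Fin r) (PowerSeries R)) (m : FormalModule n r R)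
    (i : Fin r) : matAct n r R A m i = ∑ j, A i j • m j := rfl

theorem matAct_smul (A : Matrix (Fin r) (Fin r) (PowerSeries R)) (a : Weyl n R)
    (m : FormalModule n r R) : matAct n r R A (a • m) = a • matAct n r R A m := by
  funext i
  simp only [matAct_apply, Pi.smul_apply, Finset.smul_sum]
  exact Finset.sum_congr rfl fun j _ => (smul_comm _ _ _).symm

theorem matAct_scalar (c : PowerSeries R) (m : FormalModule n r R) :
    matAct n r R (Matrix.scalar (Fin r) c) m = c • m := by
  funext i
  simp [matAct_apply, Matrix.diagonal_apply, ite_smul]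

theorem matAct_single (A : Matrix (Fin r) (Fin r) (PowerSeries R)) (i j : Fin r) :
    matAct n r R A (Pi.single j 1) i = A i j • (1 : Vac n R) := by
  rw [matAct_apply, Finset.sum_eq_single j]
  · rw [Pi.single_eq_same]
  · intro k _ hk
    rw [Pi.single_eq_of_ne hk, smul_zero]
  · simp

theorem matAct_injective : Function.Injective (matAct n r R) := by
  intro A B h
  ext1 i j
  refine series_smul_one_injective (n := n) ?_
  change A i j • (1 : Vac n R) = B i j • (1 : Vac n R)
  rw [← matAct_single, ← matAct_single, h]

/-- The r vacuum vectors generate ℳ_r over 𝒟, so a semilinear map is determined by their images. -/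
theorem sum_ofVac_smul_single (m : FormalModule n r R) :
    m = ∑ j, Weyl.ofVac (m j) • (Pi.single j 1 : FormalModule n r R) := by
  funext i
  rw [Finset.sum_apply, Finset.sum_eq_single i]
  · rw [Pi.smul_apply, Pi.single_eq_same, Weyl.ofVac_smul_one]
  · intro k _ hk
    rw [Pi.smul_apply, Pi.single_eq_of_ne hk.symm, smul_zero]
  · simp

theorem y_smul_single (j : Fin n) (i : Fin r) :
    (Weyl.y j : Weyl n R) • (Pi.single i 1 : FormalModule n r R) = 0 := by
  funext k
  by_cases hk : k = i
  · subst hk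
    rw [Pi.smul_apply, Pi.single_eq_same, y_smul_one, Pi.zero_apply]
  · rw [Pi.smul_apply, Pi.single_eq_of_ne hk, smul_zero, Pi.zero_apply]

/-- The `𝒟`-linear endomorphisms of `ℳ_r` are the matrices over `R⟦h⟧`. -/
theorem exists_matAct [Algebra ℂ R] (f : Module.End (PowerSeries R) (FormalModule n r R))
    (hf : ∀ (a : Weyl n R) m, f (a • m) = a • f m) : ∃ A, f = matAct n r R A := by
  have h (i j : Fin r) : ∃ c : PowerSeries R, f (Pi.single j 1) i = c • (1 : Vac n R) := by
    -- A 𝒟-linear map sends vacuum vectors to vectors whose coordinates are killed by the y_k, so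
    -- the coordinates are series in h.
    refine eq_smul_one_of_y_smul _ fun k => ?_
    have := hf (Weyl.y k) (Pi.single j 1)
    rw [y_smul_single, map_zero] at this
    exact (congrFun this i).symm
  choose A hA using h
  refine ⟨Matrix.of A, LinearMap.ext fun m => ?_⟩
  rw [sum_ofVac_smul_single m, map_sum, map_sum]
  refine Finset.sum_congr rfl fun j _ => ?_
  rw [hf, matAct_smul]
  congr 1
  funext i
  rw [hA, matAct_single]
  rfl

/-- The action of invertible matrices over `R⟦h⟧` on `ℳ_r`. -/
def matEquiv (n : ℕ) (g : GL (Fin r) (PowerSeries R)) :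
    FormalModule n r R ≃ₗ[PowerSeries R] FormalModule n r R :=
  LinearEquiv.ofLinearMap (matAct n r R g)
    (matAct n r R ((g⁻¹ : GL (Fin r) (PowerSeries R)) : Matrix (Fin r) (Fin r) (PowerSeries R)))
    (by
      rw [← Module.End.mul_eq_comp, ← map_mul, Units.mul_inv, map_one]
      rfl)
    (by
      rw [← Module.End.mul_eq_comp, ← map_mul, Units.inv_mul, map_one]
      rfl)

theorem matEquiv_apply (g : GL (Fin r) (PowerSeries R)) (m : FormalModule n r R) :
    matEquiv n g m = matAct n r R g m := rfl

/-- The image of a matrix in `Aut(𝒟, ℳ_r)`. -/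
def ofMatrix (n : ℕ) (g : GL (Fin r) (PowerSeries R)) : PairAut n r R :=
  PairAut.of 1 (matEquiv n g) (fun a => by rw [AlgEquiv.one_apply])
    (fun a m => by rw [AlgEquiv.one_apply, matEquiv_apply, matEquiv_apply, matAct_smul])

theorem ofMatrix_alg (g : GL (Fin r) (PowerSeries R)) : (ofMatrix n g).alg = 1 :=
  PairAut.alg_of _ _ _ _

theorem ofMatrix_mod (g : GL (Fin r) (PowerSeries R)) (m : FormalModule n r R) :
    (ofMatrix n g).mod m = matAct n r R g m := by
  rw [← matEquiv_apply]
  exact LinearEquiv.congr_fun (PairAut.mod_of _ _ _ _) m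

theorem ofMatrix_one : ofMatrix n (1 : GL (Fin r) (PowerSeries R)) = 1 :=
  PairAut.ext (by rw [ofMatrix_alg, PairAut.alg_one]) fun m => by
    rw [ofMatrix_mod, Units.val_one, map_one, PairAut.mod_one, Module.End.one_apply]

theorem ofMatrix_mul (g g' : GL (Fin r) (PowerSeries R)) :
    ofMatrix n (g * g') = ofMatrix n g * ofMatrix n g' :=
  PairAut.ext (by rw [PairAut.alg_mul, ofMatrix_alg, ofMatrix_alg, ofMatrix_alg, mul_one])
    fun m => by
      rw [PairAut.mod_mul, ofMatrix_mod, ofMatrix_mod, ofMatrix_mod, Units.val_mul, map_mul,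
        Module.End.mul_apply]

/-- The inclusion `GL_h(r) → Aut(𝒟, ℳ_r)`. -/
def matAut (n r : ℕ) (R : Type) [CommRing R] :
    GL (Fin r) (PowerSeries R) →* PairAut n r R where
  toFun g := ofMatrix n g
  map_one' := ofMatrix_one
  map_mul' := ofMatrix_mul

theorem matAut_alg (g : GL (Fin r) (PowerSeries R)) : (matAut n r R g).alg = 1 :=
  ofMatrix_alg g

theorem matAut_mod (g : GL (Fin r) (PowerSeries R)) (m : FormalModule n r R) :
    (matAut n r R g).mod m = matAct n r R g m := ofMatrix_mod g m

theorem isMatrix_iff (p : PairAut n r R) (g : GL (Fin r) (PowerSeries R)) :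
    p.IsMatrix g ↔ p = matAut n r R g :=
  ⟨fun h => PairAut.ext h.1 fun m => funext fun i => h.2 m i, fun h => h ▸ ⟨rfl, fun _ _ => rfl⟩⟩

theorem matAut_injective : Function.Injective (matAut n r R) := fun g g' h =>
  Units.ext (matAct_injective (n := n) (LinearMap.ext fun m => by
    rw [← matAut_mod, ← matAut_mod, h]))

/-- Both p and its inverse are 𝒟-linear, so each is given by a matrix; faithfulness of the matrix
action makes these matrices mutually inverse. -/
theorem exists_matAut [Algebra ℂ R] (p : PairAut n r R) (hp : p.alg = 1) :
    ∃ g, p = matAut n r R g := by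
  have h (p : PairAut n r R) (hp : p.alg = 1) : ∃ A, ∀ m, p.mod m = matAct n r R A m := by
    obtain ⟨A, hA⟩ := exists_matAct (p.mod : FormalModule n r R →ₗ[PowerSeries R] _) fun a m =>
      (p.mod_smul a m).trans (by rw [hp]; rfl)
    exact ⟨A, fun m => LinearMap.congr_fun hA m⟩
  obtain ⟨A, hA⟩ := h p hp
  obtain ⟨B, hB⟩ := h p⁻¹ (by rw [PairAut.alg_inv, hp, inv_one])
  have hAB : A * B = 1 := matAct_injective (n := n) (LinearMap.ext fun m => by
    rw [map_mul, map_one]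
    change matAct n r R A (matAct n r R B m) = m
    rw [← hB, ← hA]
    exact p.mod.apply_symm_apply m)
  have hBA : B * A = 1 := matAct_injective (n := n) (LinearMap.ext fun m => by
    rw [map_mul, map_one]
    change matAct n r R B (matAct n r R A m) = m
    rw [← hA, ← hB]
    exact p.mod.symm_apply_apply m)
  exact ⟨⟨A, B, hAB, hBA⟩, PairAut.ext hp hA⟩

/-- The component `Ψ` of an element of `Aut(𝒟, ℳ_1)`, as a map of `R⟦x, h⟧`. -/
def PairAut.vac (q : PairAut n 1 R) : Vac n R ≃ₗ[PowerSeries R] Vac n R :=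
  (LinearEquiv.funUnique (Fin 1) (PowerSeries R) (Vac n R)).symm ≪≫ₗ q.mod ≪≫ₗ
    LinearEquiv.funUnique (Fin 1) (PowerSeries R) (Vac n R)

theorem PairAut.vac_apply (q : PairAut n 1 R) (m : Vac n R) :
    q.vac m = q.mod (fun _ => m) 0 := rfl

theorem PairAut.mod_eq_vac (q : PairAut n 1 R) (m : FormalModule n 1 R) (i : Fin 1) :
    q.mod m i = q.vac (m 0) := by
  have h : m = fun _ => m 0 := funext fun j => congrArg m (Subsingleton.elim j 0)
  rw [PairAut.vac_apply, ← h, Subsingleton.elim i 0]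

theorem PairAut.vac_smul (q : PairAut n 1 R) (a : Weyl n R) (m : Vac n R) :
    q.vac (a • m) = q.alg a • q.vac m :=
  congrFun (q.mod_smul a fun _ => m) 0

theorem PairAut.vac_mul (q q' : PairAut n 1 R) (m : Vac n R) :
    (q * q').vac m = q.vac (q'.vac m) :=
  PairAut.mod_eq_vac q _ 0

/-- The element of `Aut(𝒟, ℳ_1)` with given components. -/
def PairAut.ofVac (Φ : Weyl n R ≃ₐ[PowerSeries R] Weyl n R)
    (Ψ : Vac n R ≃ₗ[PowerSeries R] Vac n R)
    (hΦ : ∀ a, weylAug n R (Φ a) = weylAug n R a)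
    (hΨ : ∀ (a : Weyl n R) m, Ψ (a • m) = Φ a • Ψ m) : PairAut n 1 R :=
  PairAut.of Φ (LinearEquiv.piCongrRight fun _ => Ψ) hΦ fun a m => funext fun i => hΨ a (m i)

/-- The map `(Φ, Ψ) ↦ (Φ, Ψ ⊕ ⋯ ⊕ Ψ)` from `Aut(𝒟, ℳ_1)` to `Aut(𝒟, ℳ_r)`. -/
def diagAut (n r : ℕ) (R : Type) [CommRing R] : PairAut n 1 R →* PairAut n r R where
  toFun q := PairAut.of q.alg (LinearEquiv.piCongrRight fun _ => q.vac) q.weylAug_alg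
    fun a m => funext fun i => q.vac_smul a (m i)
  map_one' := PairAut.ext rfl fun _ => rfl
  map_mul' q q' := PairAut.ext rfl fun m => funext fun i => PairAut.vac_mul q q' (m i)

theorem diagAut_alg (q : PairAut n 1 R) : (diagAut n r R q).alg = q.alg := rfl

theorem diagAut_mod (q : PairAut n 1 R) (m : FormalModule n r R) (i : Fin r) :
    (diagAut n r R q).mod m i = q.vac (m i) := rfl

theorem isDiag_iff (p : PairAut n r R) (q : PairAut n 1 R) :
    p.IsDiag q ↔ p = diagAut n r R q :=
  ⟨fun h => PairAut.ext h.1 fun m => funext fun i => h.2 m i, fun h => h ▸ ⟨rfl, fun _ _ => rfl⟩⟩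

/-- The entries of g are series in h, and Ψ is R⟦h⟧-linear. -/
theorem diagAut_mul_matAut (q : PairAut n 1 R) (g : GL (Fin r) (PowerSeries R)) :
    diagAut n r R q * matAut n r R g = matAut n r R g * diagAut n r R q := by
  refine PairAut.ext ?_ fun m => funext fun i => ?_
  · rw [PairAut.alg_mul, PairAut.alg_mul, matAut_alg, mul_one, one_mul]
  · rw [PairAut.mod_mul, PairAut.mod_mul, diagAut_mod, matAut_mod, matAut_mod, matAct_apply,
      matAct_apply, map_sum]
    exact Finset.sum_congr rfl fun j _ => map_smul _ _ _

/-- Scalars from R⟦h⟧ˣ lie both among the diagonal automorphisms and among the matrices. This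
overlap is the sole source of ambiguity in the factorization diag(q)·g. -/
theorem diagAut_matAut_scalar (c : (PowerSeries R)ˣ) :
    diagAut n r R (matAut n 1 R (Matrix.GeneralLinearGroup.scalar (Fin 1) c)) =
      matAut n r R (Matrix.GeneralLinearGroup.scalar (Fin r) c) := by
  refine PairAut.ext (by rw [diagAut_alg, matAut_alg, matAut_alg]) fun m => funext fun i => ?_
  rw [diagAut_mod, matAut_mod, PairAut.vac_apply, matAut_mod]
  change matAct n 1 R (Matrix.scalar (Fin 1) (c : PowerSeries R)) _ 0 =
    matAct n r R (Matrix.scalar (Fin r) (c : PowerSeries R)) _ i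
  rw [matAct_scalar, matAct_scalar]
  rfl

/-- The units of `R` as constant units of `R⟦h⟧`. -/
def constUnit (R : Type) [CommRing R] : Rˣ →* (PowerSeries R)ˣ :=
  Units.map (PowerSeries.C (R := R)).toMonoidHom

theorem mem_scalarAut_iff (p : PairAut n r R) : p ∈ scalarAut n r R ↔
    ∃ c : Rˣ, p = matAut n r R (Matrix.GeneralLinearGroup.scalar (Fin r) (constUnit R c)) := by
  have h (c : Rˣ) (m : FormalModule n r R) :
      (matAut n r R (Matrix.GeneralLinearGroup.scalar (Fin r) (constUnit R c))).mod m =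
        PowerSeries.C (c : R) • m := matAct_scalar (PowerSeries.C (c : R)) m
  constructor
  · rintro ⟨h1, c, hc⟩
    exact ⟨c, PairAut.ext h1 fun m => by rw [hc, h]⟩
  · rintro ⟨c, rfl⟩
    exact ⟨rfl, c, h c⟩

theorem PairAut.mod_apply_eq_sum (p : PairAut n r R) (m : FormalModule n r R) (i : Fin r) :
    p.mod m i = ∑ j, p.alg (Weyl.ofVac (m j)) • p.mod (Pi.single j 1) i := by
  conv_lhs => rw [sum_ofVac_smul_single m, map_sum, Finset.sum_apply]
  exact Finset.sum_congr rfl fun j _ => congrFun (p.mod_smul _ _) i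

theorem weylAug_ofVac (m : Vac n R) : weylAug n R (Weyl.ofVac m) = vacAug n R m := by
  conv_rhs => rw [← Weyl.ofVac_smul_one m, vacAug_smul, map_one, mul_one]

/-- The matrix of `Ψ` on `ℳ_r / 𝔪 ℳ_r = R ^ r`. -/
def evMat (p : PairAut n r R) : Matrix (Fin r) (Fin r) R :=
  Matrix.of fun i j => vacAug n R (p.mod (Pi.single j 1) i)

/-- Since Φ preserves constant terms, Ψ descends to an R-linear map of ℳ_r/𝔪ℳ_r = R^r. Applied to a
second automorphism, this says that `evMat` is multiplicative. -/
theorem vacAug_mod (p : PairAut n r R) (m : FormalModule n r R) (i : Fin r) :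
    vacAug n R (p.mod m i) = ∑ j, evMat p i j * vacAug n R (m j) := by
  rw [p.mod_apply_eq_sum, map_sum]
  refine Finset.sum_congr rfl fun j _ => ?_
  rw [vacAug_smul, p.weylAug_alg, weylAug_ofVac, mul_comm]
  rfl

/-- The action of `Aut(𝒟, ℳ_r)` on `ℳ_r / 𝔪 ℳ_r = R ^ r`. -/
def evGL (n r : ℕ) (R : Type) [CommRing R] : PairAut n r R →* GL (Fin r) R :=
  MonoidHom.toHomUnits
    { toFun := evMat
      map_one' := by
        ext i j
        change vacAug n R ((Pi.single j 1 : FormalModule n r R) i) = _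
        rw [Pi.single_apply, Matrix.one_apply, apply_ite (vacAug n R), map_one, map_zero]
      map_mul' := fun p q => by
        ext i j
        rw [Matrix.mul_apply]
        exact vacAug_mod p _ i }

theorem evGL_apply (p : PairAut n r R) (i j : Fin r) :
    (evGL n r R p : Matrix (Fin r) (Fin r) R) i j = vacAug n R (p.mod (Pi.single j 1) i) := rfl

theorem vacAug_series_smul_one (c : PowerSeries R) :
    vacAug n R (c • (1 : Vac n R)) = PowerSeries.constantCoeff c := by
  rw [vacAug_series_smul, map_one, mul_one]

theorem evGL_matAut (g : GL (Fin r) (PowerSeries R)) :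
    evGL n r R (matAut n r R g) =
      Matrix.GeneralLinearGroup.map (PowerSeries.constantCoeff (R := R)) g := by
  ext i j
  rw [evGL_apply, matAut_mod, matAct_single, vacAug_series_smul_one]
  rfl

theorem evGL_diagAut (q : PairAut n 1 R) :
    ∃ c : Rˣ, evGL n r R (diagAut n r R q) = Matrix.GeneralLinearGroup.scalar (Fin r) c := by
  -- The unit is the scalar by which q acts on the line ℳ_1/𝔪ℳ_1, read as a 1 × 1 determinant.
  refine ⟨Matrix.GeneralLinearGroup.det (evGL n 1 R q), ?_⟩
  ext i j
  rw [evGL_apply, diagAut_mod, Matrix.GeneralLinearGroup.coe_scalar,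
    Matrix.GeneralLinearGroup.val_det_apply, Matrix.det_fin_one, evGL_apply, Pi.single_apply]
  simp only [Matrix.scalar_apply, Matrix.diagonal_apply]
  split_ifs with h
  · rw [PairAut.vac_apply]
    refine congrArg (fun m => vacAug n R (q.mod m 0)) (funext fun k => ?_)
    rw [Subsingleton.elim k 0, Pi.single_eq_same]
  · rw [map_zero, map_zero]

end AutConstructions

/-! ### The factorization diag(q)·g -/

section Factorization

variable {n r : ℕ} {R : Type} [CommRing R]

/-- Any coordinate of Ψ applied to a vector killed by the y_j is killed by the Φ(y_j). The only
issue is the constant term, which is arranged by inverting the matrix of Ψ on ℳ_r/𝔪ℳ_r. -/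
theorem exists_vacuum (hr : 1 ≤ r) (p : PairAut n r R) :
    ∃ w : Vac n R, (∀ j, p.alg (Weyl.y j) • w = 0) ∧ vacAug n R w = 1 := by
  let i₀ : Fin r := ⟨0, hr⟩
  -- Column i₀ of the inverse matrix: the constant vector with these entries is sent by Ψ to the
  -- basis vector i₀ modulo 𝔪.
  let c : Fin r → R := fun j => (evGL n r R p⁻¹ : Matrix (Fin r) (Fin r) R) j i₀
  let m : FormalModule n r R := fun j => (PowerSeries.C (c j) : PowerSeries R) • (1 : Vac n R)
  refine ⟨p.mod m i₀, fun j => ?_, ?_⟩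
  · have h : (Weyl.y j : Weyl n R) • m = 0 := funext fun k => by
      change (Weyl.y j : Weyl n R) • (PowerSeries.C (c k) : PowerSeries R) • (1 : Vac n R) = 0
      rw [smul_comm, y_smul_one, smul_zero]
    have := congrFun (p.mod_smul (Weyl.y j) m) i₀
    rw [h, map_zero] at this
    exact this.symm
  · have h : evGL n r R p * evGL n r R p⁻¹ = 1 := by rw [← map_mul, mul_inv_cancel, map_one]
    have h1 := congrArg (fun A : Matrix (Fin r) (Fin r) R => A i₀ i₀) (congrArg Units.val h)
    simp only [Units.val_mul, Matrix.mul_apply, Units.val_one, Matrix.one_apply_eq] at h1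
    rw [vacAug_mod, ← h1]
    refine Finset.sum_congr rfl fun j _ => ?_
    rw [vacAug_series_smul_one, PowerSeries.constantCoeff_C]
    rfl

theorem vacAug_twistMap (p : PairAut n r R) (w : Vac n R) (hw : ∀ j, p.alg (Weyl.y j) • w = 0)
    (hw1 : vacAug n R w = 1) (m : Vac n R) :
    vacAug n R (twistMap p.alg w hw m) = vacAug n R m := by
  change vacAug n R (p.alg _ • w) = _
  rw [vacAug_smul, p.weylAug_alg, weylAug_ofVac, hw1, mul_one]

/-- The two semilinear maps have inverse twists, so their composite is 𝒟-linear on ℳ_1 and therefore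
a scalar series in h. Both preserve constant terms, so the series has constant term 1 and is a unit.
-/
theorem twistMap_comp [Algebra ℂ R] (p q : PairAut n r R) (hpq : p.alg * q.alg = 1) (w v : Vac n R)
    (hw : ∀ j, p.alg (Weyl.y j) • w = 0) (hv : ∀ j, q.alg (Weyl.y j) • v = 0)
    (hw1 : vacAug n R w = 1) (hv1 : vacAug n R v = 1) :
    ∃ c : (PowerSeries R)ˣ, ∀ m, twistMap p.alg w hw (twistMap q.alg v hv m) =
      (c : PowerSeries R) • m := by
  let f : Vac n R →ₗ[PowerSeries R] Vac n R := twistMap p.alg w hw ∘ₗ twistMap q.alg v hv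
  have hfm (m : Vac n R) : f m = twistMap p.alg w hw (twistMap q.alg v hv m) := rfl
  have hf (a : Weyl n R) (m : Vac n R) : f (a • m) = a • f m := by
    have ha : p.alg (q.alg a) = a := DFunLike.congr_fun hpq a
    rw [hfm, hfm, twistMap_smul, twistMap_smul, ha]
  obtain ⟨c, hc⟩ := eq_smul_one_of_y_smul (f 1) fun j => by
    rw [← hf, y_smul_one, map_zero]
  have hc1 : PowerSeries.constantCoeff c = 1 := by
    rw [← vacAug_series_smul_one (n := n), ← hc, hfm, vacAug_twistMap p w hw hw1, vacAug_twistMap q v hv hv1, map_one]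
  have hu : IsUnit c := PowerSeries.isUnit_iff_constantCoeff.2 (hc1 ▸ isUnit_one)
  refine ⟨hu.unit, fun m => ?_⟩
  rw [← hfm, IsUnit.unit_spec]
  conv_lhs => rw [← Weyl.ofVac_smul_one m, hf, hc, smul_comm, Weyl.ofVac_smul_one]

/-- The lift of Φ to ℳ_1 sends 1 to a vector killed by the Φ(y_j). Composing it in either order with
the analogous map for the inverse of Φ gives a unit scalar: one order yields surjectivity and the
other injectivity. -/
theorem exists_diag [Algebra ℂ R] (hr : 1 ≤ r) (p : PairAut n r R) : ∃ q : PairAut n 1 R, q.alg = p.alg := by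
  obtain ⟨w, hw, hw1⟩ := exists_vacuum hr p
  obtain ⟨v, hv, hv1⟩ := exists_vacuum hr p⁻¹
  obtain ⟨c, hc⟩ := twistMap_comp p p⁻¹ (mul_inv_cancel p.alg) w v hw hv hw1 hv1
  obtain ⟨d, hd⟩ := twistMap_comp p⁻¹ p (inv_mul_cancel p.alg) v w hv hw hv1 hw1
  refine ⟨PairAut.ofVac p.alg (LinearEquiv.ofBijective (twistMap p.alg w hw) ⟨?_, ?_⟩)
    p.weylAug_alg (twistMap_smul p.alg w hw), rfl⟩
  · intro m m' h
    have h1 := (hd m).symm.trans ((congrArg _ h).trans (hd m'))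
    have h2 := congrArg (fun z => ((d⁻¹ : (PowerSeries R)ˣ) : PowerSeries R) • z) h1
    simpa only [← mul_smul, Units.inv_mul, one_smul] using h2
  · intro m
    refine ⟨twistMap p⁻¹.alg v hv (((c⁻¹ : (PowerSeries R)ˣ) : PowerSeries R) • m), ?_⟩
    rw [hc, ← mul_smul, Units.mul_inv, one_smul]

/-- The determinant of `g` does not depend on `h`. -/
def HasConstDet (g : GL (Fin r) (PowerSeries R)) : Prop :=
  ∃ d : R, (g : Matrix (Fin r) (Fin r) (PowerSeries R)).det = PowerSeries.C d

theorem HasConstDet.mul {g g' : GL (Fin r) (PowerSeries R)} (hg : HasConstDet g)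
    (hg' : HasConstDet g') : HasConstDet (g * g') := by
  obtain ⟨d, hd⟩ := hg
  obtain ⟨d', hd'⟩ := hg'
  exact ⟨d * d', by rw [Units.val_mul, Matrix.det_mul, hd, hd', map_mul]⟩

theorem hasConstDet_one : HasConstDet (1 : GL (Fin r) (PowerSeries R)) :=
  ⟨1, by rw [Units.val_one, Matrix.det_one, map_one]⟩

theorem hasConstDet_scalar (c : Rˣ) :
    HasConstDet (Matrix.GeneralLinearGroup.scalar (Fin r) (constUnit R c)) := by
  refine ⟨(c : R) ^ r, ?_⟩
  rw [← Matrix.GeneralLinearGroup.val_det_apply, Matrix.GeneralLinearGroup.det_scalar,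
    Fintype.card_fin, Units.val_pow_eq_pow_val, map_pow]
  rfl

theorem HasConstDet.map {S : Type} [CommRing S] (ρ : R →+* S)
    {g : GL (Fin r) (PowerSeries R)} (hg : HasConstDet g) :
    HasConstDet (Matrix.GeneralLinearGroup.map (PowerSeries.map ρ) g) := by
  obtain ⟨d, hd⟩ := hg
  refine ⟨ρ d, ?_⟩
  rw [← PowerSeries.map_C, ← hd, RingHom.map_det]
  rfl

variable [Algebra ℂ R]

/-- Scaling by c multiplies the determinant by c^r, so c is taken to be an r-th root of
det(g)(0)/det(g), a series with constant term 1. -/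
theorem exists_hasConstDet (hr : 1 ≤ r) (g : GL (Fin r) (PowerSeries R)) :
    ∃ c : (PowerSeries R)ˣ, HasConstDet (Matrix.GeneralLinearGroup.scalar (Fin r) c * g) := by
  set u := Matrix.GeneralLinearGroup.det g with hu
  set u₀ : Rˣ := Units.map (PowerSeries.constantCoeff (R := R)).toMonoidHom u
  obtain ⟨c, hc1, hc⟩ := exists_pow_eq (R := R) hr
    ((u⁻¹ * constUnit R u₀ : (PowerSeries R)ˣ) : PowerSeries R) (by
      have h : Units.map (PowerSeries.constantCoeff (R := R)).toMonoidHom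
          (u⁻¹ * constUnit R u₀) = 1 := by
        rw [map_mul, map_inv]
        have : Units.map (PowerSeries.constantCoeff (R := R)).toMonoidHom (constUnit R u₀) = u₀ :=
          Units.ext (PowerSeries.constantCoeff_C _)
        rw [this, inv_mul_cancel]
      exact congrArg Units.val h)
  have hcu : IsUnit c := PowerSeries.isUnit_iff_constantCoeff.2 (hc1 ▸ isUnit_one)
  refine ⟨hcu.unit, u₀, ?_⟩
  rw [← Matrix.GeneralLinearGroup.val_det_apply, map_mul, Matrix.GeneralLinearGroup.det_scalar,
    Fintype.card_fin, Units.val_mul, Units.val_pow_eq_pow_val, IsUnit.unit_spec, hc,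
    ← Units.val_mul, ← hu, mul_comm u⁻¹, inv_mul_cancel_right]
  rfl

/-- The two determinants differ by c^r, which is then constant in h, and this forces c to be
constant. -/
theorem eq_constUnit_of_hasConstDet (hr : 1 ≤ r) {g : GL (Fin r) (PowerSeries R)}
    (hg : HasConstDet g) (c : (PowerSeries R)ˣ)
    (hgc : HasConstDet (g * Matrix.GeneralLinearGroup.scalar (Fin r) c)) :
    ∃ c₀ : Rˣ, c = constUnit R c₀ := by
  obtain ⟨d, hd⟩ := hg
  obtain ⟨e, he⟩ := hgc
  rw [← Matrix.GeneralLinearGroup.val_det_apply, map_mul, Matrix.GeneralLinearGroup.det_scalar,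
    Fintype.card_fin, Units.val_mul, Matrix.GeneralLinearGroup.val_det_apply, hd,
    Units.val_pow_eq_pow_val] at he
  have hdu : IsUnit d := by
    have h : IsUnit (PowerSeries.C d) := hd ▸ ⟨Matrix.GeneralLinearGroup.det g, rfl⟩
    simpa using h.map (PowerSeries.constantCoeff (R := R))
  obtain ⟨d, rfl⟩ := hdu
  refine ⟨_, eq_C_of_pow_eq_C hr c (((d⁻¹ : Rˣ) : R) * e) ?_⟩
  rw [map_mul, ← he, ← mul_assoc, ← map_mul, Units.inv_mul, map_one, one_mul]

/-- After division by a diagonal lift of Φ only a matrix g remains. A scalar c making det(cg)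
constant is then moved across: diag(q)·g = diag(q c⁻¹)·(c g). -/
theorem exists_factorization (hr : 1 ≤ r) (p : PairAut n r R) :
    ∃ (q : PairAut n 1 R) (g : GL (Fin r) (PowerSeries R)), HasConstDet g ∧
      p = diagAut n r R q * matAut n r R g := by
  obtain ⟨q, hq⟩ := exists_diag hr p
  obtain ⟨g, hg⟩ := exists_matAut ((diagAut n r R q)⁻¹ * p) (by
    rw [PairAut.alg_mul, PairAut.alg_inv, diagAut_alg, hq, inv_mul_cancel])
  obtain ⟨c, hc⟩ := exists_hasConstDet hr g
  refine ⟨q * matAut n 1 R (Matrix.GeneralLinearGroup.scalar (Fin 1) c⁻¹), _, hc, ?_⟩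
  rw [map_mul, diagAut_matAut_scalar, mul_assoc, ← map_mul, map_inv, inv_mul_cancel_left, ← hg,
    mul_inv_cancel_left]

/-- The rank-one parts q and q' induce the same Φ, so they differ by a 1 × 1 matrix, that is, a
scalar c in R⟦h⟧ˣ. This scalar reappears in the matrix factor, where constancy of both determinants
forces c to be constant. -/
theorem factorization_unique (hr : 1 ≤ r) {q q' : PairAut n 1 R}
    {g g' : GL (Fin r) (PowerSeries R)} (hg : HasConstDet g) (hg' : HasConstDet g')
    (h : diagAut n r R q * matAut n r R g = diagAut n r R q' * matAut n r R g') :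
    ∃ c : Rˣ, q = q' * matAut n 1 R (Matrix.GeneralLinearGroup.scalar (Fin 1) (constUnit R c)) ∧
      g' = g * Matrix.GeneralLinearGroup.scalar (Fin r) (constUnit R c) := by
  have halg : q'⁻¹.alg * q.alg = 1 := by
    have := congrArg PairAut.alg h
    rw [PairAut.alg_mul, PairAut.alg_mul, matAut_alg, matAut_alg, diagAut_alg, diagAut_alg,
      mul_one, mul_one] at this
    rw [PairAut.alg_inv, this, inv_mul_cancel]
  obtain ⟨s, hs⟩ := exists_matAut (q'⁻¹ * q) ((PairAut.alg_mul _ _).trans halg)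
  obtain ⟨c, rfl⟩ : ∃ c, s = Matrix.GeneralLinearGroup.scalar (Fin 1) c := by
    refine ⟨Matrix.GeneralLinearGroup.det s, ?_⟩
    ext i j
    rw [Subsingleton.elim i 0, Subsingleton.elim j 0, Matrix.GeneralLinearGroup.coe_scalar,
      Matrix.GeneralLinearGroup.val_det_apply, Matrix.det_fin_one]
    simp
  have hq : q = q' * matAut n 1 R (Matrix.GeneralLinearGroup.scalar (Fin 1) c) := by
    rw [← hs, mul_inv_cancel_left]
  have hgg : g' = g * Matrix.GeneralLinearGroup.scalar (Fin r) c := by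
    rw [hq, map_mul, mul_assoc, mul_right_inj, diagAut_matAut_scalar, ← map_mul] at h
    rw [← matAut_injective h, Matrix.GeneralLinearGroup.scalar_commute]
  obtain ⟨c₀, rfl⟩ := eq_constUnit_of_hasConstDet hr hg c (hgg ▸ hg')
  exact ⟨c₀, hq, hgg⟩

end Factorization

/-! ### Commutators as partial derivatives, and the Poincaré lemma -/

section PartialDerivatives

variable {n : ℕ} {R : Type} [CommRing R]

/-- The partial derivatives on `R⟦x, y⟧⟦h⟧`. -/
def pderiv (s : Fin n ⊕ Fin n) : PowerSeries (SymbolRing n R) →+ PowerSeries (SymbolRing n R) :=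
  coeffwise (hasse (Finsupp.single s 1)).toAddMonoidHom

theorem coeff_pderiv (s : Fin n ⊕ Fin n) (f : PowerSeries (SymbolRing n R)) (N : ℕ) :
    PowerSeries.coeff N (pderiv s f) = hasse (Finsupp.single s 1) (PowerSeries.coeff N f) := by
  rw [pderiv, coeff_coeffwise]
  rfl

theorem dX_single (j : Fin n) :
    (dX (Finsupp.single j 1) : PowerSeries (SymbolRing n R) →+ _) = pderiv (Sum.inl j) := by
  have hs : (Finsupp.single j 1 : Fin n →₀ ℕ).sumElim (0 : Fin n →₀ ℕ) =
      Finsupp.single (Sum.inl j) 1 := by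
    ext i
    rcases i with i | i <;> simp [Finsupp.single_apply]
  rw [dX, pderiv, hs]

theorem dY_single (j : Fin n) :
    (dY (Finsupp.single j 1) : PowerSeries (SymbolRing n R) →+ _) = pderiv (Sum.inr j) := by
  have hs : Finsupp.sumElim (0 : Fin n →₀ ℕ) (Finsupp.single j 1 : Fin n →₀ ℕ) =
      Finsupp.single (Sum.inr j) 1 := by
    ext i
    rcases i with i | i <;> simp [Finsupp.single_apply]
  rw [dY, pderiv, hs]

theorem dY_of_linear {κ : Fin n →₀ ℕ} (j : Fin n) (h0 : κ ≠ 0) (h1 : κ ≠ Finsupp.single j 1) :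
    dY κ (PowerSeries.C (MvPowerSeries.X (Sum.inr j) : SymbolRing n R)) = 0 := by
  classical
  ext N e
  rw [dY, coeff_coeffwise]
  refine (coeff_hasse _ _ _).trans ?_
  rw [PowerSeries.coeff_C]
  split_ifs
  · rw [MvPowerSeries.coeff_X, if_neg, mul_zero, map_zero, map_zero]
    intro h
    have hi : ∀ i, e (Sum.inr i) + κ i = (Finsupp.single j 1 : Fin n →₀ ℕ) i := fun i => by
      have := DFunLike.congr_fun h (Sum.inr i)
      simpa [Finsupp.single_apply] using this
    have hz : ∀ i, i ≠ j → κ i = 0 := fun i hij => by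
      have := hi i
      rw [Finsupp.single_eq_of_ne hij] at this
      omega
    have hj := hi j
    rw [Finsupp.single_eq_same] at hj
    have : κ j = 0 ∨ κ j = 1 := by omega
    rcases this with hk | hk
    · exact h0 (Finsupp.ext fun i => if hij : i = j then hij ▸ hk else hz i hij)
    · refine h1 (Finsupp.ext fun i => ?_)
      by_cases hij : i = j
      · subst hij
        simpa using hk
      · rw [hz i hij, Finsupp.single_eq_of_ne hij]
  · simp

theorem mfact_zero : mfact (0 : Fin n →₀ ℕ) = 1 := Finset.prod_eq_one fun _ _ => rfl

theorem mfact_single (j : Fin n) : mfact (Finsupp.single j 1 : Fin n →₀ ℕ) = 1 :=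
  Finset.prod_eq_one fun k _ => by
    rw [Finsupp.single_apply]
    split_ifs <;> rfl

theorem symbol_x_mul (j : Fin n) (a : Weyl n R) :
    Weyl.symbol (Weyl.x j * a) =
      PowerSeries.C (MvPowerSeries.X (Sum.inl j)) * Weyl.symbol a := by
  classical
  refine star_of_left _ _ fun N e k he => ?_
  change MvPowerSeries.coeff e (PowerSeries.coeff N (PowerSeries.C (MvPowerSeries.X _))) = 0
  rw [PowerSeries.coeff_C]
  split_ifs
  · rw [MvPowerSeries.coeff_X, if_neg]
    rintro rfl
    simp at he
  · simp

/-- The star product stops after first order, since the higher x-derivatives of x_j vanish. The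
first-order term is what turns commutators with x_j into h times a partial derivative. -/
theorem symbol_mul_x (a : Weyl n R) (j : Fin n) :
    Weyl.symbol (a * Weyl.x j) =
      Weyl.symbol a * PowerSeries.C (MvPowerSeries.X (Sum.inl j)) +
        PowerSeries.X * pderiv (Sum.inr j) (Weyl.symbol a) := by
  refine (hsum_of_le_one _ j fun κ h0 h1 => ?_).trans ?_
  · change mfact κ • (_ * dX κ (PowerSeries.C (MvPowerSeries.X (Sum.inl j)))) = 0
    rw [dX_of_linear j h0 h1, mul_zero, smul_zero]
  · have e3 := dX_single_X (R := R) j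
    change mfact 0 • (dY 0 _ * dX 0 (PowerSeries.C (MvPowerSeries.X (Sum.inl j)))) +
      PowerSeries.X * mfact _ • (dY (Finsupp.single j 1) _ *
        dX (Finsupp.single j 1) (PowerSeries.C (MvPowerSeries.X (Sum.inl j)))) = _
    rw [e3, mfact_zero, mfact_single, one_smul, one_smul, mul_one, dX_zero, dY_zero, dY_single]

theorem symbol_y_mul (j : Fin n) (a : Weyl n R) :
    Weyl.symbol (Weyl.y j * a) =
      PowerSeries.C (MvPowerSeries.X (Sum.inr j)) * Weyl.symbol a +
        PowerSeries.X * pderiv (Sum.inl j) (Weyl.symbol a) := by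
  refine (hsum_of_le_one _ j fun κ h0 h1 => ?_).trans ?_
  · change mfact κ • (dY κ (PowerSeries.C (MvPowerSeries.X (Sum.inr j))) * _) = 0
    rw [dY_of_linear j h0 h1, zero_mul, smul_zero]
  · have e3 := dY_single_X (R := R) j j
    rw [if_pos rfl] at e3
    change mfact 0 • (dY 0 (PowerSeries.C (MvPowerSeries.X (Sum.inr j))) * dX 0 _) +
      PowerSeries.X * mfact _ • (dY (Finsupp.single j 1)
        (PowerSeries.C (MvPowerSeries.X (Sum.inr j))) * dX (Finsupp.single j 1) _) = _
    rw [e3, mfact_zero, mfact_single, one_smul, one_smul, one_mul, dX_zero, dY_zero, dX_single]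

/-- The partial derivatives on the Weyl algebra, in terms of normally ordered symbols. -/
def Weyl.pd (s : Fin n ⊕ Fin n) (a : Weyl n R) : Weyl n R :=
  Weyl.ofSymbol (pderiv s (Weyl.symbol a))

theorem Weyl.pd_neg (s : Fin n ⊕ Fin n) (a : Weyl n R) : Weyl.pd s (-a) = -Weyl.pd s a := by
  rw [Weyl.pd, Weyl.pd, map_neg, map_neg, map_neg]

theorem Weyl.symbol_h_mul (a : Weyl n R) :
    Weyl.symbol (Weyl.h * a) = PowerSeries.X * Weyl.symbol a := by
  rw [Weyl.h_mul, Weyl.symbol_X_smul]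

theorem Weyl.commutator_x (a : Weyl n R) (j : Fin n) :
    a * Weyl.x j - Weyl.x j * a = Weyl.h * Weyl.pd (Sum.inr j) a := by
  apply Weyl.symbol.injective
  rw [map_sub, symbol_mul_x, symbol_x_mul, Weyl.symbol_h_mul, mul_comm, add_sub_cancel_left]
  rfl

theorem Weyl.commutator_y (a : Weyl n R) (j : Fin n) :
    a * Weyl.y j - Weyl.y j * a = -(Weyl.h * Weyl.pd (Sum.inl j) a) := by
  apply Weyl.symbol.injective
  rw [map_sub, symbol_y_mul, symbol_mul_y, map_neg, Weyl.symbol_h_mul, mul_comm, sub_add_cancel_left]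
  rfl

theorem Weyl.x_comm (i j : Fin n) : (Weyl.x i * Weyl.x j : Weyl n R) = Weyl.x j * Weyl.x i := by
  apply Weyl.symbol.injective
  rw [symbol_x_mul, symbol_x_mul]
  exact mul_comm _ _

theorem Weyl.y_comm (i j : Fin n) : (Weyl.y i * Weyl.y j : Weyl n R) = Weyl.y j * Weyl.y i := by
  apply Weyl.symbol.injective
  rw [symbol_mul_y, symbol_mul_y]
  exact mul_comm _ _

/-- The formal Poincaré lemma for closed one-forms. -/
theorem exists_primitive {σ : Type} [Fintype σ] [DecidableEq σ] (g : σ → MvPowerSeries σ ℂ)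
    (hg : ∀ s t, hasse (Finsupp.single s 1) (g t) = hasse (Finsupp.single t 1) (g s)) :
    ∃ f, ∀ s, hasse (Finsupp.single s 1) f = g s := by
  -- This is ∑ X_t g_t with each coefficient divided by its total degree, as Euler's identity
  -- dictates. In degree zero the default value of the inverse is harmless because every summand is
  -- zero.
  let f : MvPowerSeries σ ℂ := fun e => ((∑ i, e i : ℕ) : ℂ)⁻¹ *
    ∑ t, if e t = 0 then 0 else MvPowerSeries.coeff (e - Finsupp.single t 1) (g t)
  have hf (e : σ →₀ ℕ) : MvPowerSeries.coeff e f = ((∑ i, e i : ℕ) : ℂ)⁻¹ *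
    ∑ t, if e t = 0 then 0 else MvPowerSeries.coeff (e - Finsupp.single t 1) (g t) := rfl
  refine ⟨f, fun s => ?_⟩
  ext e
  rw [coeff_hasse_single, hf]
  have hdeg : ∑ i, (e + Finsupp.single s 1 : σ →₀ ℕ) i = ∑ i, e i + 1 := by
    simp [Finset.sum_add_distrib, Finsupp.single_apply]
  -- Closedness trades the coefficient of g_t for the coefficient of g_s, with factor e_t plus 1
  -- when t = s. Summing over t gives the total degree |e| + 1, which cancels the normalization.
  have key (t : σ) : ((e s + 1 : ℕ) : ℂ) * (if (e + Finsupp.single s 1 : σ →₀ ℕ) t = 0 then 0 else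
      MvPowerSeries.coeff (e + Finsupp.single s 1 - Finsupp.single t 1) (g t)) =
      ((e t + if t = s then 1 else 0 : ℕ) : ℂ) * MvPowerSeries.coeff e (g s) := by
    by_cases hts : t = s
    · subst hts
      rw [if_neg (by simp), if_pos rfl, add_tsub_cancel_right]
    · rw [Finsupp.add_apply, Finsupp.single_eq_of_ne hts, add_zero, if_neg hts, add_zero]
      by_cases het : e t = 0
      · rw [if_pos het, het, Nat.cast_zero, mul_zero, zero_mul]
      · rw [if_neg het]
        have hle : Finsupp.single t 1 ≤ e := Finsupp.single_le_iff.2 (by omega)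
        have h1 := congrArg (MvPowerSeries.coeff (e - Finsupp.single t 1)) (hg s t)
        rw [coeff_hasse_single, coeff_hasse_single, tsub_add_cancel_of_le hle,
          ← tsub_add_eq_add_tsub hle] at *
        rw [Finsupp.tsub_apply, Finsupp.tsub_apply, Finsupp.single_eq_of_ne (Ne.symm hts),
          Finsupp.single_eq_same, Nat.sub_zero, Nat.sub_add_cancel (by omega)] at h1
        exact h1
  rw [mul_left_comm, Finset.mul_sum, Finset.sum_congr rfl fun t _ => key t, ← Finset.sum_mul,
    ← Nat.cast_sum, Finset.sum_add_distrib, Finset.sum_ite_eq' Finset.univ s,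
    if_pos (Finset.mem_univ s), hdeg, ← mul_assoc,
    inv_mul_cancel₀ (Nat.cast_ne_zero.2 (Nat.succ_ne_zero _)), one_mul]

theorem Weyl.exists_primitive (g : Fin n ⊕ Fin n → Weyl n ℂ)
    (hg : ∀ s t, Weyl.pd s (g t) = Weyl.pd t (g s)) : ∃ a, ∀ s, Weyl.pd s a = g s := by
  have h (N : ℕ) := FormalQuant.exists_primitive
    (fun s => PowerSeries.coeff N (Weyl.symbol (g s))) fun s t => by
      rw [← coeff_pderiv, ← coeff_pderiv]
      exact congrArg (fun a => PowerSeries.coeff N (Weyl.symbol a)) (hg s t)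
  choose f hf using h
  refine ⟨Weyl.ofSymbol (PowerSeries.mk f), fun s => Weyl.symbol.injective ?_⟩
  change pderiv s (PowerSeries.mk f) = _
  ext N : 1
  rw [coeff_pderiv, PowerSeries.coeff_mk, hf]

/-- An element of the Weyl algebra with vanishing partial derivatives is a scalar. -/
theorem Weyl.eq_algebraMap_of_pd [Algebra ℂ R] (a : Weyl n R) (ha : ∀ s, Weyl.pd s a = 0) :
    ∃ c : PowerSeries R, a = algebraMap _ _ c := by
  classical
  refine ⟨PowerSeries.mk fun N =>
    MvPowerSeries.constantCoeff (PowerSeries.coeff N (Weyl.symbol a)), ?_⟩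
  apply Weyl.symbol.injective
  rw [Algebra.algebraMap_eq_smul_one]
  have h1 (c : PowerSeries R) : Weyl.symbol (c • (1 : Weyl n R)) =
    PowerSeries.map (algebraMap R (SymbolRing n R)) c * 1 := rfl
  have h2 (c : R) : algebraMap R (SymbolRing n R) c = MvPowerSeries.C c := rfl
  ext N e
  rw [h1, mul_one, PowerSeries.coeff_map, PowerSeries.coeff_mk, h2, MvPowerSeries.coeff_C]
  split_ifs with he
  · rw [he]; rfl
  · refine coeff_eq_zero_of_hasse _ (fun s => ?_) e he
    have := congrArg (fun b => PowerSeries.coeff N (Weyl.symbol b)) (ha s)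
    simp only [map_zero] at this
    rw [← coeff_pderiv]
    exact this

end PartialDerivatives

/-! ### Every derivation of 𝒟 is (1/h)[a, ·] -/

section Derivations

variable {n : ℕ} {R : Type} [CommRing R]

theorem coeff_mul_X_of_lt {σ : Type} [Fintype σ] [DecidableEq σ] {d : ℕ} (f : MvPowerSeries σ R)
    (hf : ∀ e : σ →₀ ℕ, ∑ i, e i < d → MvPowerSeries.coeff e f = 0) (s : σ) (e : σ →₀ ℕ)
    (he : ∑ i, e i < d + 1) : MvPowerSeries.coeff e (f * MvPowerSeries.X s) = 0 := by
  rw [MvPowerSeries.coeff_mul]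
  refine Finset.sum_eq_zero fun p hp => ?_
  rw [mem_antidiagonal] at hp
  rw [MvPowerSeries.coeff_X]
  split_ifs with h
  · rw [hf p.1, zero_mul]
    rw [← hp, h] at he
    simpa [Finset.sum_add_distrib, Finsupp.single_apply] using he
  · rw [mul_zero]

theorem Weyl.coeff_zero_h_mul (a : Weyl n R) :
    PowerSeries.coeff 0 (Weyl.symbol (Weyl.h * a)) = 0 := by
  rw [Weyl.symbol_h_mul, PowerSeries.coeff_zero_X_mul]

/-- By `Weyl.exists_decomp` an element is ∑ p_j x_j + ∑ q_j y_j modulo constants and h𝒟. Such a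
derivation sends it to ∑ δ(p_j) x_j + ∑ δ(q_j) y_j modulo h, so vanishing of all δ(a) below degree d
in x, y implies vanishing below degree d + 1. -/
theorem derivation_coeff_zero (δ : Weyl n R →ₗ[PowerSeries R] Weyl n R)
    (hδ : ∀ a b, δ (a * b) = δ a * b + a * δ b) (hx : ∀ j, δ (Weyl.x j) = 0)
    (hy : ∀ j, δ (Weyl.y j) = 0) (a : Weyl n R) :
    PowerSeries.coeff 0 (Weyl.symbol (δ a)) = 0 := by
  classical
  suffices h : ∀ (d : ℕ) (a : Weyl n R) (e : Fin n ⊕ Fin n →₀ ℕ), ∑ i, e i < d →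
      MvPowerSeries.coeff e (PowerSeries.coeff 0 (Weyl.symbol (δ a))) = 0 by
    ext e
    rw [h _ a e (Nat.lt_succ_self _), map_zero]
  intro d
  induction d with
  | zero => intro a e he; omega
  | succ d ih =>
    intro a e he
    obtain ⟨p, q, b, hab⟩ := Weyl.exists_decomp a
    have h1 : δ 1 = 0 := by
      have := hδ 1 1
      rwa [mul_one, mul_one, one_mul, left_eq_add] at this
    have hc : δ (algebraMap (PowerSeries R) _ (PowerSeries.C (weylAug n R a))) = 0 := by
      rw [Algebra.algebraMap_eq_smul_one, map_smul, h1, smul_zero]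
    have hh : δ (Weyl.h * b) = Weyl.h * δ b := by
      rw [Weyl.h_mul, Weyl.h_mul, map_smul]
    have hsum : δ a = ∑ j, δ (p j) * Weyl.x j + ∑ j, δ (q j) * Weyl.y j + Weyl.h * δ b := by
      rw [hab]
      simp only [map_add, hc, hh, map_sum, hδ, hx, hy, mul_zero, add_zero, zero_add]
    rw [hsum, map_add Weyl.symbol, map_add (PowerSeries.coeff 0), Weyl.coeff_zero_h_mul, add_zero]
    simp only [map_add, map_sum, Weyl.coeff_zero_mul]
    have hX (s : Fin n ⊕ Fin n) (c : Weyl n R) : MvPowerSeries.coeff e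
        (PowerSeries.coeff 0 (Weyl.symbol (δ c)) * PowerSeries.coeff 0
          (PowerSeries.C (MvPowerSeries.X s : SymbolRing n R))) = 0 := by
      rw [PowerSeries.coeff_zero_C]
      exact coeff_mul_X_of_lt _ (ih c) s e he
    have h3 := Finset.sum_eq_zero fun j (_ : j ∈ Finset.univ) => hX (Sum.inl j) (p j)
    have h4 := Finset.sum_eq_zero fun j (_ : j ∈ Finset.univ) => hX (Sum.inr j) (q j)
    exact (congrArg₂ (· + ·) h3 h4).trans (add_zero 0)

/-- Division by `h` of a linear map with values in `h 𝒟`. -/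
def divHMap (δ : Weyl n R →ₗ[PowerSeries R] Weyl n R)
    (h0 : ∀ a, PowerSeries.coeff 0 (Weyl.symbol (δ a)) = 0) :
    Weyl n R →ₗ[PowerSeries R] Weyl n R where
  toFun a := Weyl.divH (δ a)
  map_add' a b := Weyl.h_mul_cancel (by
    rw [mul_add, Weyl.h_mul_divH _ (h0 _), Weyl.h_mul_divH _ (h0 _), Weyl.h_mul_divH _ (h0 _),
      map_add])
  map_smul' c a := Weyl.h_mul_cancel (by
    rw [RingHom.id_apply, mul_smul_comm, Weyl.h_mul_divH _ (h0 _), Weyl.h_mul_divH _ (h0 _),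
      map_smul])

theorem h_mul_divHMap (δ : Weyl n R →ₗ[PowerSeries R] Weyl n R)
    (h0 : ∀ a, PowerSeries.coeff 0 (Weyl.symbol (δ a)) = 0) (a : Weyl n R) :
    Weyl.h * divHMap δ h0 a = δ a := Weyl.h_mul_divH _ (h0 _)

theorem Weyl.mul_h_mul (a b : Weyl n R) : a * (Weyl.h * b) = Weyl.h * (a * b) := by
  rw [← mul_assoc, ← Weyl.h_comm, mul_assoc]

/-- A derivation of the Weyl algebra that kills the generators vanishes. -/
theorem derivation_eq_zero (δ : Weyl n R →ₗ[PowerSeries R] Weyl n R)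
    (hδ : ∀ a b, δ (a * b) = δ a * b + a * δ b) (hx : ∀ j, δ (Weyl.x j) = 0)
    (hy : ∀ j, δ (Weyl.y j) = 0) (a : Weyl n R) : δ a = 0 := by
  -- The induction on the power of h quantifies over all such derivations: δ takes values in h𝒟, and
  -- δ/h is again a derivation killing the generators.
  suffices h : ∀ (N : ℕ) (δ : Weyl n R →ₗ[PowerSeries R] Weyl n R)
      (_ : ∀ a b, δ (a * b) = δ a * b + a * δ b) (_ : ∀ j, δ (Weyl.x j) = 0)
      (_ : ∀ j, δ (Weyl.y j) = 0) (a : Weyl n R), PowerSeries.coeff N (Weyl.symbol (δ a)) = 0 by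
    apply Weyl.symbol.injective
    ext N : 1
    rw [h N δ hδ hx hy, map_zero, map_zero]
  intro N
  induction N with
  | zero => exact derivation_coeff_zero
  | succ N ih =>
    intro δ hδ hx hy a
    have h0 := derivation_coeff_zero δ hδ hx hy
    have hd := h_mul_divHMap δ h0
    rw [← hd, Weyl.symbol_h_mul, PowerSeries.coeff_succ_X_mul]
    refine ih (divHMap δ h0) (fun a b => Weyl.h_mul_cancel ?_) (fun j => Weyl.h_mul_cancel ?_)
      (fun j => Weyl.h_mul_cancel ?_) a
    · rw [mul_add, hd, hδ, ← Weyl.mul_h_mul a, hd, ← mul_assoc, hd]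
    · rw [hd, hx, mul_zero]
    · rw [hd, hy, mul_zero]

/-- The inner derivation `(1/h) [a, ·]`. -/
def innerDer (a : Weyl n R) : Weyl n R →ₗ[PowerSeries R] Weyl n R :=
  divHMap (LinearMap.mulLeft (PowerSeries R) a - LinearMap.mulRight (PowerSeries R) a) fun b => by
    change PowerSeries.coeff 0 (Weyl.symbol (a * b - b * a)) = 0
    rw [map_sub, map_sub, Weyl.coeff_zero_mul, Weyl.coeff_zero_mul, mul_comm, sub_self]

theorem h_mul_innerDer (a b : Weyl n R) : Weyl.h * innerDer a b = a * b - b * a :=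
  h_mul_divHMap _ _ b

theorem innerDer_mul (a b c : Weyl n R) :
    innerDer a (b * c) = innerDer a b * c + b * innerDer a c := by
  apply Weyl.h_mul_cancel
  rw [mul_add, ← mul_assoc Weyl.h, ← Weyl.mul_h_mul b, h_mul_innerDer, h_mul_innerDer,
    h_mul_innerDer]
  simp only [sub_mul, mul_sub, mul_assoc]
  abel

theorem innerDer_x (a : Weyl n R) (j : Fin n) : innerDer a (Weyl.x j) = Weyl.pd (Sum.inr j) a :=
  Weyl.h_mul_cancel ((h_mul_innerDer _ _).trans (Weyl.commutator_x a j))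

theorem innerDer_y (a : Weyl n R) (j : Fin n) : innerDer a (Weyl.y j) = -Weyl.pd (Sum.inl j) a :=
  Weyl.h_mul_cancel ((h_mul_innerDer _ _).trans
    ((Weyl.commutator_y a j).trans (mul_neg _ _).symm))

/-- Every derivation of the Weyl algebra is of the form `(1/h) [a, ·]`. -/
theorem exists_innerDer (φ : Weyl n ℂ →ₗ[PowerSeries ℂ] Weyl n ℂ)
    (hφ : ∀ a b, φ (a * b) = φ a * b + a * φ b) : ∃ a, ∀ b, φ b = innerDer a b := by
  have h1 : φ 1 = 0 := by
    have := hφ 1 1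
    rwa [mul_one, mul_one, one_mul, left_eq_add] at this
  have hh : φ Weyl.h = 0 := by
    rw [Weyl.h_eq, Algebra.algebraMap_eq_smul_one, map_smul, h1, smul_zero]
  -- If φ kills [a, b], the Leibniz rule reads [φ(a), b] = [φ(b), a]. It is applied to pairs of
  -- generators, whose commutators are 0 or h.
  have hcomm (a b : Weyl n ℂ) (hab : φ (a * b - b * a) = 0) :
      φ a * b - b * φ a = φ b * a - a * φ b := by
    rw [map_sub, hφ, hφ] at hab
    rw [← sub_eq_zero, ← hab]
    abel
  -- To agree with (1/h)[a, ·] on generators one needs ∂a/∂y_j = φ(x_j) and ∂a/∂x_j = -φ(y_j).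
  -- Closedness of this one-form is φ applied to the commutation relations.
  obtain ⟨a, ha⟩ := Weyl.exists_primitive
    (Sum.elim (fun j => -φ (Weyl.y j)) fun j => φ (Weyl.x j)) (by
      have hxx (i j : Fin n) : Weyl.pd (Sum.inr j) (φ (Weyl.x i)) =
          Weyl.pd (Sum.inr i) (φ (Weyl.x j)) := by
        apply Weyl.h_mul_cancel
        rw [← Weyl.commutator_x, ← Weyl.commutator_x]
        exact hcomm _ _ (by rw [Weyl.x_comm, sub_self, map_zero])
      have hyy (i j : Fin n) : Weyl.pd (Sum.inl j) (φ (Weyl.y i)) =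
          Weyl.pd (Sum.inl i) (φ (Weyl.y j)) := by
        apply Weyl.h_mul_cancel
        rw [← neg_inj, ← Weyl.commutator_y, ← Weyl.commutator_y]
        exact hcomm _ _ (by rw [Weyl.y_comm, sub_self, map_zero])
      have hyx (i j : Fin n) : Weyl.pd (Sum.inr j) (-φ (Weyl.y i)) =
          Weyl.pd (Sum.inl i) (φ (Weyl.x j)) := by
        apply Weyl.h_mul_cancel
        rw [Weyl.pd_neg, mul_neg, ← Weyl.commutator_x,
          hcomm _ _ (by rw [Weyl.y_mul_x_sub]; split_ifs <;> simp [hh]), Weyl.commutator_y, neg_neg]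
      rintro (i | i) (j | j)
      · simp only [Sum.elim_inl, Weyl.pd_neg, hyy i j]
      · exact (hyx i j).symm
      · exact hyx j i
      · exact hxx j i)
  refine ⟨a, fun b => sub_eq_zero.1 ?_⟩
  -- The difference is a derivation that kills every generator, so it vanishes.
  refine derivation_eq_zero (φ - innerDer a) (fun b c => ?_) (fun j => ?_) (fun j => ?_) b
  · simp only [LinearMap.sub_apply, hφ, innerDer_mul, sub_mul, mul_sub]
    abel
  · rw [LinearMap.sub_apply, innerDer_x, ha, Sum.elim_inr, sub_self]
  · rw [LinearMap.sub_apply, innerDer_y, ha, Sum.elim_inl, neg_neg, sub_self]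

end Derivations

/-! ### The splitting of Der(𝒟, ℳ_r) -/

section InnerDerivations

variable {n r : ℕ}

/-- Allows identities involving 1/h on the module to be checked after multiplication by h;
`Weyl.h_mul_cancel` does the same on 𝒟. -/
theorem X_smul_module_cancel {R : Type} [CommRing R] {m m' : FormalModule n r R}
    (h : (PowerSeries.X : PowerSeries R) • m = (PowerSeries.X : PowerSeries R) • m') : m = m' :=
  funext fun i => PowerSeries.X_mul_cancel (by
    have := congrFun h i
    rwa [Pi.smul_apply, Pi.smul_apply, X_smul_vac, X_smul_vac] at this)

theorem h_smul {R : Type} [CommRing R] (a : Weyl n R) (m : FormalModule n r R) :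
    (Weyl.h * a) • m = (PowerSeries.X : PowerSeries R) • a • m := by
  rw [Weyl.h_mul, smul_assoc]

/-- Division by `h` on `ℳ_r`. -/
def divX (m : FormalModule n r ℂ) : FormalModule n r ℂ := fun i =>
  PowerSeries.mk fun N => PowerSeries.coeff (N + 1) (m i)

theorem X_smul_divX (m : FormalModule n r ℂ) (hm : ∀ i, PowerSeries.coeff 0 (m i) = 0) :
    (PowerSeries.X : PowerSeries ℂ) • divX m = m := by
  funext i
  rw [Pi.smul_apply, X_smul_vac]
  ext N : 1
  cases N with
  | zero => rw [hm, PowerSeries.coeff_zero_X_mul]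
  | succ N =>
    rw [PowerSeries.coeff_succ_X_mul]
    exact PowerSeries.coeff_mk N _

/-- The operator `(1/h) a` on `ℳ_r`, for `a ∈ 𝒥`. -/
def innerMod (r : ℕ) (α : hInvJ n) : FormalModule n r ℂ →ₗ[PowerSeries ℂ] FormalModule n r ℂ :=
  -- Elements of 𝒥 are those carrying ℳ_1 into hℳ_1, so the division by h is exact.
  have h0 (m : FormalModule n r ℂ) (i : Fin r) :
      PowerSeries.coeff 0 ((HInv.num α.1 • m) i) = 0 := (mem_idealJ_iff _).1 α.2 (m i)
  { toFun := fun m => divX (HInv.num α.1 • m)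
    map_add' := fun m m' => X_smul_module_cancel (by
      rw [X_smul_divX _ (h0 (m + m')), smul_add (PowerSeries.X : PowerSeries ℂ),
        X_smul_divX _ (h0 m), X_smul_divX _ (h0 m'), smul_add])
    map_smul' := fun c m => X_smul_module_cancel (by
      rw [RingHom.id_apply, X_smul_divX _ (h0 (c • m)), smul_comm _ c (divX _),
        X_smul_divX _ (h0 m), smul_comm _ c]) }

theorem X_smul_innerMod (α : hInvJ n) (m : FormalModule n r ℂ) :
    (PowerSeries.X : PowerSeries ℂ) • innerMod r α m = HInv.num α.1 • m :=
  X_smul_divX _ fun i => (mem_idealJ_iff _).1 α.2 (m i)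

theorem innerMod_smul (α : hInvJ n) (a : Weyl n ℂ) (m : FormalModule n r ℂ) :
    innerMod r α (a • m) = innerDer (HInv.num α.1) a • m + a • innerMod r α m := by
  apply X_smul_module_cancel
  rw [smul_add, X_smul_innerMod, ← h_smul, h_mul_innerDer, ← smul_comm a (PowerSeries.X : PowerSeries ℂ), X_smul_innerMod,
    sub_smul, mul_smul, mul_smul, sub_add_cancel]

/-- The pair `((1/h) [a, ·], (1/h) a)`. -/
def inner (r : ℕ) (α : hInvJ n) : PairDer n r :=
  ⟨(innerDer (HInv.num α.1), innerMod r α), innerDer_mul _, innerMod_smul α⟩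

theorem inner_alg (α : hInvJ n) (b : Weyl n ℂ) :
    Weyl.h * (inner r α).alg b = HInv.num α.1 * b - b * HInv.num α.1 := h_mul_innerDer _ b

theorem inner_mod (α : hInvJ n) (m : FormalModule n r ℂ) :
    (PowerSeries.X : PowerSeries ℂ) • (inner r α).mod m = HInv.num α.1 • m := X_smul_innerMod α m

theorem isInner_iff (X : PairDer n r) (α : hInvJ n) : X.IsInner α ↔ X = inner r α :=
  ⟨fun h => PairDer.ext (fun a => Weyl.h_mul_cancel ((h.1 a).trans (inner_alg α a).symm))
    fun m => X_smul_module_cancel ((h.2 m).trans (inner_mod α m).symm),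
    fun h => h ▸ ⟨inner_alg α, inner_mod α⟩⟩

theorem PairDer.alg_add (X Y : PairDer n r) (a : Weyl n ℂ) :
    (X + Y).alg a = X.alg a + Y.alg a := rfl

theorem PairDer.mod_add (X Y : PairDer n r) (m : FormalModule n r ℂ) :
    (X + Y).mod m = X.mod m + Y.mod m := rfl

theorem PairDer.alg_sub (X Y : PairDer n r) (a : Weyl n ℂ) :
    (X - Y).alg a = X.alg a - Y.alg a := rfl

theorem PairDer.mod_sub (X Y : PairDer n r) (m : FormalModule n r ℂ) :
    (X - Y).mod m = X.mod m - Y.mod m := rfl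

theorem PairDer.alg_smul (c : ℂ) (X : PairDer n r) (a : Weyl n ℂ) :
    (c • X).alg a = c • X.alg a := rfl

theorem PairDer.mod_smul (c : ℂ) (X : PairDer n r) (m : FormalModule n r ℂ) :
    (c • X).mod m = c • X.mod m := rfl

theorem PairDer.mod_weyl_smul (X : PairDer n r) (a : Weyl n ℂ) (m : FormalModule n r ℂ) :
    X.mod (a • m) = X.alg a • m + a • X.mod m := X.2.2 a m

theorem PairDer.alg_h_mul (X : PairDer n r) (a : Weyl n ℂ) :
    X.alg (Weyl.h * a) = Weyl.h * X.alg a := by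
  rw [Weyl.h_mul, Weyl.h_mul, map_smul]

theorem num_coe_add (α β : hInvJ n) :
    HInv.num (α + β : hInvJ n).1 = HInv.num α.1 + HInv.num β.1 := rfl

theorem num_coe_smul (c : ℂ) (α : hInvJ n) :
    HInv.num (c • α : hInvJ n).1 = (PowerSeries.C c : PowerSeries ℂ) • HInv.num α.1 := by
  rw [C_smul_eq]
  rfl

/-- The map `(1/h) 𝒥 → Der(𝒟, ℳ_r)`. -/
def innerLie (n r : ℕ) : hInvJ n →ₗ⁅ℂ⁆ PairDer n r where
  toFun := inner r
  map_add' α β := ((isInner_iff _ _).1 ⟨fun b => by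
      rw [PairDer.alg_add, mul_add, inner_alg, inner_alg, num_coe_add, add_mul,
        mul_add]
      abel, fun m => by
      rw [PairDer.mod_add, smul_add, inner_mod, inner_mod, num_coe_add, add_smul]⟩).symm
  map_smul' c α := ((isInner_iff _ _).1 ⟨fun b => by
      rw [RingHom.id_apply, PairDer.alg_smul, ← C_smul_eq, mul_smul_comm, inner_alg,
        num_coe_smul, smul_mul_assoc, mul_smul_comm, smul_sub],
      fun m => by
      rw [RingHom.id_apply, PairDer.mod_smul, ← C_smul_eq, smul_comm, inner_mod,
        num_coe_smul, smul_assoc]⟩).symm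
  -- Two factors 1/h occur in the bracket, so both components are compared after multiplication by
  -- h².
  map_lie' {α β} := ((isInner_iff _ _).1 ⟨fun c => Weyl.h_mul_cancel (by
      have h1 (α β : hInvJ n) : Weyl.h * (Weyl.h * (inner r α).alg ((inner r β).alg c)) =
          HInv.num α.1 * (HInv.num β.1 * c - c * HInv.num β.1) -
            (HInv.num β.1 * c - c * HInv.num β.1) * HInv.num α.1 := by
        rw [← PairDer.alg_h_mul, inner_alg, inner_alg]
      rw [PairDer.lie_alg, mul_sub Weyl.h, mul_sub Weyl.h, h1, h1, LieSubalgebra.coe_bracket,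
        mul_sub Weyl.h, ← mul_assoc Weyl.h, ← Weyl.mul_h_mul, HInv.h_mul_num_lie]
      simp only [sub_mul, mul_sub, mul_assoc]
      abel),
    fun m => X_smul_module_cancel (by
      have h1 (α β : hInvJ n) : (PowerSeries.X : PowerSeries ℂ) • (PowerSeries.X : PowerSeries ℂ) •
          (inner r α).mod ((inner r β).mod m) = (HInv.num α.1 * HInv.num β.1) • m := by
        rw [← map_smul (inner r α).mod, inner_mod, inner_mod, mul_smul]
      rw [PairDer.lie_mod, smul_sub, smul_sub, h1, h1, LieSubalgebra.coe_bracket, ← h_smul,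
        HInv.h_mul_num_lie, sub_smul])⟩).symm

theorem innerLie_apply (α : hInvJ n) : innerLie n r α = inner r α := rfl

/-- The map `𝔤𝔩_h(r) → Der(𝒟, ℳ_r)`. -/
def matDer (n r : ℕ) : GlH r →ₗ⁅ℂ⁆ PairDer n r where
  toFun A := ⟨(0, matAct n r ℂ A), fun a b => by simp, fun a m => by
    rw [LinearMap.zero_apply, zero_smul, zero_add]
    exact matAct_smul A a m⟩
  map_add' A B := PairDer.ext (fun a => (add_zero 0).symm) fun m => by
    rw [PairDer.mod_add]
    exact LinearMap.congr_fun (map_add (matAct n r ℂ) A B) m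
  map_smul' c A := PairDer.ext (fun a => (smul_zero c).symm) fun m => by
    rw [PairDer.mod_smul]
    funext i
    change ∑ j, (c • A i j) • m j = c • ∑ j, A i j • m j
    rw [Finset.smul_sum]
    exact Finset.sum_congr rfl fun j _ => smul_assoc c (A i j) (m j)
  map_lie' {A B} := PairDer.ext (fun a => by rw [PairDer.lie_alg]; exact (sub_zero 0).symm)
    fun m => by
      rw [PairDer.lie_mod]
      change matAct n r ℂ (A * B - B * A) m = _
      rw [map_sub, map_mul, map_mul]
      rfl

theorem matDer_alg (A : GlH r) (a : Weyl n ℂ) : (matDer n r A).alg a = 0 := rfl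

theorem matDer_mod (A : GlH r) (m : FormalModule n r ℂ) :
    (matDer n r A).mod m = matAct n r ℂ A m := rfl

theorem isMatrix_der_iff (X : PairDer n r) (A : GlH r) : X.IsMatrix A ↔ X = matDer n r A :=
  ⟨fun h => PairDer.ext h.1 fun m => funext fun i => h.2 m i, fun h => h ▸ ⟨fun _ => rfl,
    fun _ _ => rfl⟩⟩

theorem matDer_injective : Function.Injective (matDer n r) := fun A B h =>
  matAct_injective (n := n) (LinearMap.ext fun m => by rw [← matDer_mod, ← matDer_mod, h])

theorem mod_inner_matAct (α : hInvJ n) (A : GlH r) (m : FormalModule n r ℂ) :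
    (inner r α).mod (matAct n r ℂ A m) = matAct n r ℂ A ((inner r α).mod m) := by
  apply X_smul_module_cancel
  rw [inner_mod, ← map_smul (matAct n r ℂ A) PowerSeries.X, inner_mod, matAct_smul]

/-- Matrices over ℂ⟦h⟧ are 𝒟-linear, and hence commute with (1/h)a once the denominator is cleared.
-/
theorem lie_inner_matDer (α : hInvJ n) (A : GlH r) : ⁅inner r α, matDer n r A⁆ = 0 :=
  PairDer.ext (fun a => by
    rw [PairDer.lie_alg, matDer_alg, matDer_alg, map_zero, sub_zero]
    rfl) fun m => by
    rw [PairDer.lie_mod, matDer_mod, matDer_mod, mod_inner_matAct, sub_self]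
    rfl

/-- The element `c = (1/h) (c h)` of `(1/h) 𝒥`, for `c ∈ ℂ⟦h⟧`. -/
def scalarJ (n : ℕ) (c : PowerSeries ℂ) : hInvJ n :=
  ⟨HInv.mk (c • Weyl.h), by
    change c • (Weyl.h : Weyl n ℂ) ∈ idealJ n ℂ
    rw [Algebra.smul_def]
    exact TwoSidedIdeal.mul_mem_left _ _ _ (TwoSidedIdeal.subset_span (Or.inr rfl))⟩

theorem num_scalarJ (c : PowerSeries ℂ) : HInv.num (scalarJ n c).1 = c • Weyl.h := rfl

/-- The element ch is central, so its inner derivation is zero and only multiplication by c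
survives. The subspaces (1/h)𝒥 and 𝔤𝔩_h(r) thus share the scalars ℂ⟦h⟧, which is why a direct sum
needs traceless matrices; this is the infinitesimal form of `diagAut_matAut_scalar`. -/
theorem inner_scalarJ (c : PowerSeries ℂ) :
    inner r (scalarJ n c) = matDer n r (Matrix.scalar (Fin r) c) := by
  refine ((isInner_iff _ _).1 ⟨fun b => ?_, fun m => ?_⟩).symm
  · rw [matDer_alg, mul_zero, num_scalarJ, smul_mul_assoc, mul_smul_comm, Weyl.h_comm, sub_self]
  · rw [matDer_mod, matAct_scalar, num_scalarJ, smul_assoc, smul_comm, Weyl.h_eq, algebraMap_smul]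

/-- The traceless part of a matrix. -/
def traceless (r : ℕ) : GlH r →ₗ[ℂ] GlH r :=
  LinearMap.id - (Matrix.scalarAlgHom (Fin r) ℂ).toLinearMap ∘ₗ
    ((r : ℂ)⁻¹ • (Matrix.traceLinearMap (Fin r) ℂ (PowerSeries ℂ)))

theorem traceless_apply (A : GlH r) :
    traceless r A = A - Matrix.scalar (Fin r) ((r : ℂ)⁻¹ • A.trace) := rfl

theorem traceless_of_trace_eq_zero (A : GlH r) (hA : A.trace = 0) : traceless r A = A := by
  rw [traceless_apply, hA, smul_zero, map_zero, sub_zero]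

theorem trace_scalar (c : PowerSeries ℂ) : (Matrix.scalar (Fin r) c).trace = (r : ℂ) • c := by
  rw [Matrix.scalar_apply, Matrix.trace_diagonal, Finset.sum_const, Finset.card_univ,
    Fintype.card_fin, Nat.cast_smul_eq_nsmul]

theorem trace_traceless (hr : 1 ≤ r) (A : GlH r) : (traceless r A).trace = 0 := by
  rw [traceless_apply, Matrix.trace_sub, trace_scalar, smul_smul,
    mul_inv_cancel₀ (Nat.cast_ne_zero.2 (by omega)), one_smul, sub_self]

theorem traceless_scalar (hr : 1 ≤ r) (c : PowerSeries ℂ) :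
    traceless r (Matrix.scalar (Fin r) c) = 0 := by
  rw [traceless_apply, trace_scalar, smul_smul,
    inv_mul_cancel₀ (Nat.cast_ne_zero.2 (by omega)), one_smul, sub_self]

theorem trace_lie (A B : GlH r) : (⁅A, B⁆ : GlH r).trace = 0 := by
  rw [LieRing.of_associative_ring_bracket, Matrix.trace_sub, Matrix.trace_mul_comm, sub_self]

theorem lie_scalar (c : PowerSeries ℂ) (A : GlH r) : ⁅A, Matrix.scalar (Fin r) c⁆ = 0 := by
  rw [LieRing.of_associative_ring_bracket, sub_eq_zero]
  exact ((Matrix.scalar_commute c (fun d => mul_comm c d) A).eq).symm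

theorem scalar_lie (c : PowerSeries ℂ) (A : GlH r) : ⁅Matrix.scalar (Fin r) c, A⁆ = 0 := by
  rw [← lie_skew, lie_scalar, neg_zero]

/-- A commutator is traceless already, and the scalar parts that are removed are central. -/
theorem traceless_lie (A B : GlH r) : traceless r ⁅A, B⁆ = ⁅traceless r A, traceless r B⁆ := by
  rw [traceless_of_trace_eq_zero _ (trace_lie A B), traceless_apply, traceless_apply, sub_lie,
    lie_sub, lie_sub, lie_scalar, scalar_lie, scalar_lie, sub_zero, sub_zero, sub_zero]

/-- The splitting `𝔭𝔤𝔩_h(r) → 𝔤𝔩_h(r)` by traceless matrices. -/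
def pglSection (hr : 1 ≤ r) : PglH r →ₗ⁅ℂ⁆ GlH r where
  __ := Submodule.liftQ (scalarGlH r).toSubmodule (traceless r) (by
    rintro A ⟨c, rfl⟩
    exact traceless_scalar hr c)
  map_lie' {x y} := by
    obtain ⟨A, rfl⟩ := LieSubmodule.Quotient.surjective_mk' _ x
    obtain ⟨B, rfl⟩ := LieSubmodule.Quotient.surjective_mk' _ y
    exact traceless_lie A B

theorem pglSection_mk (hr : 1 ≤ r) (A : GlH r) :
    pglSection hr (LieSubmodule.Quotient.mk' (scalarGlH r) A) = traceless r A := rfl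

theorem mk_pglSection (hr : 1 ≤ r) (x : PglH r) :
    LieSubmodule.Quotient.mk' (scalarGlH r) (pglSection hr x) = x := by
  obtain ⟨A, rfl⟩ := LieSubmodule.Quotient.surjective_mk' _ x
  rw [pglSection_mk, ← sub_eq_zero, ← map_sub, LieSubmodule.Quotient.mk_eq_zero]
  exact ⟨-((r : ℂ)⁻¹ • A.trace), by rw [traceless_apply, map_neg, sub_sub_cancel_left]⟩

theorem trace_pglSection (hr : 1 ≤ r) (x : PglH r) : (pglSection hr x).trace = 0 := by
  obtain ⟨A, rfl⟩ := LieSubmodule.Quotient.surjective_mk' _ x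
  exact trace_traceless hr A

/-- The map `(1/h) 𝒥 ⊕ 𝔭𝔤𝔩_h(r) → Der(𝒟, ℳ_r)`. -/
def splitDer (n : ℕ) (hr : 1 ≤ r) : hInvJ n × PglH r →ₗ⁅ℂ⁆ PairDer n r where
  __ := (innerLie n r : hInvJ n →ₗ[ℂ] PairDer n r).coprod
    ((matDer n r : GlH r →ₗ[ℂ] PairDer n r) ∘ₗ (pglSection hr : PglH r →ₗ[ℂ] GlH r))
  map_lie' {x y} := by
    change innerLie n r ⁅x.1, y.1⁆ + matDer n r (pglSection hr ⁅x.2, y.2⁆) =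
      ⁅innerLie n r x.1 + matDer n r (pglSection hr x.2),
        innerLie n r y.1 + matDer n r (pglSection hr y.2)⁆
    -- Both cross brackets vanish because inner elements commute with matrices.
    rw [LieHom.map_lie, LieHom.map_lie, LieHom.map_lie, add_lie, lie_add, lie_add, innerLie_apply,
      innerLie_apply, lie_inner_matDer, ← lie_skew (matDer n r _) (inner r y.1), lie_inner_matDer,
      neg_zero, add_zero, zero_add]

theorem splitDer_apply (hr : 1 ≤ r) (x : hInvJ n × PglH r) :
    splitDer n hr x = inner r x.1 + matDer n r (pglSection hr x.2) := rfl

/-- Vanishing on 𝒟 makes a = hα central, so a is a series c in h. Vanishing on ℳ_r, multiplied by h,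
then says c + hA = 0 as matrices; the trace of the traceless A drops out, leaving rc = 0. -/
theorem splitDer_injective (hr : 1 ≤ r) : Function.Injective (splitDer n hr) := by
  rw [injective_iff_map_eq_zero]
  rintro ⟨α, x⟩ h
  rw [splitDer_apply] at h
  have halg (b : Weyl n ℂ) : innerDer (HInv.num α.1) b = 0 :=
    (add_zero _).symm.trans (congrArg (fun X : PairDer n r => X.alg b) h)
  obtain ⟨c, hc⟩ := Weyl.eq_algebraMap_of_pd (HInv.num α.1) (by
    rintro (j | j)
    · rw [← neg_eq_zero, ← innerDer_y, halg]
    · rw [← innerDer_x, halg])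
  have hmod (m : FormalModule n r ℂ) :
      (inner r α).mod m + matAct n r ℂ (pglSection hr x) m = 0 :=
    congrArg (fun X : PairDer n r => X.mod m) h
  have hA : Matrix.scalar (Fin r) c + (PowerSeries.X : PowerSeries ℂ) • pglSection hr x = 0 := by
    refine matAct_injective (n := n) (LinearMap.ext fun m => ?_)
    rw [map_add, map_zero, LinearMap.add_apply, LinearMap.zero_apply, matAct_scalar,
      ← algebraMap_smul (Weyl n ℂ) c m, ← hc, ← inner_mod,
      ← smul_zero (PowerSeries.X : PowerSeries ℂ), ← hmod m, smul_add]
    congr 1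
    funext i
    rw [matAct_apply, Pi.smul_apply, matAct_apply, Finset.smul_sum]
    exact Finset.sum_congr rfl fun j _ => mul_smul PowerSeries.X (pglSection hr x i j) (m j)
  have hc0 : c = 0 := by
    have := congrArg Matrix.trace hA
    rw [Matrix.trace_add, Matrix.trace_smul, trace_pglSection, smul_zero, add_zero, trace_scalar,
      Matrix.trace_zero] at this
    exact (smul_eq_zero.1 this).resolve_left (Nat.cast_ne_zero.2 (by omega))
  have hα : α = 0 := Subtype.ext (HInv.num.injective (by
    rw [hc, hc0, map_zero]
    exact (map_zero HInv.num).symm))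
  have hx : pglSection hr x = 0 := by
    subst hα
    refine matDer_injective (n := n) ?_
    rw [map_zero, ← h, ← innerLie_apply, map_zero, zero_add]
  rw [hα, ← mk_pglSection hr x, hx, map_zero]
  rfl

/-- Every element of `Der(𝒟, ℳ_r)` is the sum of an inner one and a matrix. -/
theorem exists_inner_add_matDer (hr : 1 ≤ r) (X : PairDer n r) :
    ∃ (α : hInvJ n) (A : GlH r), X = inner r α + matDer n r A := by
  obtain ⟨a, ha⟩ := exists_innerDer X.alg X.2.1
  -- The operator hψ - a is 𝒟-linear, since φ = (1/h)[a, ·]; hence it is a matrix B.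
  let f : Module.End (PowerSeries ℂ) (FormalModule n r ℂ) :=
    { toFun := fun m => (PowerSeries.X : PowerSeries ℂ) • X.mod m - a • m
      map_add' := fun m m' => by
        rw [map_add, smul_add, smul_add]
        abel
      map_smul' := fun c m => by
        rw [map_smul, RingHom.id_apply, smul_sub, smul_comm _ c, smul_comm a c] }
  have hf (m : FormalModule n r ℂ) : f m = (PowerSeries.X : PowerSeries ℂ) • X.mod m - a • m := rfl
  obtain ⟨B, hB⟩ := exists_matAct f fun b m => by
    rw [hf, hf, X.mod_weyl_smul, ha, smul_add, ← h_smul, h_mul_innerDer, sub_smul, mul_smul,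
      mul_smul, smul_sub, smul_comm b (PowerSeries.X : PowerSeries ℂ)]
    abel
  let i₀ : Fin r := ⟨0, hr⟩
  -- The element a is determined only up to ℂ⟦h⟧. The diagonal entry of hψ - a = B at i₀ shows that
  -- a + B i₀ i₀ carries ℳ_1 into hℳ_1, which is membership in 𝒥.
  have haJ : a + algebraMap _ _ (B i₀ i₀) ∈ idealJ n ℂ := by
    rw [mem_idealJ_iff]
    intro m
    have h1 := congrFun (LinearMap.congr_fun hB (Pi.single i₀ m)) i₀
    rw [hf, matAct_apply, Finset.sum_eq_single i₀ (fun j _ hj => by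
      rw [Pi.single_eq_of_ne hj, smul_zero]) (by simp), Pi.sub_apply, Pi.smul_apply, Pi.smul_apply,
      Pi.single_eq_same, sub_eq_iff_eq_add, add_comm] at h1
    rw [add_smul, algebraMap_smul, ← h1, X_smul_vac, PowerSeries.coeff_zero_X_mul]
  refine ⟨⟨HInv.mk (a + algebraMap _ _ (B i₀ i₀)), haJ⟩, ?_⟩
  set α : hInvJ n := ⟨HInv.mk (a + algebraMap _ _ (B i₀ i₀)), haJ⟩ with hα
  have halg (b : Weyl n ℂ) : X.alg b = (inner r α).alg b := by
    apply Weyl.h_mul_cancel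
    rw [ha, h_mul_innerDer, inner_alg]
    change _ = (a + algebraMap _ _ (B i₀ i₀)) * b - b * (a + algebraMap _ _ (B i₀ i₀))
    rw [add_mul, mul_add, Algebra.commutes]
    abel
  obtain ⟨A, hA⟩ := exists_matAct (X - inner r α).mod fun b m => by
    rw [PairDer.mod_weyl_smul, PairDer.alg_sub, halg, sub_self, zero_smul, zero_add]
  refine ⟨A, PairDer.ext (fun b => ?_) fun m => ?_⟩
  · rw [PairDer.alg_add, matDer_alg, add_zero, halg]
  · rw [PairDer.mod_add, matDer_mod, ← hA, PairDer.mod_sub, add_sub_cancel]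

theorem splitDer_surjective (hr : 1 ≤ r) : Function.Surjective (splitDer n hr) := by
  intro X
  obtain ⟨α, A, rfl⟩ := exists_inner_add_matDer hr X
  -- The scalar part tr(A)/r of the matrix is transferred to the inner component through
  -- `inner_scalarJ`.
  refine ⟨(α + scalarJ n ((r : ℂ)⁻¹ • A.trace), LieSubmodule.Quotient.mk' (scalarGlH r) A), ?_⟩
  rw [splitDer_apply, pglSection_mk, ← innerLie_apply, map_add, innerLie_apply, innerLie_apply,
    inner_scalarJ, add_assoc, ← map_add, traceless_apply, add_sub_cancel]

/-- The isomorphism `Der(𝒟, ℳ_r) ≃ (1/h) 𝒥 ⊕ 𝔭𝔤𝔩_h(r)`. -/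
def splitLie (n : ℕ) (hr : 1 ≤ r) : PairDer n r ≃ₗ⁅ℂ⁆ hInvJ n × PglH r :=
  (LieEquiv.ofBijective (splitDer n hr) ⟨splitDer_injective hr, splitDer_surjective hr⟩).symm

theorem splitLie_symm (hr : 1 ≤ r) (x : hInvJ n × PglH r) :
    (splitLie n hr).symm x = inner r x.1 + matDer n r (pglSection hr x.2) := rfl

theorem splitLie_inner_add_matDer (hr : 1 ≤ r) (α : hInvJ n) (A : GlH r) (hA : A.trace = 0) :
    splitLie n hr (inner r α + matDer n r A) =
      (α, LieSubmodule.Quotient.mk' (scalarGlH r) A) := by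
  rw [← LieEquiv.apply_symm_apply (splitLie n hr) (α, LieSubmodule.Quotient.mk' (scalarGlH r) A),
    splitLie_symm, pglSection_mk, traceless_of_trace_eq_zero A hA]

theorem exists_inner_add_traceless (hr : 1 ≤ r) (X : PairDer n r) :
    ∃ (α : hInvJ n) (A : GlH r), A.trace = 0 ∧ X = inner r α + matDer n r A := by
  obtain ⟨⟨α, x⟩, rfl⟩ := splitDer_surjective hr X
  exact ⟨α, pglSection hr x, trace_pglSection hr x, rfl⟩

end InnerDerivations

/-! ### Compatibility of the constructions with base change -/

section BaseChange

variable {n r : ℕ} {R S : Type} [CommRing R] [CommRing S]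

theorem PairAut.BaseChange.mul {ρ : R →+* S} {p q : PairAut n r R} {p' q' : PairAut n r S}
    (hp : PairAut.BaseChange ρ p p') (hq : PairAut.BaseChange ρ q q') :
    PairAut.BaseChange ρ (p * q) (p' * q') := by
  refine ⟨fun a => ?_, fun m => ?_⟩
  · rw [PairAut.alg_mul, PairAut.alg_mul, AlgEquiv.mul_apply, AlgEquiv.mul_apply, hq.1, hp.1]
  · rw [PairAut.mod_mul, PairAut.mod_mul, hq.2, hp.2]

theorem map_smul_vac (ρ : R →+* S) (c : PowerSeries R) (m : Vac n R) :
    PowerSeries.map (MvPowerSeries.map (σ := Fin n) ρ) (c • m) =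
      PowerSeries.map ρ c • PowerSeries.map (MvPowerSeries.map (σ := Fin n) ρ) m := by
  have h1 (R : Type) [CommRing R] (c : PowerSeries R) (m : Vac n R) :
    c • m = PowerSeries.map (algebraMap R (FunRing n R)) c * m := rfl
  rw [h1, h1, map_mul]
  congr 1
  ext N : 1
  simp only [PowerSeries.coeff_map]
  exact MvPowerSeries.map_C _ _

theorem formalModule_map_add (ρ : R →+* S) (m m' : FormalModule n r R) :
    FormalModule.map ρ (m + m') = FormalModule.map ρ m + FormalModule.map ρ m' :=
  funext fun _ => map_add _ _ _

theorem formalModule_map_single (ρ : R →+* S) (i : Fin r) (w : Vac n R) :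
    FormalModule.map ρ (Pi.single i w) =
      Pi.single i (PowerSeries.map (MvPowerSeries.map (σ := Fin n) ρ) w) := by
  funext j
  change PowerSeries.map (MvPowerSeries.map ρ) ((Pi.single i w : FormalModule n r R) j) = _
  rw [Pi.single_apply, Pi.single_apply, apply_ite (PowerSeries.map (MvPowerSeries.map ρ)), map_zero]

theorem formalModule_map_single_one (ρ : R →+* S) (i : Fin r) :
    FormalModule.map ρ (Pi.single i 1 : FormalModule n r R) = Pi.single i 1 := by
  rw [formalModule_map_single, map_one]

theorem formalModule_map_matAct (ρ : R →+* S) (A : Matrix (Fin r) (Fin r) (PowerSeries R))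
    (m : FormalModule n r R) : FormalModule.map ρ (matAct n r R A m) =
      matAct n r S (A.map (PowerSeries.map ρ)) (FormalModule.map ρ m) := by
  funext i
  change PowerSeries.map (MvPowerSeries.map ρ) (∑ j, A i j • m j) = _
  rw [map_sum]
  exact Finset.sum_congr rfl fun j _ => map_smul_vac ρ _ _

theorem baseChange_matAut (ρ : R →+* S) (g : GL (Fin r) (PowerSeries R)) :
    PairAut.BaseChange ρ (matAut n r R g)
      (matAut n r S (Matrix.GeneralLinearGroup.map (PowerSeries.map ρ) g)) := by
  refine ⟨fun a => ?_, fun m => ?_⟩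
  · rw [matAut_alg, matAut_alg, AlgEquiv.one_apply, AlgEquiv.one_apply]
  · rw [matAut_mod, matAut_mod, formalModule_map_matAct]
    rfl

theorem PairAut.BaseChange.vac {ρ : R →+* S} {q : PairAut n 1 R} {q' : PairAut n 1 S}
    (h : PairAut.BaseChange ρ q q') (m : Vac n R) :
    q'.vac (PowerSeries.map (MvPowerSeries.map ρ) m) =
      PowerSeries.map (MvPowerSeries.map ρ) (q.vac m) :=
  congrFun (h.2 fun _ => m) 0

theorem baseChange_of_vac {ρ : R →+* S} {q : PairAut n 1 R} {q' : PairAut n 1 S}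
    (h1 : ∀ a, q'.alg (Weyl.map ρ a) = Weyl.map ρ (q.alg a))
    (h2 : ∀ m, q'.vac (PowerSeries.map (MvPowerSeries.map ρ) m) =
      PowerSeries.map (MvPowerSeries.map ρ) (q.vac m)) : PairAut.BaseChange ρ q q' :=
  ⟨h1, fun m => funext fun i => by
    rw [PairAut.mod_eq_vac]
    refine (h2 (m 0)).trans ?_
    rw [← PairAut.mod_eq_vac q m i]
    rfl⟩

theorem PairAut.BaseChange.diagAut {ρ : R →+* S} {q : PairAut n 1 R} {q' : PairAut n 1 S}
    (h : PairAut.BaseChange ρ q q') :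
    PairAut.BaseChange ρ (diagAut n r R q) (diagAut n r S q') := by
  refine ⟨fun a => ?_, fun m => funext fun i => ?_⟩
  · rw [diagAut_alg, diagAut_alg, h.1]
  · rw [diagAut_mod]
    refine (h.vac (m i)).trans ?_
    rw [← diagAut_mod]
    rfl

theorem PairAut.BaseChange.evGL {ρ : R →+* S} {p : PairAut n r R} {p' : PairAut n r S}
    (h : PairAut.BaseChange ρ p p') :
    evGL n r S p' = Matrix.GeneralLinearGroup.map ρ (evGL n r R p) := by
  ext i j
  rw [evGL_apply, ← formalModule_map_single_one ρ, h.2]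
  exact MvPowerSeries.constantCoeff_map ρ _

/-- An automorphism sending each basis vector to a fixed multiple of itself is diagonal. -/
theorem exists_eq_diagAut (hr : 1 ≤ r) (p : PairAut n r R) (w : Vac n R)
    (hp : ∀ i, p.mod (Pi.single i 1) = Pi.single i w) : ∃ q, p = diagAut n r R q := by
  let i₀ : Fin r := ⟨0, hr⟩
  have hw (j : Fin n) : p.alg (Weyl.y j) • w = 0 := by
    have h := p.mod_smul (Weyl.y j) (Pi.single i₀ 1)
    rw [y_smul_single, map_zero, hp] at h
    have h1 := congrFun h i₀
    rw [Pi.smul_apply, Pi.single_eq_same] at h1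
    exact h1.symm
  -- The common image w of the vacuum vectors makes each coordinate of Ψ the same twisted map.
  have hf (m : FormalModule n r R) (i : Fin r) : p.mod m i = twistMap p.alg w hw (m i) := by
    rw [p.mod_apply_eq_sum, Finset.sum_eq_single i]
    · rw [hp, Pi.single_eq_same]
      rfl
    · intro j _ hj
      rw [hp, Pi.single_eq_of_ne hj.symm, smul_zero]
    · simp
  have hbij : Function.Bijective (twistMap p.alg w hw) := by
    constructor
    · intro m m' h
      have h1 : p.mod (fun _ => m) = p.mod fun _ => m' := funext fun i => by
        rw [hf, hf, h]
      exact congrFun (p.mod.injective h1) i₀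
    · intro v
      obtain ⟨m, hm⟩ := p.mod.surjective fun _ => v
      exact ⟨m i₀, by rw [← hf, hm]⟩
  refine ⟨PairAut.ofVac p.alg (LinearEquiv.ofBijective _ hbij) p.weylAug_alg
    (twistMap_smul p.alg w hw), PairAut.ext rfl fun m => funext fun i => ?_⟩
  rw [hf, diagAut_mod]
  rfl

/-- Removing the base-changed matrix from p' leaves a base change of diag(q). It sends every basis
vector to the same multiple of itself, namely the base change of Ψ(1), and so is itself diagonal.
Thus p' inherits its factorization from p. -/
theorem exists_baseChange_diagAut (hr : 1 ≤ r) {ρ : R →+* S} {q : PairAut n 1 R}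
    {g : GL (Fin r) (PowerSeries R)} {p' : PairAut n r S}
    (h : PairAut.BaseChange ρ (diagAut n r R q * matAut n r R g) p') :
    ∃ q', PairAut.BaseChange ρ q q' ∧ p' = diagAut n r S q' *
      matAut n r S (Matrix.GeneralLinearGroup.map (PowerSeries.map ρ) g) := by
  have h1 := h.mul (baseChange_matAut (n := n) ρ g⁻¹)
  rw [mul_assoc, ← map_mul, mul_inv_cancel, map_one, mul_one] at h1
  obtain ⟨q', hq'⟩ := exists_eq_diagAut hr _
    (PowerSeries.map (MvPowerSeries.map (σ := Fin n) ρ) (q.vac 1)) fun i => by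
    rw [← formalModule_map_single_one ρ, h1.2, ← formalModule_map_single]
    congr 1
    funext j
    rw [diagAut_mod]
    by_cases hj : j = i
    · subst hj
      rw [Pi.single_eq_same, Pi.single_eq_same]
    · rw [Pi.single_eq_of_ne hj, Pi.single_eq_of_ne hj, map_zero]
  rw [hq'] at h1
  refine ⟨q', baseChange_of_vac (fun a => ?_) fun m => ?_, ?_⟩
  · exact h1.1 a
  · exact congrFun (h1.2 fun _ => m) ⟨0, hr⟩
  · rw [← hq', mul_assoc, ← map_mul, map_inv, inv_mul_cancel, map_one, mul_one]

end BaseChange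

/-! ### The group isomorphisms -/

section Splitting

open scoped MatrixGroups

variable {n r : ℕ} {R : Type} [CommRing R]

theorem map_constantCoeff_constGL (g : GL (Fin r) R) :
    Matrix.GeneralLinearGroup.map (PowerSeries.constantCoeff (R := R)) (constGL r R g) = g := by
  ext i j
  exact PowerSeries.constantCoeff_C _

theorem constGL_scalar (c : Rˣ) :
    constGL r R (Matrix.GeneralLinearGroup.scalar (Fin r) c) =
      Matrix.GeneralLinearGroup.scalar (Fin r) (constUnit R c) :=
  Matrix.GeneralLinearGroup.map_scalar _ c

theorem map_constGL {S : Type} [CommRing S] (ρ : R →+* S) (g : GL (Fin r) R) :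
    Matrix.GeneralLinearGroup.map (PowerSeries.map ρ) (constGL r R g) =
      constGL r S (Matrix.GeneralLinearGroup.map ρ g) :=
  Units.ext (Matrix.ext fun _ _ => PowerSeries.map_C ρ _)

theorem toPGL_apply (x : SemiGL r R) : SemiGL.toPGL r R x =
    (x.left : PGL(r, PowerSeries R)) * Matrix.ProjGenLinGroup.mk (constGL r R x.right) := rfl

/-- The semidirect product embeds in PGL_h(r) × GL(r) by the multiplication map and the projection.
-/
theorem semiGL_ext {x y : SemiGL r R} (h1 : SemiGL.toPGL r R x = SemiGL.toPGL r R y)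
    (h2 : x.right = y.right) : x = y := by
  refine SemidirectProduct.ext (Subtype.ext ?_) h2
  rw [toPGL_apply, toPGL_apply, h2] at h1
  exact mul_right_cancel h1

theorem scalar_eq_one (hr : 1 ≤ r) {c : Rˣ}
    (hc : Matrix.GeneralLinearGroup.scalar (Fin r) c = 1) : c = 1 := by
  let i₀ : Fin r := ⟨0, hr⟩
  have := congrArg (fun g : GL (Fin r) R => (g : Matrix (Fin r) (Fin r) R) i₀ i₀) hc
  refine Units.ext ?_
  simpa [Matrix.GeneralLinearGroup.coe_scalar] using this

theorem evGL_matAut_constUnit (c : Rˣ) :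
    evGL n r R (matAut n r R (Matrix.GeneralLinearGroup.scalar (Fin r) (constUnit R c))) =
      Matrix.GeneralLinearGroup.scalar (Fin r) c := by
  rw [evGL_matAut, ← constGL_scalar, map_constantCoeff_constGL]

variable [Algebra ℂ R]

/-- The classes of the two factors of an element of `Aut(𝒟, ℳ_r)`. -/
def splitFun (hr : 1 ≤ r) (p : PairAut n r R) :
    (PairAut n 1 R ⧸ scalarAut n 1 R) × PGL(r, PowerSeries R) :=
  (QuotientGroup.mk (exists_factorization hr p).choose,
    Matrix.ProjGenLinGroup.mk (exists_factorization hr p).choose_spec.choose)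

/-- Any two normalized factorizations differ by a constant scalar, which is trivial in both targets;
the chosen factors therefore do not matter. -/
theorem splitFun_eq (hr : 1 ≤ r) (q : PairAut n 1 R) {g : GL (Fin r) (PowerSeries R)}
    (hg : HasConstDet g) :
    splitFun hr (diagAut n r R q * matAut n r R g) =
      (QuotientGroup.mk q, Matrix.ProjGenLinGroup.mk g) := by
  obtain ⟨h1, h2⟩ := (exists_factorization hr
    (diagAut n r R q * matAut n r R g)).choose_spec.choose_spec
  obtain ⟨c, hc, hc'⟩ := factorization_unique hr hg h1 h2
  refine Prod.ext (QuotientGroup.eq.2 ?_) ?_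
  · refine (mem_scalarAut_iff _).2 ⟨c, ?_⟩
    rw [inv_mul_eq_iff_eq_mul]
    exact hc
  · exact (Matrix.ProjGenLinGroup.mk_eq_mk_iff.2 ⟨_, hc'.symm⟩).symm

/-- The map `Aut(𝒟, ℳ_r) → Aut(𝒟, ℳ_1) / ℂ^* × PGL_h(r)`. -/
def splitAut (n : ℕ) (hr : 1 ≤ r) (R : Type) [CommRing R] [Algebra ℂ R] :
    PairAut n r R →* (PairAut n 1 R ⧸ scalarAut n 1 R) × PGL(r, PowerSeries R) :=
  MonoidHom.mk' (splitFun hr) fun p p' => by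
    obtain ⟨q, g, hg, rfl⟩ := exists_factorization hr p
    obtain ⟨q', g', hg', rfl⟩ := exists_factorization hr p'
    -- Diagonal automorphisms commute with matrices, so factorizations multiply factor by factor,
    -- and constant determinants are preserved.
    have h : diagAut n r R q * matAut n r R g * (diagAut n r R q' * matAut n r R g') =
        diagAut n r R (q * q') * matAut n r R (g * g') := by
      rw [map_mul, map_mul, mul_assoc, mul_assoc, ← mul_assoc (matAut n r R g),
        ← diagAut_mul_matAut, mul_assoc]
    rw [h, splitFun_eq hr _ hg, splitFun_eq hr _ hg', splitFun_eq hr _ (hg.mul hg')]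
    rfl

theorem splitAut_apply (hr : 1 ≤ r) (q : PairAut n 1 R) {g : GL (Fin r) (PowerSeries R)}
    (hg : HasConstDet g) : splitAut n hr R (diagAut n r R q * matAut n r R g) =
      (QuotientGroup.mk q, Matrix.ProjGenLinGroup.mk g) := splitFun_eq hr q hg

theorem splitAut_diagAut (hr : 1 ≤ r) (q : PairAut n 1 R) :
    splitAut n hr R (diagAut n r R q) = (QuotientGroup.mk q, 1) := by
  have := splitAut_apply hr q (hasConstDet_one (r := r) (R := R))
  rwa [map_one, mul_one] at this

theorem splitAut_matAut (hr : 1 ≤ r) {g : GL (Fin r) (PowerSeries R)} (hg : HasConstDet g) :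
    splitAut n hr R (matAut n r R g) = (1, Matrix.ProjGenLinGroup.mk g) := by
  have := splitAut_apply (n := n) hr 1 hg
  rwa [map_one, one_mul] at this

/-- Normalizing the determinant only rescales g, which leaves its class in PGL_h(r) unchanged and
moves the inverse scalar into the first factor. -/
theorem splitAut_matAut_snd (hr : 1 ≤ r) (g : GL (Fin r) (PowerSeries R)) :
    (splitAut n hr R (matAut n r R g)).2 = Matrix.ProjGenLinGroup.mk g := by
  obtain ⟨c, hc⟩ := exists_hasConstDet hr g
  have h : matAut n r R g = diagAut n r R (matAut n 1 R (Matrix.GeneralLinearGroup.scalar (Fin 1)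
      c⁻¹)) * matAut n r R (Matrix.GeneralLinearGroup.scalar (Fin r) c * g) := by
    rw [diagAut_matAut_scalar, ← map_mul, map_inv, inv_mul_cancel_left]
  rw [h, splitAut_apply hr _ hc, map_mul, Matrix.ProjGenLinGroup.mk_scalar, one_mul]

/-- If both classes are trivial, q is a constant scalar and g is a scalar of constant determinant,
hence also constant; their product is then a constant scalar. -/
theorem splitAut_eq_one_iff (hr : 1 ≤ r) (p : PairAut n r R) :
    splitAut n hr R p = 1 ↔ p ∈ scalarAut n r R := by
  constructor
  · intro h
    obtain ⟨q, g, hg, rfl⟩ := exists_factorization hr p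
    rw [splitAut_apply hr q hg, Prod.mk_eq_one, QuotientGroup.eq_one_iff, mem_scalarAut_iff,
      ← Matrix.ProjGenLinGroup.mk_one, eq_comm (a := Matrix.ProjGenLinGroup.mk g),
      Matrix.ProjGenLinGroup.mk_eq_mk_iff] at h
    obtain ⟨⟨c, rfl⟩, u, hu⟩ := h
    obtain ⟨d, rfl⟩ := eq_constUnit_of_hasConstDet hr hasConstDet_one u (hu ▸ hg)
    rw [mem_scalarAut_iff]
    refine ⟨c * d, ?_⟩
    rw [← hu, one_mul, diagAut_matAut_scalar, ← map_mul, ← map_mul, ← map_mul]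
  · rw [mem_scalarAut_iff]
    rintro ⟨c, rfl⟩
    rw [splitAut_matAut hr (hasConstDet_scalar c), Matrix.ProjGenLinGroup.mk_scalar]
    rfl

theorem exists_mk_eq_of_hasConstDet (hr : 1 ≤ r) (x : PGL(r, PowerSeries R)) :
    ∃ g : GL (Fin r) (PowerSeries R), HasConstDet g ∧ Matrix.ProjGenLinGroup.mk g = x := by
  obtain ⟨g, rfl⟩ := Matrix.ProjGenLinGroup.mk_surjective x
  obtain ⟨c, hc⟩ := exists_hasConstDet hr g
  exact ⟨_, hc, by rw [map_mul, Matrix.ProjGenLinGroup.mk_scalar, one_mul]⟩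

theorem splitAut_surjective (hr : 1 ≤ r) : Function.Surjective (splitAut n hr R) := by
  rintro ⟨x, y⟩
  obtain ⟨q, rfl⟩ := QuotientGroup.mk_surjective x
  obtain ⟨g, hg, rfl⟩ := exists_mk_eq_of_hasConstDet hr y
  exact ⟨_, splitAut_apply hr q hg⟩

/-- The diagonal factor acts on ℳ_r/𝔪ℳ_r by a scalar, so only the value of g at h = 0 is seen in
PGL(r). This is the condition placing `splitAut` and `evGL` together in the fibre product over
PGL(r). -/
theorem map_splitAut_snd (hr : 1 ≤ r) (p : PairAut n r R) :
    Matrix.ProjGenLinGroup.map (PowerSeries.constantCoeff (R := R)) (splitAut n hr R p).2 =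
      Matrix.ProjGenLinGroup.mk (evGL n r R p) := by
  obtain ⟨q, g, hg, rfl⟩ := exists_factorization hr p
  obtain ⟨c, hc⟩ := evGL_diagAut (r := r) q
  rw [splitAut_apply hr q hg, Matrix.ProjGenLinGroup.map_mk, map_mul, evGL_matAut, hc, map_mul,
    Matrix.ProjGenLinGroup.mk_scalar, one_mul]

/-- The unipotent part of an element of `Aut(𝒟, ℳ_r)`. -/
def expPart (hr : 1 ≤ r) (p : PairAut n r R) : expKer r R :=
  ⟨(splitAut n hr R p).2 * (Matrix.ProjGenLinGroup.mk (constGL r R (evGL n r R p)))⁻¹, by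
    rw [expKer, MonoidHom.mem_ker, map_mul, map_inv, map_splitAut_snd,
      Matrix.ProjGenLinGroup.map_mk, map_constantCoeff_constGL, mul_inv_cancel]⟩

/-- The map `Aut(𝒟, ℳ_r) → Aut(𝒟, ℳ_1) / ℂ^* × GL(r) ⋉ exp(h 𝔭𝔤𝔩_h(r))`. -/
def fullSplit (n : ℕ) (hr : 1 ≤ r) (R : Type) [CommRing R] [Algebra ℂ R] :
    PairAut n r R →* (PairAut n 1 R ⧸ scalarAut n 1 R) × SemiGL r R :=
  MonoidHom.mk' (fun p => ((splitAut n hr R p).1, ⟨expPart hr p, evGL n r R p⟩)) fun p p' => by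
    refine Prod.ext (by rw [map_mul]; rfl) (SemidirectProduct.ext (Subtype.ext ?_) ?_)
    -- With a the PGL_h(r)-component and g the class of `evGL`, the law is a a'(g g')⁻¹ = (a
    -- g⁻¹)·g(a' g'⁻¹)g⁻¹, the twisted product of the semidirect product.
    · change (splitAut n hr R (p * p')).2 *
        (Matrix.ProjGenLinGroup.mk (constGL r R (evGL n r R (p * p'))))⁻¹ =
        (splitAut n hr R p).2 * (Matrix.ProjGenLinGroup.mk (constGL r R (evGL n r R p)))⁻¹ *
        (Matrix.ProjGenLinGroup.mk (constGL r R (evGL n r R p)) *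
          ((splitAut n hr R p').2 *
            (Matrix.ProjGenLinGroup.mk (constGL r R (evGL n r R p')))⁻¹) *
          (Matrix.ProjGenLinGroup.mk (constGL r R (evGL n r R p)))⁻¹)
      simp only [map_mul, Prod.snd_mul]
      group
    · exact map_mul (evGL n r R) p p'

theorem fullSplit_fst (hr : 1 ≤ r) (p : PairAut n r R) :
    (fullSplit n hr R p).1 = (splitAut n hr R p).1 := rfl

theorem fullSplit_right (hr : 1 ≤ r) (p : PairAut n r R) :
    (fullSplit n hr R p).2.right = evGL n r R p := rfl

theorem fullSplit_left (hr : 1 ≤ r) (p : PairAut n r R) :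
    ((fullSplit n hr R p).2.left : PGL(r, PowerSeries R)) = (splitAut n hr R p).2 *
      (Matrix.ProjGenLinGroup.mk (constGL r R (evGL n r R p)))⁻¹ := rfl

theorem toPGL_fullSplit (hr : 1 ≤ r) (p : PairAut n r R) :
    SemiGL.toPGL r R (fullSplit n hr R p).2 = (splitAut n hr R p).2 := by
  rw [toPGL_apply, fullSplit_left, fullSplit_right, inv_mul_cancel_right]

theorem fullSplit_eq_iff (hr : 1 ≤ r) (p : PairAut n r R)
    (x : (PairAut n 1 R ⧸ scalarAut n 1 R) × SemiGL r R) :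
    fullSplit n hr R p = x ↔
      splitAut n hr R p = (x.1, SemiGL.toPGL r R x.2) ∧ evGL n r R p = x.2.right := by
  constructor
  · rintro rfl
    exact ⟨by rw [toPGL_fullSplit]; rfl, rfl⟩
  · rintro ⟨h1, h2⟩
    refine Prod.ext ((fullSplit_fst hr p).trans (congrArg Prod.fst h1)) (semiGL_ext ?_ h2)
    rw [toPGL_fullSplit, h1]

/-- The kernel of `splitAut` consists of constant scalars, and these are detected by `evGL`.
Conversely, a preimage under `splitAut` has the right image in PGL(r), so its `evGL` is off by one
constant scalar, and multiplying by that scalar does not disturb `splitAut`. -/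
theorem fullSplit_bijective (hr : 1 ≤ r) : Function.Bijective (fullSplit n hr R) := by
  constructor
  · rw [injective_iff_map_eq_one]
    intro p hp
    rw [fullSplit_eq_iff] at hp
    obtain ⟨h1, h2⟩ := hp
    have h3 : splitAut n hr R p = 1 := by
      rw [h1, Prod.snd_one, map_one]
      rfl
    rw [splitAut_eq_one_iff, mem_scalarAut_iff] at h3
    obtain ⟨c, rfl⟩ := h3
    rw [evGL_matAut_constUnit] at h2
    rw [scalar_eq_one hr h2, map_one, map_one, map_one]
  · rintro ⟨x, y⟩
    obtain ⟨p, hp⟩ := splitAut_surjective (n := n) hr (x, SemiGL.toPGL r R y)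
    have h1 := map_splitAut_snd hr p
    have h2 : Matrix.ProjGenLinGroup.map (PowerSeries.constantCoeff (R := R))
        (y.left : PGL(r, PowerSeries R)) = 1 := MonoidHom.mem_ker.1 y.left.2
    rw [hp, toPGL_apply, map_mul, h2, one_mul, Matrix.ProjGenLinGroup.map_mk,
      map_constantCoeff_constGL, eq_comm, Matrix.ProjGenLinGroup.mk_eq_mk_iff] at h1
    obtain ⟨c, hc⟩ := h1
    refine ⟨p * matAut n r R (Matrix.GeneralLinearGroup.scalar (Fin r) (constUnit R c)), ?_⟩
    rw [fullSplit_eq_iff, map_mul, map_mul, (splitAut_eq_one_iff hr _).2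
      ((mem_scalarAut_iff _).2 ⟨c, rfl⟩), mul_one, evGL_matAut_constUnit, hc]
    exact ⟨hp, rfl⟩

/-- The isomorphism `Aut(𝒟, ℳ_r) ≃ Aut(𝒟, ℳ_1) / ℂ^* × GL(r) ⋉ exp(h 𝔭𝔤𝔩_h(r))` on points. -/
def fullSplitEquiv (n : ℕ) (hr : 1 ≤ r) (R : Type) [CommRing R] [Algebra ℂ R] :
    PairAut n r R ≃* (PairAut n 1 R ⧸ scalarAut n 1 R) × SemiGL r R :=
  MulEquiv.ofBijective (fullSplit n hr R) (fullSplit_bijective hr)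

/-- The isomorphism `Aut(𝒟, ℳ_r) / ℂ^* ≃ Aut(𝒟, ℳ_1) / ℂ^* × PGL_h(r)` on points. -/
def quotSplitEquiv (n : ℕ) (hr : 1 ≤ r) (R : Type) [CommRing R] [Algebra ℂ R] :
    PairAut n r R ⧸ scalarAut n r R ≃*
      (PairAut n 1 R ⧸ scalarAut n 1 R) × PGL(r, PowerSeries R) :=
  MulEquiv.ofBijective (QuotientGroup.lift (scalarAut n r R) (splitAut n hr R)
      fun p hp => (splitAut_eq_one_iff hr p).2 hp) (by
    constructor
    · rw [injective_iff_map_eq_one]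
      intro x hx
      obtain ⟨p, rfl⟩ := QuotientGroup.mk_surjective x
      exact (QuotientGroup.eq_one_iff p).2 ((splitAut_eq_one_iff hr p).1 hx)
    · intro y
      obtain ⟨p, hp⟩ := splitAut_surjective (n := n) hr y
      exact ⟨QuotientGroup.mk p, hp⟩)

theorem quotSplitEquiv_mk (hr : 1 ≤ r) (p : PairAut n r R) :
    quotSplitEquiv n hr R (QuotientGroup.mk p) = splitAut n hr R p := rfl

variable {S : Type} [CommRing S] [Algebra ℂ S]

/-- A normalized factorization of p base-changes to one of p', because constancy of the determinant
in h survives a change of coefficients. -/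
theorem splitAut_of_baseChange (hr : 1 ≤ r) {ρ : R →+* S} {p : PairAut n r R} {p' : PairAut n r S}
    (h : PairAut.BaseChange ρ p p') :
    (∃ q q', QuotientGroup.mk q = (splitAut n hr R p).1 ∧
      QuotientGroup.mk q' = (splitAut n hr S p').1 ∧ PairAut.BaseChange ρ q q') ∧
    (splitAut n hr S p').2 =
      Matrix.ProjGenLinGroup.map (PowerSeries.map ρ) (splitAut n hr R p).2 := by
  obtain ⟨q, g, hg, rfl⟩ := exists_factorization hr p
  obtain ⟨q', hq', rfl⟩ := exists_baseChange_diagAut hr h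
  rw [splitAut_apply hr q hg, splitAut_apply hr q' (hg.map ρ)]
  exact ⟨⟨q, q', rfl, rfl, hq'⟩, rfl⟩

theorem exists_baseChange_of_splitAut (hr : 1 ≤ r) {ρ : R →+* S} {q : PairAut n 1 R}
    {q' : PairAut n 1 S} (h : PairAut.BaseChange ρ q q') (x : PGL(r, PowerSeries R)) :
    ∃ p p', splitAut n hr R p = (QuotientGroup.mk q, x) ∧
      splitAut n hr S p' =
        (QuotientGroup.mk q', Matrix.ProjGenLinGroup.map (PowerSeries.map ρ) x) ∧
      PairAut.BaseChange ρ p p' := by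
  obtain ⟨g, hg, rfl⟩ := exists_mk_eq_of_hasConstDet hr x
  exact ⟨_, _, splitAut_apply hr q hg, splitAut_apply hr q' (hg.map ρ),
    h.diagAut.mul (baseChange_matAut ρ g)⟩

/-- The data under `splitAut` lift to some pair s, s' related by base change. They determine p and
p' up to constant scalars c and c', and compatibility of `evGL` forces c' to be the base change of
c. -/
theorem baseChange_of_fullSplit (hr : 1 ≤ r) {ρ : R →+* S} {p : PairAut n r R}
    {p' : PairAut n r S} {q : PairAut n 1 R} {q' : PairAut n 1 S}
    (hq : QuotientGroup.mk q = (splitAut n hr R p).1)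
    (hq' : QuotientGroup.mk q' = (splitAut n hr S p').1) (h : PairAut.BaseChange ρ q q')
    (h2 : (splitAut n hr S p').2 =
      Matrix.ProjGenLinGroup.map (PowerSeries.map ρ) (splitAut n hr R p).2)
    (hev : evGL n r S p' = Matrix.GeneralLinearGroup.map ρ (evGL n r R p)) :
    PairAut.BaseChange ρ p p' := by
  obtain ⟨s, s', hs, hs', hss⟩ := exists_baseChange_of_splitAut hr h (splitAut n hr R p).2
  rw [hq] at hs
  rw [hq', ← h2] at hs'
  have key (R : Type) [CommRing R] [Algebra ℂ R] (p s : PairAut n r R)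
      (hsp : splitAut n hr R s = splitAut n hr R p) : ∃ c : Rˣ, p = s * matAut n r R
        (Matrix.GeneralLinearGroup.scalar (Fin r) (constUnit R c)) := by
    have h1 : splitAut n hr R (s⁻¹ * p) = 1 := by rw [map_mul, map_inv, hsp, inv_mul_cancel]
    rw [splitAut_eq_one_iff, mem_scalarAut_iff] at h1
    obtain ⟨c, hc⟩ := h1
    exact ⟨c, by rw [← hc, mul_inv_cancel_left]⟩
  obtain ⟨c, rfl⟩ := key R p s hs
  obtain ⟨c', rfl⟩ := key S p' s' hs'
  rw [map_mul, map_mul, map_mul, evGL_matAut_constUnit, evGL_matAut_constUnit, hss.evGL,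
    mul_right_inj] at hev
  have hc : Matrix.GeneralLinearGroup.scalar (Fin r) (constUnit S c') =
      Matrix.GeneralLinearGroup.map (PowerSeries.map ρ)
        (Matrix.GeneralLinearGroup.scalar (Fin r) (constUnit R c)) := by
    rw [← constGL_scalar, hev, Matrix.GeneralLinearGroup.map_scalar,
      Matrix.GeneralLinearGroup.map_scalar, constGL_scalar]
    congr 1
    exact Units.ext (PowerSeries.map_C ρ (c : R)).symm
  rw [hc]
  exact hss.mul (baseChange_matAut ρ _)

/-- The isomorphism of pro-algebraic groups
`Aut(𝒟, ℳ_r) ≃ Aut(𝒟, ℳ_1) / ℂ^* × GL(r) ⋉ exp(h 𝔭𝔤𝔩_h(r))`. -/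
def fullSplitIso (n : ℕ) (hr : 1 ≤ r) :
    (autGroup n r).Iso ((autModScalars n 1).prod (semiGroup r)) where
  equiv R _ _ := fullSplitEquiv n hr R
  bc_iff {R S} _ _ _ _ ρ p p' := by
    constructor
    · intro h
      have h : PairAut.BaseChange (ρ : R →+* S) p p' := h
      obtain ⟨⟨q, q', hq, hq', hqq⟩, h2⟩ := splitAut_of_baseChange hr h
      refine ⟨⟨q, q', hq, hq', hqq⟩, h.evGL, ?_⟩
      change (splitAut n hr S p').2 *
        (Matrix.ProjGenLinGroup.mk (constGL r S (evGL n r S p')))⁻¹ =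
        Matrix.ProjGenLinGroup.map (PowerSeries.map (ρ : R →+* S)) ((splitAut n hr R p).2 *
          (Matrix.ProjGenLinGroup.mk (constGL r R (evGL n r R p)))⁻¹)
      rw [map_mul, map_inv, ← h2, h.evGL, Matrix.ProjGenLinGroup.map_mk]
      rw [map_constGL]
    · rintro ⟨⟨q, q', hq, hq', hqq⟩, hev, h2⟩
      have hev : evGL n r S p' = Matrix.GeneralLinearGroup.map (ρ : R →+* S) (evGL n r R p) := hev
      refine baseChange_of_fullSplit hr hq hq' hqq ?_ hev
      rw [← toPGL_fullSplit, ← toPGL_fullSplit, toPGL_apply, toPGL_apply, map_mul,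
        Matrix.ProjGenLinGroup.map_mk]
      refine congrArg₂ (· * ·) h2 (congrArg Matrix.ProjGenLinGroup.mk ?_)
      rw [fullSplit_right, fullSplit_right, hev]
      exact (map_constGL _ _).symm

/-- The isomorphism of pro-algebraic groups
`Aut(𝒟, ℳ_r) / ℂ^* ≃ Aut(𝒟, ℳ_1) / ℂ^* × PGL_h(r)`. -/
def quotSplitIso (n : ℕ) (hr : 1 ≤ r) :
    (autModScalars n r).Iso ((autModScalars n 1).prod (pglGroup r)) where
  equiv R _ _ := quotSplitEquiv n hr R
  bc_iff {R S} _ _ _ _ ρ x x' := by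
    constructor
    · rintro ⟨p, p', rfl, rfl, h⟩
      exact splitAut_of_baseChange hr h
    · rintro ⟨⟨q, q', hq, hq', hqq⟩, h2⟩
      -- Base change in the quotient only asks for some representatives, so it suffices to build one
      -- compatible pair with the prescribed images and use injectivity.
      obtain ⟨s, s', hs, hs', hss⟩ :=
        exists_baseChange_of_splitAut hr hqq (quotSplitEquiv n hr R x).2
      refine ⟨s, s', (quotSplitEquiv n hr R).injective ?_, (quotSplitEquiv n hr S).injective ?_,
        hss⟩
      · rw [quotSplitEquiv_mk, hs, hq]
      · rw [quotSplitEquiv_mk, hs']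
        exact Prod.ext hq' h2.symm

end Splitting

/-! ### Passage to Der(𝒟, ℳ_r)/ℂ and the adjoint action -/

section Adjoint

variable {n r : ℕ}

/-- The constant c acts as the inner element (1/h)(ch), so the splitting places it entirely in
(1/h)𝒥. -/
theorem mem_scalarDer_iff (hr : 1 ≤ r) (X : PairDer n r) :
    X ∈ scalarDer n r ↔ (splitLie n hr X).1 ∈ constJ n ∧ (splitLie n hr X).2 = 0 := by
  have key (c : ℂ) : splitLie n hr (inner r (scalarJ n (PowerSeries.C c))) =
      (scalarJ n (PowerSeries.C c), 0) := by
    have := splitLie_inner_add_matDer hr (scalarJ n (PowerSeries.C c)) 0 (Matrix.trace_zero _ _)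
    rwa [map_zero, map_zero, add_zero] at this
  have hmod (c : ℂ) (m : FormalModule n r ℂ) :
      (inner r (scalarJ n (PowerSeries.C c))).mod m = c • m := by
    rw [inner_scalarJ, matDer_mod, matAct_scalar, C_smul_eq]
  constructor
  · rintro ⟨h1, c, hc⟩
    have hX : X = inner r (scalarJ n (PowerSeries.C c)) := PairDer.ext
      (fun a => by rw [h1, inner_scalarJ, matDer_alg]) fun m => by rw [hc, hmod]
    rw [hX, key]
    exact ⟨⟨c, C_smul_eq c _⟩, rfl⟩
  · rintro ⟨⟨c, hc⟩, h2⟩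
    have h1 : (splitLie n hr X).1 = scalarJ n (PowerSeries.C c) :=
      Subtype.ext (HInv.num.injective (by rw [hc, num_scalarJ, C_smul_eq]))
    have hX : X = inner r (scalarJ n (PowerSeries.C c)) :=
      (splitLie n hr).injective ((Prod.ext h1 h2).trans (key c).symm)
    rw [hX]
    exact ⟨fun a => by rw [inner_scalarJ, matDer_alg], c, hmod c⟩

/-- The map `Der(𝒟, ℳ_r) → (1/h) 𝒥 / ℂ ⊕ 𝔭𝔤𝔩_h(r)`. -/
def splitLieMod (n : ℕ) (hr : 1 ≤ r) : PairDer n r →ₗ[ℂ] (hInvJ n ⧸ constJ n) × PglH r :=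
  LinearMap.prodMap (LieSubmodule.Quotient.mk' (constJ n) : hInvJ n →ₗ[ℂ] hInvJ n ⧸ constJ n)
    LinearMap.id ∘ₗ (splitLie n hr : PairDer n r →ₗ[ℂ] hInvJ n × PglH r)

theorem splitLieMod_apply (hr : 1 ≤ r) (X : PairDer n r) : splitLieMod n hr X =
    (LieSubmodule.Quotient.mk' (constJ n) (splitLie n hr X).1, (splitLie n hr X).2) := rfl

theorem splitLieMod_eq_zero_iff (hr : 1 ≤ r) (X : PairDer n r) :
    splitLieMod n hr X = 0 ↔ X ∈ scalarDer n r := by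
  rw [mem_scalarDer_iff hr, splitLieMod_apply, Prod.mk_eq_zero, LieSubmodule.Quotient.mk_eq_zero]

/-- The homomorphism `Der(𝒟, ℳ_r) / ℂ → (1/h) 𝒥 / ℂ ⊕ 𝔭𝔤𝔩_h(r)`. -/
def quotSplitLieHom (n : ℕ) (hr : 1 ≤ r) :
    (PairDer n r ⧸ scalarDer n r) →ₗ⁅ℂ⁆ (hInvJ n ⧸ constJ n) × PglH r where
  __ := Submodule.liftQ (scalarDer n r).toSubmodule (splitLieMod n hr)
    fun X hX => (splitLieMod_eq_zero_iff hr X).2 hX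
  map_lie' {x y} := by
    obtain ⟨X, rfl⟩ := LieSubmodule.Quotient.surjective_mk' _ x
    obtain ⟨Y, rfl⟩ := LieSubmodule.Quotient.surjective_mk' _ y
    change splitLieMod n hr ⁅X, Y⁆ = ⁅splitLieMod n hr X, splitLieMod n hr Y⁆
    rw [splitLieMod_apply, LieEquiv.map_lie]
    rfl

/-- The isomorphism `Der(𝒟, ℳ_r) / ℂ ≃ (1/h) 𝒥 / ℂ ⊕ 𝔭𝔤𝔩_h(r)`. -/
def quotSplitLie (n : ℕ) (hr : 1 ≤ r) :
    (PairDer n r ⧸ scalarDer n r) ≃ₗ⁅ℂ⁆ (hInvJ n ⧸ constJ n) × PglH r :=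
  LieEquiv.ofBijective (quotSplitLieHom n hr) (by
    constructor
    · rw [injective_iff_map_eq_zero]
      intro x hx
      obtain ⟨X, rfl⟩ := LieSubmodule.Quotient.surjective_mk' _ x
      exact (LieSubmodule.Quotient.mk_eq_zero _).2 ((splitLieMod_eq_zero_iff hr X).1 hx)
    · rintro ⟨x, y⟩
      obtain ⟨α, rfl⟩ := LieSubmodule.Quotient.surjective_mk' _ x
      refine ⟨LieSubmodule.Quotient.mk' (scalarDer n r) ((splitLie n hr).symm (α, y)), ?_⟩
      change splitLieMod n hr _ = _
      rw [splitLieMod_apply, LieEquiv.apply_symm_apply])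

theorem quotSplitLie_mk (hr : 1 ≤ r) (X : PairDer n r) :
    quotSplitLie n hr (LieSubmodule.Quotient.mk' (scalarDer n r) X) =
      (LieSubmodule.Quotient.mk' (constJ n) (splitLie n hr X).1, (splitLie n hr X).2) := rfl

/-- Conjugating the operator a by Ψ gives Φ(a), and Φ fixes h. Only the algebra component matters,
so the answer may be expressed through any q with the same Φ. -/
theorem conjDer_inner (p : PairAut n r ℂ) (q : PairAut n 1 ℂ) (h : p.alg = q.alg) (α : hInvJ n) :
    conjDer n r p (inner r α) = inner r (actJ n q α) := by
  refine (isInner_iff _ _).1 ⟨fun b => ?_, fun m => ?_⟩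
  · rw [conjDer_alg, num_actJ, ← alg_h p, ← map_mul p.alg, inner_alg, map_sub, map_mul, map_mul,
      AlgEquiv.apply_symm_apply, h]
  · rw [conjDer_mod, num_actJ, ← map_smul p.mod, inner_mod, p.mod_smul,
      LinearEquiv.apply_symm_apply, h]

theorem conjDer_matDer (q : PairAut n 1 ℂ) (g : GL (Fin r) (PowerSeries ℂ)) (A : GlH r) :
    conjDer n r (diagAut n r ℂ q * matAut n r ℂ g) (matDer n r A) =
      matDer n r (conjGlH r g A) := by
  refine PairDer.ext (fun a => ?_) fun m => ?_
  · rw [conjDer_alg, matDer_alg, matDer_alg, map_zero]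
  · set p := diagAut n r ℂ q * matAut n r ℂ g with hp
    obtain ⟨m, rfl⟩ := p.mod.surjective m
    have hcomm (B : GlH r) (m : FormalModule n r ℂ) : (diagAut n r ℂ q).mod (matAct n r ℂ B m) =
        matAct n r ℂ B ((diagAut n r ℂ q).mod m) := funext fun i => by
      rw [diagAut_mod, matAct_apply, matAct_apply, map_sum]
      exact Finset.sum_congr rfl fun j _ => map_smul _ _ _
    rw [conjDer_mod, LinearEquiv.symm_apply_apply, matDer_mod, matDer_mod, hp, PairAut.mod_mul,
      PairAut.mod_mul, matAut_mod, matAut_mod, hcomm, hcomm, hcomm, conjGlH_apply,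
      ← Module.End.mul_apply, ← Module.End.mul_apply, ← map_mul, ← map_mul, mul_assoc,
      Units.inv_mul, mul_one]

theorem trace_conjGlH (g : GL (Fin r) (PowerSeries ℂ)) (A : GlH r) :
    (conjGlH r g A).trace = A.trace := by
  rw [conjGlH_apply, Matrix.trace_mul_comm, ← mul_assoc, Units.inv_mul, one_mul]

/-- The diagonal factor moves (1/h)𝒥 and centralizes matrices, whereas the matrix factor fixes
(1/h)𝒥 and conjugates matrices. Conjugation preserves the trace, so the decomposition is respected.
-/
theorem splitLie_conjDer (hr : 1 ≤ r) (q : PairAut n 1 ℂ) (g : GL (Fin r) (PowerSeries ℂ))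
    (X : PairDer n r) : splitLie n hr (conjDer n r (diagAut n r ℂ q * matAut n r ℂ g) X) =
      (actJ n q (splitLie n hr X).1,
        conjPglH r (Matrix.ProjGenLinGroup.mk g) (splitLie n hr X).2) := by
  obtain ⟨α, A, hA, rfl⟩ := exists_inner_add_traceless hr X
  rw [map_add, conjDer_matDer, conjDer_inner _ q
    (by rw [PairAut.alg_mul, matAut_alg, mul_one, diagAut_alg]),
    splitLie_inner_add_matDer hr _ _ ((trace_conjGlH g A).trans hA),
    splitLie_inner_add_matDer hr _ _ hA]
  rfl

end Adjoint

/-! ### Tangent vectors over the dual numbers -/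

section Tangent

variable {n r : ℕ}

theorem epsC_mul_epsC : epsC * epsC = 0 := by
  rw [← map_mul, DualNumber.eps_mul_eps, map_zero]

theorem add_epsC_smul {M : Type} [AddCommGroup M] [Module (PowerSeries (DualNumber ℂ)) M]
    (m x y z : M) : m + epsC • x + epsC • (y + epsC • z) = m + epsC • (x + y) := by
  rw [smul_add, smul_add, ← mul_smul, epsC_mul_epsC, zero_smul, add_zero, add_assoc]

theorem formalModule_map_smul {R S : Type} [CommRing R] [CommRing S] (ρ : R →+* S)
    (c : PowerSeries R) (m : FormalModule n r R) :
    FormalModule.map ρ (c • m) = PowerSeries.map ρ c • FormalModule.map ρ m :=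
  funext fun i => map_smul_vac ρ c (m i)

theorem weyl_map_add {R S : Type} [CommRing R] [CommRing S] (ρ : R →+* S) (a b : Weyl n R) :
    Weyl.map ρ (a + b) = Weyl.map ρ a + Weyl.map ρ b :=
  map_add (PowerSeries.map (MvPowerSeries.map (σ := Fin n ⊕ Fin n) ρ)) a b

theorem weyl_map_h_mul {R S : Type} [CommRing R] [CommRing S] (ρ : R →+* S) (a : Weyl n R) :
    Weyl.map ρ (Weyl.h * a) = Weyl.h * Weyl.map ρ a := by
  rw [Weyl.h_mul, Weyl.h_mul]
  change PowerSeries.map (MvPowerSeries.map ρ) (Weyl.symbol ((PowerSeries.X : PowerSeries R) • a)) =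
    Weyl.symbol ((PowerSeries.X : PowerSeries S) • Weyl.map ρ a)
  rw [Weyl.symbol_X_smul, Weyl.symbol_X_smul, map_mul, PowerSeries.map_X]
  rfl

/-- The cross term carries ε² = 0. -/
theorem IsTangentDer.mul {p q : PairAut n r (DualNumber ℂ)} {X Y : PairDer n r}
    (hp : IsTangentDer p X) (hq : IsTangentDer q Y) : IsTangentDer (p * q) (X + Y) := by
  refine ⟨fun a => ?_, fun m => ?_⟩
  · rw [PairAut.alg_mul, AlgEquiv.mul_apply, hq.1, map_add, map_smul, hp.1, hp.1, PairDer.alg_add,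
      weyl_map_add]
    exact add_epsC_smul (M := Weyl n (DualNumber ℂ)) _ _ _ _
  · rw [PairAut.mod_mul, hq.2, map_add, map_smul, hp.2, hp.2, PairDer.mod_add,
      formalModule_map_add]
    exact add_epsC_smul (M := FormalModule n r (DualNumber ℂ)) _ _ _ _

theorem dualMat_mul (A B : GlH r) :
    (1 + epsC • A.map (PowerSeries.map dualIncl)) * (1 + epsC • B.map (PowerSeries.map dualIncl)) =
      1 + epsC • (A + B).map (PowerSeries.map dualIncl) := by
  rw [Matrix.map_add _ (map_add _), mul_add, mul_one, add_mul, one_mul, smul_mul_smul_comm,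
    epsC_mul_epsC, zero_smul, add_zero, smul_add, add_assoc]

/-- The `ℂ[ε]`-point `1 + ε A` of `GL_h(r)`. -/
def dualGL (A : GlH r) : GL (Fin r) (PowerSeries (DualNumber ℂ)) where
  val := 1 + epsC • A.map (PowerSeries.map dualIncl)
  inv := 1 + epsC • (-A).map (PowerSeries.map dualIncl)
  val_inv := by
    rw [dualMat_mul, add_neg_cancel, Matrix.map_zero _ (map_zero _), smul_zero, add_zero]
  inv_val := by
    rw [dualMat_mul, neg_add_cancel, Matrix.map_zero _ (map_zero _), smul_zero, add_zero]

theorem val_dualGL (A : GlH r) : (dualGL A : Matrix (Fin r) (Fin r) (PowerSeries (DualNumber ℂ))) =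
    1 + epsC • A.map (PowerSeries.map dualIncl) := rfl

theorem isTangentGl_iff (g : GL (Fin r) (PowerSeries (DualNumber ℂ))) (A : GlH r) :
    IsTangentGl g A ↔ g = dualGL A := ⟨fun h => Units.ext h, fun h => h ▸ val_dualGL A⟩

theorem dualGL_add (A B : GlH r) : dualGL (A + B) = dualGL A * dualGL B :=
  Units.ext (dualMat_mul A B).symm

theorem dualGL_neg (A : GlH r) : dualGL (-A) = (dualGL A)⁻¹ := Units.ext rfl

theorem mk_dualGL_scalar (c : PowerSeries ℂ) :
    Matrix.ProjGenLinGroup.mk (dualGL (Matrix.scalar (Fin r) c)) = 1 := by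
  have h (d : PowerSeries ℂ) : (1 + epsC * PowerSeries.map dualIncl d) *
      (1 + epsC * PowerSeries.map dualIncl (-d)) = 1 := by
    have := epsC_mul_epsC
    rw [map_neg]
    linear_combination -(PowerSeries.map dualIncl d) ^ 2 * this
  have h' : (1 + epsC * PowerSeries.map dualIncl (-c)) *
      (1 + epsC * PowerSeries.map dualIncl c) = 1 := (mul_comm _ _).trans (h c)
  let u : (PowerSeries (DualNumber ℂ))ˣ := ⟨_, _, h c, h'⟩
  refine Eq.trans (congrArg _ (Units.ext (Matrix.ext fun i j => ?_)))
    (Matrix.ProjGenLinGroup.mk_scalar (n := Fin r) u)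
  rw [val_dualGL]
  change _ = Matrix.scalar (Fin r) (1 + epsC * PowerSeries.map dualIncl c) i j
  rw [Matrix.add_apply, Matrix.smul_apply, Matrix.map_apply, Matrix.scalar_apply,
    Matrix.scalar_apply, Matrix.diagonal_apply, Matrix.diagonal_apply, Matrix.one_apply]
  split_ifs
  · rfl
  · rw [map_zero, smul_zero, add_zero]

/-- det(1 + εA) = 1 + ε tr A. The traceless normalization of the Lie algebra is thus compatible with
the determinant normalization of the group, which is why the two splittings agree. -/
theorem hasConstDet_dualGL (A : GlH r) (hA : A.trace = 0) : HasConstDet (dualGL A) := by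
  refine ⟨1, ?_⟩
  have h : (A.map (PowerSeries.map dualIncl)).trace = 0 := by
    rw [← AddMonoidHom.map_trace, hA, map_zero]
  rw [val_dualGL, Matrix.det_one_add_smul, h, zero_mul, add_zero, sq, epsC_mul_epsC, mul_zero,
    add_zero, map_one]

theorem matAct_matrix_smul {R : Type} [CommRing R] (c : PowerSeries R)
    (A : Matrix (Fin r) (Fin r) (PowerSeries R)) (m : FormalModule n r R) :
    matAct n r R (c • A) m = c • matAct n r R A m := by
  funext i
  rw [matAct_apply, Pi.smul_apply, matAct_apply, Finset.smul_sum]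
  exact Finset.sum_congr rfl fun j _ => mul_smul c (A i j) (m j)

theorem smul_single_vac {R : Type} [CommRing R] (c : PowerSeries R) (i : Fin r) (w : Vac n R) :
    c • (Pi.single i w : FormalModule n r R) = Pi.single i (c • w) := by
  funext j
  rw [Pi.smul_apply]
  by_cases hj : j = i
  · subst hj
    rw [Pi.single_eq_same, Pi.single_eq_same]
  · rw [Pi.single_eq_of_ne hj, Pi.single_eq_of_ne hj, smul_zero]

theorem isTangentDer_matAut (A : GlH r) :
    IsTangentDer (matAut n r (DualNumber ℂ) (dualGL A)) (matDer n r A) := by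
  refine ⟨fun a => ?_, fun m => ?_⟩
  · rw [matAut_alg, AlgEquiv.one_apply, matDer_alg]
    have : Weyl.map dualIncl (0 : Weyl n ℂ) = 0 :=
      map_zero (PowerSeries.map (MvPowerSeries.map (σ := Fin n ⊕ Fin n) dualIncl))
    rw [this, smul_zero, add_zero]
  · rw [matAut_mod, matDer_mod, formalModule_map_matAct, val_dualGL, map_add, map_one,
      LinearMap.add_apply, Module.End.one_apply]
    exact congrArg _ (matAct_matrix_smul _ _ _)

theorem inner_mod_apply (α : hInvJ n) (m : FormalModule n r ℂ) (i : Fin r) :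
    (inner r α).mod m i = (inner 1 α).mod (fun _ => m i) 0 := by
  have h1 := congrFun (inner_mod α m) i
  have h2 := congrFun (inner_mod (r := 1) α fun _ => m i) 0
  rw [Pi.smul_apply, Pi.smul_apply, X_smul_vac] at h1 h2
  exact PowerSeries.X_mul_cancel (h1.trans h2.symm)

/-- The conditions defining `IsTangentJ` are those for the inner derivation multiplied by h, and h
is cancellable on both 𝒟 and ℳ_1. -/
theorem isTangentJ_iff (q : PairAut n 1 (DualNumber ℂ)) (α : hInvJ n) :
    IsTangentJ q α ↔ IsTangentDer q (inner 1 α) := by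
  have hX (m : FormalModule n 1 ℂ) : FormalModule.map dualIncl (HInv.num α.1 • m) =
      (PowerSeries.X : PowerSeries (DualNumber ℂ)) •
        FormalModule.map dualIncl ((inner 1 α).mod m) := by
    rw [← inner_mod, formalModule_map_smul, PowerSeries.map_X]
  refine and_congr (forall_congr' fun a => ?_) (forall_congr' fun m => ?_)
  · rw [← inner_alg, weyl_map_h_mul, ← mul_smul_comm, ← sub_eq_iff_eq_add']
    exact ⟨Weyl.h_mul_cancel, congrArg _⟩
  · rw [hX, smul_comm, ← sub_eq_iff_eq_add']
    exact ⟨X_smul_module_cancel, congrArg _⟩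

theorem isTangentDer_diagAut_iff (hr : 1 ≤ r) (q : PairAut n 1 (DualNumber ℂ)) (α : hInvJ n) :
    IsTangentDer (diagAut n r (DualNumber ℂ) q) (inner r α) ↔ IsTangentDer q (inner 1 α) := by
  let T (v : Vac n ℂ) : Vac n (DualNumber ℂ) := PowerSeries.map (MvPowerSeries.map dualIncl) v
  have key (s : ℕ) (f : FormalModule n s ℂ) (i : Fin s) :
      (FormalModule.map dualIncl f + epsC • FormalModule.map dualIncl ((inner s α).mod f)) i =
        T (f i) + epsC • T ((inner 1 α).mod (fun _ => f i) 0) := by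
    rw [← inner_mod_apply]
    rfl
  refine and_congr Iff.rfl ⟨fun h m => funext fun i => ?_, fun h m => funext fun i => ?_⟩
  · have h1 := congrFun (h fun _ => m 0) ⟨0, hr⟩
    rw [key] at h1
    rw [key, Subsingleton.elim i 0, PairAut.mod_eq_vac]
    exact h1
  · have h1 := congrFun (h fun _ => m i) 0
    rw [key] at h1
    rw [key]
    exact h1

theorem IsTangentJ.diagAut_mul_matAut (hr : 1 ≤ r) {q : PairAut n 1 (DualNumber ℂ)} {α : hInvJ n}
    (h : IsTangentJ q α) (A : GlH r) : IsTangentDer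
      (diagAut n r (DualNumber ℂ) q * matAut n r (DualNumber ℂ) (dualGL A))
      (inner r α + matDer n r A) :=
  ((isTangentDer_diagAut_iff hr q α).2 ((isTangentJ_iff q α).1 h)).mul (isTangentDer_matAut A)

/-- Multiplying by 1 - εA leaves 1 + εα. As α acts identically in every coordinate, the result sends
all basis vectors to the same multiple of themselves, so it is diagonal. -/
theorem IsTangentDer.exists_factorization (hr : 1 ≤ r) {p : PairAut n r (DualNumber ℂ)}
    {α : hInvJ n} {A : GlH r} (h : IsTangentDer p (inner r α + matDer n r A)) :
    ∃ q, IsTangentJ q α ∧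
      p = diagAut n r (DualNumber ℂ) q * matAut n r (DualNumber ℂ) (dualGL A) := by
  have h1 := h.mul (isTangentDer_matAut (-A))
  rw [add_assoc, ← map_add, add_neg_cancel, map_zero, add_zero] at h1
  -- The vector (1 + εα)·1, the common coefficient of the images of the basis vectors.
  let w : Vac n (DualNumber ℂ) := 1 + epsC • PowerSeries.map (MvPowerSeries.map dualIncl)
    ((inner 1 α).mod (fun _ => 1) 0)
  obtain ⟨q, hq⟩ := exists_eq_diagAut hr _ w fun i => by
    have h2 : (inner r α).mod (Pi.single i 1) =
        Pi.single i ((inner 1 α).mod (fun _ => 1) 0) := funext fun j => by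
      rw [inner_mod_apply]
      by_cases hj : j = i
      · subst hj
        rw [Pi.single_eq_same, Pi.single_eq_same]
      · rw [Pi.single_eq_of_ne hj, Pi.single_eq_of_ne hj]
        exact congrFun (map_zero (inner 1 α).mod) 0
    rw [← formalModule_map_single_one dualIncl, h1.2, h2, formalModule_map_single,
      formalModule_map_single, map_one, Pi.single_add]
    exact congrArg _ (smul_single_vac epsC i _)
  refine ⟨q, ?_, ?_⟩
  · rw [isTangentJ_iff, ← isTangentDer_diagAut_iff hr, ← hq]
    exact h1
  · rw [← hq, dualGL_neg, map_inv, inv_mul_cancel_right]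

/-- With A traceless, diag(1 + εα)·(1 + εA) is a normalized factorization, so the group splitting
reads off α and A exactly as the Lie algebra splitting does. -/
theorem isTangentDer_mk_iff (hr : 1 ≤ r) (g : PairAut n r (DualNumber ℂ) ⧸ scalarAut n r _)
    (x : PairDer n r ⧸ scalarDer n r) : (autPairModScalars n r).tangent g x ↔
      ((jPair n).prod (pglPair r)).tangent (quotSplitEquiv n hr (DualNumber ℂ) g)
        (quotSplitLie n hr x) := by
  constructor
  · rintro ⟨p, X, rfl, rfl, h⟩
    obtain ⟨α, A, hA, rfl⟩ := exists_inner_add_traceless hr X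
    obtain ⟨q, hq, rfl⟩ := h.exists_factorization hr
    rw [quotSplitEquiv_mk, splitAut_apply hr q (hasConstDet_dualGL A hA), quotSplitLie_mk,
      splitLie_inner_add_matDer hr α A hA]
    exact ⟨⟨q, α, rfl, rfl, hq⟩, dualGL A, A, rfl, rfl, val_dualGL A⟩
  · rintro ⟨⟨q, α, hq, hα, h⟩, k, A, hk, hA, hkA⟩
    rw [isTangentGl_iff] at hkA
    subst hkA
    have htr := trace_traceless hr A
    -- The given representative A need not be traceless. Replacing it by its traceless part changes
    -- 1 + εA by a scalar matrix 1 + εc, trivial in PGL_h(r), and does not change the class in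
    -- 𝔭𝔤𝔩_h(r).
    have hA' : traceless r A + Matrix.scalar (Fin r) ((r : ℂ)⁻¹ • A.trace) = A := by
      rw [traceless_apply, sub_add_cancel]
    refine ⟨_, _, (quotSplitEquiv n hr (DualNumber ℂ)).injective ?_,
      (quotSplitLie n hr).injective ?_, h.diagAut_mul_matAut hr (traceless r A)⟩
    · rw [quotSplitEquiv_mk, splitAut_apply hr q (hasConstDet_dualGL _ htr)]
      refine Prod.ext hq (Eq.trans ?_ hk)
      rw [← hA', dualGL_add, map_mul, mk_dualGL_scalar, mul_one, hA']
    · refine (quotSplitLie_mk hr _).trans ?_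
      rw [splitLie_inner_add_matDer hr _ _ htr]
      refine Prod.ext hα (Eq.trans ?_ hA)
      rw [← pglSection_mk hr, mk_pglSection]

/-- The isomorphism of Harish-Chandra pairs
`⟨Aut(𝒟, ℳ_r), Der(𝒟, ℳ_r)⟩ / ⟨ℂ^*, ℂ⟩ ≃ ⟨Aut(𝒟, ℳ_1) / ℂ^*, (1/h) 𝒥 / ℂ⟩ × ⟨PGL_h(r), 𝔭𝔤𝔩_h(r)⟩`. -/
def quotSplitPairIso (n : ℕ) (hr : 1 ≤ r) :
    (autPairModScalars n r).Iso ((jPair n).prod (pglPair r)) where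
  grp := quotSplitIso n hr
  lie := quotSplitLie n hr
  act_comm g x := by
    obtain ⟨p, rfl⟩ := QuotientGroup.mk_surjective g
    obtain ⟨X, rfl⟩ := LieSubmodule.Quotient.surjective_mk' _ x
    obtain ⟨q, k, hk, rfl⟩ := exists_factorization hr p
    change quotSplitLie n hr (LieSubmodule.Quotient.mk' (scalarDer n r)
      (conjDer n r (diagAut n r ℂ q * matAut n r ℂ k) X)) =
      ((jPair n).prod (pglPair r)).act (splitAut n hr ℂ (diagAut n r ℂ q * matAut n r ℂ k)) _
    rw [splitAut_apply hr q hk, quotSplitLie_mk, quotSplitLie_mk, splitLie_conjDer]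
    rfl
  tangent_iff := isTangentDer_mk_iff hr

end Tangent

/-! ### Constant matrices have constant determinant -/

section Splitting

variable {r : ℕ} {R : Type} [CommRing R]

theorem hasConstDet_constGL (g : GL (Fin r) R) : HasConstDet (constGL r R g) := by
  refine ⟨(g : Matrix (Fin r) (Fin r) R).det, ?_⟩
  rw [RingHom.map_det]
  rfl

end Splitting

end FormalQuant

end

/-! ### The splitting theorem -/

theorem lemma6 (n r : ℕ) (hr : 1 ≤ r) :
    ∃ (F : (autGroup n r).Iso ((autModScalars n 1).prod (semiGroup r)))
      (L : PairDer n r ≃ₗ⁅ℂ⁆ hInvJ n × PglH r)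
      (I : (autPairModScalars n r).Iso ((jPair n).prod (pglPair r))),
      (∀ (R : Type) [CommRing R] [Algebra ℂ R] (p : PairAut n r R),
        (∀ q : PairAut n 1 R, p.IsDiag q →
          (F.equiv R p).1 = QuotientGroup.mk q ∧
          ∃ c : Rˣ, (F.equiv R p).2 =
            SemidirectProduct.inr (Matrix.GeneralLinearGroup.scalar (Fin r) c)) ∧
        (∀ g : GL (Fin r) R, p.IsMatrix (constGL r R g) →
          F.equiv R p = (1, SemidirectProduct.inr g)) ∧
        (∀ g : GL (Fin r) (PowerSeries R), p.IsMatrix g →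
          ((∃ d : R, (g : Matrix (Fin r) (Fin r) (PowerSeries R)).det = PowerSeries.C d) →
            (F.equiv R p).1 = 1) ∧
          SemiGL.toPGL r R (F.equiv R p).2 = Matrix.ProjGenLinGroup.mk g)) ∧
      (∀ α : hInvJ n, (L.symm (α, 0)).IsInner α) ∧
      (∀ (X : PairDer n r) (A : GlH r), X.IsMatrix A → A.trace = 0 →
        L X = (0, LieSubmodule.Quotient.mk' (scalarGlH r) A)) ∧
      (∀ (R : Type) [CommRing R] [Algebra ℂ R] (p : PairAut n r R),
        I.grp.equiv R (QuotientGroup.mk p) =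
          ((F.equiv R p).1, SemiGL.toPGL r R (F.equiv R p).2)) ∧
      (∀ X : PairDer n r,
        I.lie (LieSubmodule.Quotient.mk' (scalarDer n r) X) =
          (LieSubmodule.Quotient.mk' (constJ n) (L X).1, (L X).2)) := by
  refine ⟨fullSplitIso n hr, splitLie n hr, quotSplitPairIso n hr, fun R _ _ p =>
    ⟨fun q hq => ?_, fun g hg => ?_, fun g hg => ?_⟩, fun α => ?_, fun X A hX hA => ?_,
    fun R _ _ p => ?_, fun X => rfl⟩
  · rw [isDiag_iff] at hq
    subst hq
    obtain ⟨c, hc⟩ := evGL_diagAut (r := r) q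
    refine ⟨congrArg Prod.fst (splitAut_diagAut hr q), c, congrArg Prod.snd
      ((fullSplit_eq_iff hr _ (QuotientGroup.mk q, SemidirectProduct.inr _)).2 ⟨?_, hc⟩)⟩
    -- The scalar in GL(r) recorded by `evGL` becomes trivial in PGL_h(r), in agreement with the
    -- trivial matrix factor of a diagonal automorphism.
    rw [splitAut_diagAut, toPGL_apply, SemidirectProduct.left_inr, SemidirectProduct.right_inr,
      constGL_scalar, Matrix.ProjGenLinGroup.mk_scalar, Subgroup.coe_one, one_mul]
  · rw [isMatrix_iff] at hg
    subst hg
    refine (fullSplit_eq_iff hr _ _).2 ⟨?_, by rw [evGL_matAut, map_constantCoeff_constGL]; rfl⟩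
    rw [splitAut_matAut hr (hasConstDet_constGL g), toPGL_apply, SemidirectProduct.left_inr,
      SemidirectProduct.right_inr, Subgroup.coe_one, one_mul]
  · rw [isMatrix_iff] at hg
    subst hg
    exact ⟨fun hd => congrArg Prod.fst (splitAut_matAut hr hd),
      (toPGL_fullSplit hr _).trans (splitAut_matAut_snd hr g)⟩
  · rw [isInner_iff, splitLie_symm, map_zero, map_zero, add_zero]
  · rw [isMatrix_der_iff] at hX
    have h := splitLie_inner_add_matDer hr (0 : hInvJ n) A hA
    rwa [← innerLie_apply, map_zero, zero_add, ← hX] at h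
  · exact Prod.ext rfl (toPGL_fullSplit hr p).symm
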